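/- Notation. Let $\mathbb T=\mathbb R/2\pi\mathbb Z$, let $\Theta\in C^\infty(\mathbb R)$ be a mollifier ($\Theta\ge 0$, $\Theta=0$ outside $(-1,1)$, $\int\Theta=1$), and $\Theta_\kappa(z)=\kappa^{-1}\Theta(z/\kappa)$. Put $\varphi_0(z)=\frac{1-z}{2}$ and, for $\kappa>0$, $$\varphi_\kappa(z)=1-\frac{\int_{-1}^z\psi_\kappa'(s)\,ds}{\int_{-1}^1\psi_\kappa'(s)\,ds},\qquad \psi'_\kappa(z)=\int_{-1+\kappa}^{1-\kappa}\Theta_\kappa(z-s)\,ds .$$ For $0<\varepsilon<1$ let $\varpi_{\varepsilon,\kappa}$ be the even function with $\varpi_{\varepsilon,\kappa}(y)=\varepsilon$ for $0\le y<1-\varepsilon$, $\varpi_{\varepsilon,\kappa}(y)=\varepsilon\varphi_\kappa(\frac{y-1}{\varepsilon})$ for $1-\varepsilon\le y\le 1+\varepsilon$, and $\varpi_{\varepsilon,\kappa}(y)=0$ for $y>1+\varepsilon$. Let $I_\varepsilon=[-1-\varepsilon,-1+\varepsilon]\cup[1-\varepsilon,1+\varepsilon]$ and $D_\varepsilon=\mathbb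 T\times I_\varepsilon$. Let $X(D_\varepsilon)$ be the space of real functions $g$ on $D_\varepsilon$ (modulo equality almost everywhere) whose weak derivatives $\partial_x^i\partial_y^j g$ with $j\le 3$, $i+j\le 4$ all lie in $L^2(D_\varepsilon)$, and which are even in $x$ with $\int_{-\pi}^{\pi}g(x,y)\,dx=0$ for a.e. $y\in I_\varepsilon$. For $\lambda\in\mathbb R$ and $g\in X(D_\varepsilon)$ let $$\mathcal L_{\varepsilon,\kappa}[\lambda]g(x,y)=(\lambda+y)\,\partial_xg(x,y)-\frac1{4\pi}\int_{\mathbb T\times I_\varepsilon}\varpi_{\varepsilon,\kappa}'(\bar y)\log\big[\cosh(y-\bar y)-\cos(x-\bar x)\big]\big(\partial_xg(x,y)-\partial_xg(\bar x,\bar y)\big)\,d\bar x\,d\bar y .$$ Theorem 4.1. For every $M>1$ there are constants $\kappa_0,\varepsilon_0,C>0$ depending only on $M$ such that, for every $0\le\kappa<\kappa_0$ and every integer $m$ with $1\le m<M$, there is a number $\lambda_1=\lambda_{1}(\kappa,m)$ with $|\lambda_1|\le C$ such that for every $0<\varepsilon<\varepsilon_0$ there exist $\lambda=\lambda_{\varepsilon,\kappa,m}\in\mathbb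 R$ with $$|\lambda-1-\lambda_1\varepsilon|\le C\varepsilon^2$$ and a function $h=h_{\varepsilon,\kappa,m}\in X(D_\varepsilon)\cap C^\infty(D_\varepsilon)$ (smooth up to the boundary) that is not identically zero, is $\frac{2\pi}{m}$-periodic in $x$, depends nontrivially on $x$, and satisfies $\mathcal L_{\varepsilon,\kappa}[\lambda]h=0$. Moreover, the kernel of $\mathcal L_{\varepsilon,\kappa}[\lambda]$ on $X(D_\varepsilon)$ is exactly $\operatorname{span}\{h\}$. -/

import Mathlib

open MeasureTheory Set
open scoped ContDiff

namespace CouetteWave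

/-- A mollifier: smooth, nonnegative, vanishing outside `(-1,1)`, of integral one. -/
structure IsMollifier (Θ : ℝ → ℝ) : Prop where
  smooth : ContDiff ℝ ∞ Θ
  nonneg : ∀ z, 0 ≤ Θ z
  support_subset : Function.support Θ ⊆ Ioo (-1) 1
  integral_eq_one : ∫ z in (-1 : ℝ)..1, Θ z = 1

/-- The rescaled mollifier `Θ_κ(z) = Θ(z/κ)/κ` (used for `κ > 0` only). -/
noncomputable def mollifierScaled (Θ : ℝ → ℝ) (κ z : ℝ) : ℝ := 1 / κ * Θ (z / κ)

/-- `ψ'_κ(z)`: the indicator function of `[-1+κ, 1-κ]` mollified at scale `κ`. -/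
noncomputable def psiDeriv (Θ : ℝ → ℝ) (κ z : ℝ) : ℝ :=
  ∫ s in (-1 + κ)..(1 - κ), mollifierScaled Θ κ (z - s)

/-- The transition function `φ_κ` on `[-1,1]`, going from `1` to `0`: the affine function for
`κ = 0`, and its `κ`-regularization for `κ > 0`. -/
noncomputable def phi (Θ : ℝ → ℝ) (κ z : ℝ) : ℝ :=
  if κ = 0 then (1 - z) / 2
  else 1 - (∫ s in (-1 : ℝ)..z, psiDeriv Θ κ s) / ∫ s in (-1 : ℝ)..1, psiDeriv Θ κ s

/-- The even vorticity profile `ϖ_{ε,κ}`. -/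
noncomputable def profile (Θ : ℝ → ℝ) (ε κ y : ℝ) : ℝ :=
  if |y| < 1 - ε then ε
  else if |y| ≤ 1 + ε then ε * phi Θ κ ((|y| - 1) / ε)
  else 0

/-- `I_ε`, the support of the derivative of the profile. -/
def bands (ε : ℝ) : Set ℝ := Icc (-1 - ε) (-1 + ε) ∪ Icc (1 - ε) (1 + ε)

/-- Lebesgue measure on `D_ε = 𝕋 × I_ε`. The torus `𝕋 = ℝ/2πℤ` is represented by the fundamental
domain `[-π, π]`, functions on `𝕋 × I_ε` by functions on `ℝ × I_ε` that are `2π`-periodic in `x`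
(their values at points `(x, y)` with `y ∉ I_ε` are irrelevant). -/
noncomputable def domainMeasure (ε : ℝ) : Measure (ℝ × ℝ) :=
  volume.restrict (Icc (-Real.pi) Real.pi ×ˢ bands ε)

/-- Test functions on the interior of `D_ε`: smooth, `2π`-periodic in `x`, with support in
`𝕋 × K` for some compact subset `K` of the interior of `I_ε`. -/
structure IsTest (ε : ℝ) (η : ℝ × ℝ → ℝ) : Prop where
  smooth : ContDiff ℝ ∞ η
  periodic : ∀ x y, η (x + 2 * Real.pi, y) = η (x, y)
  support_subset : ∃ K : Set ℝ, IsCompact K ∧ K ⊆ interior (bands ε) ∧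
    ∀ x y, y ∉ K → η (x, y) = 0

/-- The classical derivative `∂_x^i ∂_y^j η`. -/
noncomputable def classicalPartial (i j : ℕ) (η : ℝ × ℝ → ℝ) (p : ℝ × ℝ) : ℝ :=
  iteratedDeriv i (fun x => iteratedDeriv j (fun y => η (x, y)) p.2) p.1

/-- `v ∈ L²(D_ε)` is the weak derivative `∂_x^i ∂_y^j g` on `D_ε`. -/
def IsWeakPartial (ε : ℝ) (i j : ℕ) (g v : ℝ × ℝ → ℝ) : Prop :=
  MemLp v 2 (domainMeasure ε) ∧
    ∀ η : ℝ × ℝ → ℝ, IsTest ε η →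
      ∫ p, g p * classicalPartial i j η p ∂(domainMeasure ε) =
        (-1) ^ (i + j) * ∫ p, v p * η p ∂(domainMeasure ε)

/-- The anisotropic Sobolev space `H^{4,3}(D_ε)` of functions `2π`-periodic in `x`: all weak
derivatives `∂_x^i ∂_y^j g` with `j ≤ 3` and `i + j ≤ 4` are in `L²(D_ε)`, that is,
both `g` and `∂_x g` belong to `H³(D_ε)`. -/
structure MemSobolev (ε : ℝ) (g : ℝ × ℝ → ℝ) : Prop where
  periodic : ∀ x, ∀ y ∈ bands ε, g (x + 2 * Real.pi, y) = g (x, y)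
  memLp : MemLp g 2 (domainMeasure ε)
  weakPartial : ∀ i j : ℕ, j ≤ 3 → i + j ≤ 4 → ∃ v, IsWeakPartial ε i j g v

/-- The space `X(D_ε)`: functions of `H^{4,3}(D_ε)` that are even and of mean zero in `x`. -/
structure MemX (ε : ℝ) (g : ℝ × ℝ → ℝ) : Prop where
  sobolev : MemSobolev ε g
  even : ∀ᵐ p ∂(domainMeasure ε), g (-p.1, p.2) = g p
  mean_zero : ∀ᵐ y ∂(volume.restrict (bands ε)), ∫ x in (-Real.pi)..Real.pi, g (x, y) = 0

open Classical in
/-- The weak derivative `∂_x g ∈ L²(D_ε)`, determined almost everywhere on `D_ε`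
(and `0` if there is none, which does not happen for `g ∈ X(D_ε)`). -/
noncomputable def weakDx (ε : ℝ) (g : ℝ × ℝ → ℝ) : ℝ × ℝ → ℝ :=
  if hg : ∃ v, IsWeakPartial ε 1 0 g v then hg.choose else 0

/-- The operator `L_{ε,κ}[lam]`, the linearization at the trivial solution of the equation for
traveling waves of speed `lam`:
`(lam + y) ∂_x g(x,y)
  - (1/4π) ∫_{D_ε} ϖ'(y') log(cosh(y - y') - cos(x - x')) (∂_x g(x,y) - ∂_x g(x',y')) dx' dy'`. -/
noncomputable def linOp (Θ : ℝ → ℝ) (ε κ lam : ℝ) (g : ℝ × ℝ → ℝ) (p : ℝ × ℝ) : ℝ :=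
  (lam + p.2) * weakDx ε g p -
    1 / (4 * Real.pi) *
      ∫ q, deriv (profile Θ ε κ) q.2 *
          Real.log (Real.cosh (p.2 - q.2) - Real.cos (p.1 - q.1)) *
          (weakDx ε g p - weakDx ε g q) ∂(domainMeasure ε)

end CouetteWave

namespace CouetteWave

/-! ### Rank-one perturbations of the identity -/

section RankOne
variable {W : Type*} [NormedAddCommGroup W] [NormedSpace ℝ W] [CompleteSpace W]

/-- The solution `s` of `s = v + R s`. -/
noncomputable def resolventVec (R : W →L[ℝ] W) (v : W) : W := Ring.inverse (1 - R) v

theorem resolventVec_eq {R : W →L[ℝ] W} (hR : ‖R‖ < 1) (v : W) :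
    resolventVec R v = v + R (resolventVec R v) := by
  have h : IsUnit (1 - R) := ⟨Units.oneSub R hR, rfl⟩
  have h2 := congrArg (fun S : W →L[ℝ] W => S v) (Ring.mul_inverse_cancel _ h)
  simp only [mul_apply_eq_comp, sub_apply,
    one_apply_eq_self] at h2
  unfold resolventVec
  exact eq_add_of_sub_eq h2

omit [CompleteSpace W] in
theorem norm_le_of_eq_add {R : W →L[ℝ] W} (hR : ‖R‖ ≤ 1 / 2) {v s : W} (hs : s = v + R s) :
    ‖s‖ ≤ 2 * ‖v‖ := by
  have h1 : ‖s‖ ≤ ‖v‖ + ‖R‖ * ‖s‖ := by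
    calc ‖s‖ = ‖v + R s‖ := by rw [← hs]
      _ ≤ ‖v‖ + ‖R s‖ := norm_add_le _ _
      _ ≤ _ := by gcongr; exact R.le_opNorm s
  nlinarith [norm_nonneg s]

theorem norm_resolventVec_sub_le {R : W →L[ℝ] W} (hR : ‖R‖ ≤ 1 / 2) (v : W) :
    ‖resolventVec R v - v‖ ≤ 2 * ‖R‖ * ‖v‖ := by
  have hs := resolventVec_eq (R := R) (by linarith) v
  have h1 := norm_le_of_eq_add hR hs
  have h2 : resolventVec R v - v = R (resolventVec R v) := sub_eq_of_eq_add' hs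
  rw [h2]
  calc _ ≤ ‖R‖ * ‖resolventVec R v‖ := R.le_opNorm _
    _ ≤ ‖R‖ * (2 * ‖v‖) := by gcongr
    _ = _ := by ring

theorem eq_smul_resolventVec {R : W →L[ℝ] W} (hR : ‖R‖ ≤ 1 / 2) {v w : W} {c : ℝ}
    (hw : w = c • v + R w) : w = c • resolventVec R v := by
  have hs := resolventVec_eq (R := R) (by linarith) v
  have h : w - c • resolventVec R v = 0 + R (w - c • resolventVec R v) := by
    rw [map_sub, map_smul, zero_add]
    nth_rewrite 1 [hw]
    nth_rewrite 1 [hs]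
    rw [smul_add]; abel
  have := norm_le_of_eq_add hR h
  rw [norm_zero, mul_zero] at this
  exact sub_eq_zero.1 (norm_le_zero_iff.1 this)

theorem continuousOn_resolventVec {X : Type*} [TopologicalSpace X] {S : Set X}
    {R : X → W →L[ℝ] W} {v : X → W}
    (hR : Continuous R) (hv : Continuous v) (h : ∀ x ∈ S, ‖R x‖ < 1) :
    ContinuousOn (fun x => resolventVec (R x) (v x)) S := by
  intro x hx
  refine ContinuousAt.continuousWithinAt ?_
  have h1 : ContinuousAt (fun x => Ring.inverse (1 - R x)) x := by
    have h2 := NormedRing.inverse_continuousAt (Units.oneSub (R x) (h x hx))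
    have h3 : ContinuousAt (fun x => 1 - R x) x := by fun_prop
    exact ContinuousAt.comp (f := fun x => 1 - R x) (x := x) h2 h3
  exact h1.clm_apply hv.continuousAt

end RankOne

/-! ### Integral operators on a compact interval -/

/-- The reference interval `[-1,1]` of the band variable. -/
abbrev Seg : Type := Icc (-1 : ℝ) 1

/-- The integral operator with continuous kernel `k`. -/
noncomputable def intOp (ν : Measure Seg) [IsProbabilityMeasure ν] (k : C(Seg × Seg, ℝ)) :
    C(Seg, ℝ) →L[ℝ] C(Seg, ℝ) :=
  LinearMap.mkContinuous
    { toFun := fun f =>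
        { toFun := fun z => ∫ t, k (z, t) * f t ∂ν
          continuous_toFun := by
            refine continuous_of_dominated (bound := fun _ => ‖k‖ * ‖f‖) ?_ ?_ ?_ ?_
            · intro z; exact (by fun_prop : Continuous fun t => k (z, t) * f t).aestronglyMeasurable
            · intro z; refine Filter.Eventually.of_forall fun t => ?_
              rw [norm_mul]; gcongr
              · exact k.norm_coe_le_norm _
              · exact f.norm_coe_le_norm _
            · exact integrable_const _
            · refine Filter.Eventually.of_forall fun t => ?_
              fun_prop }
      map_add' := by
        intro f g; ext z
        simp only [ContinuousMap.coe_mk, ContinuousMap.add_apply, mul_add]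
        rw [integral_add]
        · exact (by fun_prop : Continuous fun t => k (z, t) * f t).integrable_of_hasCompactSupport
            (HasCompactSupport.of_compactSpace _)
        · exact (by fun_prop : Continuous fun t => k (z, t) * g t).integrable_of_hasCompactSupport
            (HasCompactSupport.of_compactSpace _)
      map_smul' := by
        intro c f; ext z
        simp only [ContinuousMap.coe_mk, ContinuousMap.smul_apply, smul_eq_mul, RingHom.id_apply]
        rw [← integral_const_mul]
        congr 1; ext t; ring }
    ‖k‖ (by
      intro f
      rw [ContinuousMap.norm_le _ (by positivity)]
      intro z
      simp only [LinearMap.coe_mk, AddHom.coe_mk, ContinuousMap.coe_mk]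
      calc ‖∫ t, k (z, t) * f t ∂ν‖ ≤ ‖k‖ * ‖f‖ * ν.real univ := by
            refine norm_integral_le_of_norm_le_const (Filter.Eventually.of_forall fun t => ?_)
            rw [norm_mul]; gcongr
            · exact k.norm_coe_le_norm _
            · exact f.norm_coe_le_norm _
        _ = _ := by simp)

variable (ν : Measure Seg) [IsProbabilityMeasure ν]

theorem intOp_apply (k : C(Seg × Seg, ℝ)) (f : C(Seg, ℝ)) (z : Seg) :
    intOp ν k f z = ∫ t, k (z, t) * f t ∂ν := rfl

theorem norm_intOp_le (k : C(Seg × Seg, ℝ)) : ‖intOp ν k‖ ≤ ‖k‖ :=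
  LinearMap.mkContinuous_norm_le _ (norm_nonneg _) _

theorem integrable_of_continuous {f : Seg → ℝ} (hf : Continuous f) : Integrable f ν :=
  hf.integrable_of_hasCompactSupport (HasCompactSupport.of_compactSpace _)

/-- Interaction of a band with itself in Fourier mode `n`. -/
noncomputable def selfKernel (ε : ℝ) (n : ℕ) : C(Seg × Seg, ℝ) :=
  ⟨fun p => Real.exp (-(n * (ε * |(p.1 : ℝ) - p.2|))), by fun_prop⟩

/-- Interaction of the two bands in Fourier mode `n`. -/
noncomputable def crossKernel (ε : ℝ) (n : ℕ) : C(Seg × Seg, ℝ) :=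
  ⟨fun p => Real.exp (-(n * (2 + ε * ((p.1 : ℝ) + p.2)))), by fun_prop⟩

/-- The equation for the Fourier mode `n` of the kernel, with `b` the profile on the lower band
and `u` the profile on the upper band, at speed `1 + ε * mu`. -/
def ModeEq (q : C(Seg, ℝ)) (ε mu : ℝ) (n : ℕ) (b u : C(Seg, ℝ)) : Prop :=
  (∀ z : Seg, (mu + 1 - z + ε * q z) * b z =
    1 / (2 * n) * (intOp ν (selfKernel ε n) b z - intOp ν (crossKernel ε n) u z)) ∧
  ∀ z : Seg, (2 + ε * (mu + z - 1 - ε * q z)) * u z =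
    ε / (2 * n) * (intOp ν (crossKernel ε n) b z - intOp ν (selfKernel ε n) u z)

/-- The dispersion function of the limit problem. -/
noncomputable def dispersion (mu : ℝ) : ℝ := ∫ z : Seg, (mu + 1 - (z : ℝ))⁻¹ ∂ν

end CouetteWave

namespace CouetteWave

/-! ### The mode equation as a rank-one problem with small remainder -/

theorem exp_neg_sub_le {s t : ℝ} (hs : 0 ≤ s) (ht : 0 ≤ t) :
    |Real.exp (-s) - Real.exp (-t)| ≤ |s - t| := by
  wlog h : s ≤ t generalizing s t
  · rw [abs_sub_comm, abs_sub_comm s]; exact this ht hs (le_of_not_ge h)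
  have h1 : Real.exp (-t) ≤ Real.exp (-s) := Real.exp_le_exp.2 (by linarith)
  rw [abs_of_nonneg (by linarith), abs_of_nonpos (by linarith)]
  have h2 : Real.exp (-t) = Real.exp (-s) * Real.exp (s - t) := by
    rw [← Real.exp_add]; congr 1; ring
  have h3 := Real.add_one_le_exp (s - t)
  have h4 : Real.exp (-s) ≤ 1 := Real.exp_le_one_iff.2 (by linarith)
  have h5 := Real.exp_pos (-s)
  rw [h2]
  nlinarith

theorem seg_abs_le (z : Seg) : |(z : ℝ)| ≤ 1 := abs_le.2 ⟨z.2.1, z.2.2⟩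

theorem norm_selfKernel_sub_one_le {ε : ℝ} (hε : 0 ≤ ε) (n : ℕ) :
    ‖selfKernel ε n - 1‖ ≤ 2 * n * ε := by
  rw [ContinuousMap.norm_le _ (by positivity)]
  rintro ⟨s, t⟩
  have h := exp_neg_sub_le (s := n * (ε * |(s : ℝ) - t|)) (t := 0) (by positivity) le_rfl
  have h2 : |(s : ℝ) - t| ≤ 2 := by
    have := abs_sub (s : ℝ) t; have := seg_abs_le s; have := seg_abs_le t; linarith
  simp only [neg_zero, Real.exp_zero, sub_zero] at h
  rw [abs_of_nonneg (a := (n : ℝ) * (ε * |(s : ℝ) - t|)) (by positivity)] at h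
  calc _ ≤ _ := h
    _ ≤ n * (ε * 2) := by gcongr
    _ = _ := by ring

theorem two_add_nonneg {ε : ℝ} (hε : 0 ≤ ε) (hε1 : ε ≤ 1) (s t : Seg) :
    0 ≤ 2 + ε * ((s : ℝ) + t) := by
  have := s.2.1; have := t.2.1; nlinarith

theorem norm_crossKernel_le {ε : ℝ} (hε : 0 ≤ ε) (hε1 : ε ≤ 1) (n : ℕ) :
    ‖crossKernel ε n‖ ≤ 1 := by
  rw [ContinuousMap.norm_le _ zero_le_one]
  rintro ⟨s, t⟩
  have := two_add_nonneg hε hε1 s t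
  simp only [crossKernel, ContinuousMap.coe_mk, Real.norm_eq_abs, Real.abs_exp, Real.exp_le_one_iff]
  have : 0 ≤ (n : ℝ) * (2 + ε * ((s : ℝ) + t)) := by positivity
  linarith

theorem norm_selfKernel_le {ε : ℝ} (hε : 0 ≤ ε) (n : ℕ) : ‖selfKernel ε n‖ ≤ 1 := by
  rw [ContinuousMap.norm_le _ zero_le_one]
  rintro ⟨s, t⟩
  simp only [selfKernel, ContinuousMap.coe_mk, Real.norm_eq_abs, Real.abs_exp, Real.exp_le_one_iff]
  have : 0 ≤ (n : ℝ) * (ε * |(s : ℝ) - t|) := by positivity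
  linarith

theorem norm_crossKernel_sub_le {ε : ℝ} (hε : 0 ≤ ε) (hε1 : ε ≤ 1) (n : ℕ) :
    ‖crossKernel ε n - ContinuousMap.const _ (Real.exp (-(n * 2)))‖ ≤ 2 * n * ε := by
  rw [ContinuousMap.norm_le _ (by positivity)]
  rintro ⟨s, t⟩
  have h0 := two_add_nonneg hε hε1 s t
  have h := exp_neg_sub_le (s := n * (2 + ε * ((s : ℝ) + t))) (t := n * 2) (by positivity)
    (by positivity)
  have h2 : |(s : ℝ) + t| ≤ 2 := by
    have := abs_add_le (s : ℝ) t; have := seg_abs_le s; have := seg_abs_le t; linarith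
  have h3 : (n : ℝ) * (2 + ε * ((s : ℝ) + t)) - n * 2 = n * (ε * ((s : ℝ) + t)) := by ring
  rw [h3, abs_mul, abs_mul, abs_of_nonneg hε, abs_of_nonneg (a := (n : ℝ)) (by positivity)] at h
  calc _ ≤ _ := h
    _ ≤ n * (ε * 2) := by gcongr
    _ = _ := by ring

variable (ν : Measure Seg) [IsProbabilityMeasure ν]

/-- The part of the mode operator that is small with `ε`. -/
noncomputable def smallPart (ε : ℝ) (n : ℕ) :
    C(Seg, ℝ) × C(Seg, ℝ) →L[ℝ] C(Seg, ℝ) × C(Seg, ℝ) :=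
  ((intOp ν (selfKernel ε n - 1)).comp (ContinuousLinearMap.fst ℝ _ _) -
    ε • (intOp ν (crossKernel ε n)).comp (ContinuousLinearMap.snd ℝ _ _)).prod
  ((intOp ν (crossKernel ε n - ContinuousMap.const _ (Real.exp (-(n * 2))))).comp
      (ContinuousLinearMap.fst ℝ _ _) -
    ε • (intOp ν (selfKernel ε n)).comp (ContinuousLinearMap.snd ℝ _ _))

theorem norm_smallPart_le {ε : ℝ} (hε : 0 ≤ ε) (hε1 : ε ≤ 1) (n : ℕ) :
    ‖smallPart ν ε n‖ ≤ (2 * n + 1) * ε := by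
  refine ContinuousLinearMap.opNorm_le_bound _ (by positivity) ?_
  rintro ⟨b, u⟩
  have aux : ∀ k l : C(Seg × Seg, ℝ), ‖k‖ ≤ 2 * n * ε → ‖l‖ ≤ 1 →
      ‖intOp ν k b - ε • intOp ν l u‖ ≤ (2 * n + 1) * ε * ‖(b, u)‖ := by
    intro k l hk hl
    have hb : ‖b‖ ≤ ‖(b, u)‖ := norm_fst_le (b, u)
    have hu : ‖u‖ ≤ ‖(b, u)‖ := norm_snd_le (b, u)
    calc ‖intOp ν k b - ε • intOp ν l u‖ ≤ ‖intOp ν k b‖ + ‖ε • intOp ν l u‖ := norm_sub_le _ _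
      _ ≤ (2 * n * ε) * ‖(b, u)‖ + ε * (1 * ‖(b, u)‖) := by
        rw [norm_smul, Real.norm_of_nonneg hε]
        gcongr
        · exact ((intOp ν k).le_opNorm b).trans (by gcongr; exact (norm_intOp_le ν k).trans hk)
        · exact ((intOp ν l).le_opNorm u).trans (by gcongr; exact (norm_intOp_le ν l).trans hl)
      _ = _ := by ring
  refine norm_prod_le_iff.2 ⟨?_, ?_⟩
  · exact aux _ _ (norm_selfKernel_sub_one_le hε n) (norm_crossKernel_le hε hε1 n)
  · exact aux _ _ (norm_crossKernel_sub_le hε hε1 n) (norm_selfKernel_le hε n)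

/-- The reciprocals of the (truncated) symbols on the two bands. -/
noncomputable def bandWeight (q : C(Seg, ℝ)) (ε : ℝ) {d : ℝ} (hd : 0 < d) (n : ℕ) (mu : ℝ) :
    C(Seg, ℝ) × C(Seg, ℝ) :=
  (⟨fun z => 1 / (2 * n) * (max (mu + 1 - z + ε * q z) d)⁻¹, by
      refine continuous_const.mul (Continuous.inv₀ (by fun_prop) fun z => ?_)
      positivity⟩,
   ⟨fun z => 1 / (2 * n) * (max (2 + ε * (mu + z - 1 - ε * q z)) 1)⁻¹, by
      refine continuous_const.mul (Continuous.inv₀ (by fun_prop) fun z => ?_)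
      positivity⟩)

theorem continuous_bandWeight (q : C(Seg, ℝ)) (ε : ℝ) {d : ℝ} (hd : 0 < d) (n : ℕ) :
    Continuous (bandWeight q ε hd n) := by
  refine Continuous.prodMk ?_ ?_
  · refine ContinuousMap.continuous_of_continuous_uncurry _ ?_
    refine continuous_const.mul (Continuous.inv₀ (by fun_prop) fun z => ?_)
    positivity
  · refine ContinuousMap.continuous_of_continuous_uncurry _ ?_
    refine continuous_const.mul (Continuous.inv₀ (by fun_prop) fun z => ?_)
    positivity

theorem norm_bandWeight_le (q : C(Seg, ℝ)) (ε : ℝ) {d : ℝ} (hd : 0 < d) (hd1 : d ≤ 1) {n : ℕ}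
    (hn : 1 ≤ n) (mu : ℝ) : ‖bandWeight q ε hd n mu‖ ≤ d⁻¹ := by
  have hn' : (1 : ℝ) ≤ n := by exact_mod_cast hn
  have h2 : 1 / (2 * (n : ℝ)) ≤ 1 := by rw [div_le_one (by positivity)]; linarith
  refine norm_prod_le_iff.2 ⟨?_, ?_⟩
  · rw [ContinuousMap.norm_le _ (by positivity)]
    intro z
    simp only [bandWeight, ContinuousMap.coe_mk]
    rw [Real.norm_of_nonneg (by positivity)]
    calc _ ≤ 1 * d⁻¹ := by gcongr; exact le_max_right _ _
      _ = _ := one_mul _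
  · rw [ContinuousMap.norm_le _ (by positivity)]
    intro z
    simp only [bandWeight, ContinuousMap.coe_mk]
    rw [Real.norm_of_nonneg (by positivity)]
    calc _ ≤ 1 * d⁻¹ := by gcongr; exact hd1.trans (le_max_right _ _)
      _ = _ := one_mul _

/-- The small operator in the fixed point form of the mode equation. -/
noncomputable def remainder (q : C(Seg, ℝ)) (ε : ℝ) {d : ℝ} (hd : 0 < d) (n : ℕ) (mu : ℝ) :
    C(Seg, ℝ) × C(Seg, ℝ) →L[ℝ] C(Seg, ℝ) × C(Seg, ℝ) :=
  (ContinuousLinearMap.mul ℝ (C(Seg, ℝ) × C(Seg, ℝ)) (bandWeight q ε hd n mu)).comp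
    (smallPart ν ε n)

/-- The range vector of the rank-one part in the fixed point form of the mode equation. -/
noncomputable def rangeVec (q : C(Seg, ℝ)) (ε : ℝ) {d : ℝ} (hd : 0 < d) (n : ℕ) (mu : ℝ) :
    C(Seg, ℝ) × C(Seg, ℝ) :=
  bandWeight q ε hd n mu * (1, ContinuousMap.const _ (Real.exp (-(n * 2))))

theorem norm_remainder_le (q : C(Seg, ℝ)) {ε : ℝ} (hε : 0 ≤ ε) (hε1 : ε ≤ 1) {d : ℝ} (hd : 0 < d)
    (hd1 : d ≤ 1) {n : ℕ} (hn : 1 ≤ n) (mu : ℝ) :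
    ‖remainder ν q ε hd n mu‖ ≤ d⁻¹ * ((2 * n + 1) * ε) := by
  refine (ContinuousLinearMap.opNorm_comp_le _ _).trans ?_
  gcongr
  · exact (ContinuousLinearMap.opNorm_mul_apply_le _ _ _).trans (norm_bandWeight_le q ε hd hd1 hn mu)
  · exact norm_smallPart_le ν hε hε1 n

theorem norm_rangeVec_le (q : C(Seg, ℝ)) (ε : ℝ) {d : ℝ} (hd : 0 < d)
    (hd1 : d ≤ 1) {n : ℕ} (hn : 1 ≤ n) (mu : ℝ) :
    ‖rangeVec q ε hd n mu‖ ≤ d⁻¹ := by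
  refine (norm_mul_le _ _).trans ?_
  calc _ ≤ d⁻¹ * 1 := by
        gcongr
        · exact norm_bandWeight_le q ε hd hd1 hn mu
        · refine norm_prod_le_iff.2 ⟨?_, ?_⟩
          · rw [ContinuousMap.norm_le _ zero_le_one]; intro z; simp
          · rw [ContinuousMap.norm_le _ zero_le_one]; intro z
            simp only [ContinuousMap.const_apply, Real.norm_eq_abs, Real.abs_exp,
              Real.exp_le_one_iff]
            simp
    _ = _ := mul_one _

/-- The mean with respect to `ν`, as a functional. -/
noncomputable def mean : C(Seg, ℝ) →L[ℝ] ℝ :=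
  LinearMap.mkContinuous
    { toFun := fun f => ∫ t, f t ∂ν
      map_add' := fun f g => integral_add (integrable_of_continuous ν f.continuous)
        (integrable_of_continuous ν g.continuous)
      map_smul' := fun c f => integral_const_mul c _ } 1 (by
      intro f
      calc ‖∫ t, f t ∂ν‖ ≤ ‖f‖ * ν.real univ :=
            norm_integral_le_of_norm_le_const (Filter.Eventually.of_forall fun t =>
              f.norm_coe_le_norm _)
        _ = 1 * ‖f‖ := by simp)

theorem mean_apply (f : C(Seg, ℝ)) : mean ν f = ∫ t, f t ∂ν := rfl

theorem norm_mean_le : ‖mean ν‖ ≤ 1 := LinearMap.mkContinuous_norm_le _ zero_le_one _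

theorem intOp_sub_const (k : C(Seg × Seg, ℝ)) (c : ℝ) (f : C(Seg, ℝ)) (z : Seg) :
    intOp ν (k - ContinuousMap.const _ c) f z = intOp ν k f z - c * mean ν f := by
  rw [intOp_apply, intOp_apply, mean_apply, ← integral_const_mul, ← integral_sub]
  · congr 1; ext t; simp; ring
  · exact integrable_of_continuous ν (by fun_prop)
  · exact integrable_of_continuous ν (by fun_prop)

theorem modeEq_iff (q : C(Seg, ℝ)) {ε : ℝ} (hε : 0 < ε) {d : ℝ} (hd : 0 < d) {n : ℕ}
    {mu : ℝ}
    (hD : ∀ z : Seg, d ≤ mu + 1 - z + ε * q z)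
    (hA : ∀ z : Seg, 1 ≤ 2 + ε * (mu + z - 1 - ε * q z)) (b u : C(Seg, ℝ)) :
    ModeEq ν q ε mu n b (ε • u) ↔
      (b, u) = mean ν b • rangeVec q ε hd n mu + remainder ν q ε hd n mu (b, u) := by
  rw [Prod.ext_iff]
  refine and_congr ?_ ?_
  · rw [ContinuousMap.ext_iff]
    refine forall_congr' fun z => ?_
    have h1 : ((mean ν b • rangeVec q ε hd n mu + remainder ν q ε hd n mu (b, u)).1) z =
        1 / (2 * n) * (mu + 1 - z + ε * q z)⁻¹ *
          (intOp ν (selfKernel ε n) b z - ε * intOp ν (crossKernel ε n) u z) := by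
      simp only [rangeVec, remainder, smallPart, bandWeight]
      have h := intOp_sub_const ν (selfKernel ε n) 1 b z
      have h' : (ContinuousMap.const (Seg × Seg) (1 : ℝ)) = 1 := rfl
      rw [h'] at h
      simp [h, max_eq_left (hD z)]
      ring
    rw [h1, map_smul]
    have hD' : mu + 1 - z + ε * q z ≠ 0 := by linarith [hD z]
    simp only [ContinuousMap.smul_apply, smul_eq_mul]
    rw [eq_comm, ← inv_mul_eq_iff_eq_mul₀ hD', eq_comm]
    ring_nf
  · rw [ContinuousMap.ext_iff]
    refine forall_congr' fun z => ?_
    have h1 : ((mean ν b • rangeVec q ε hd n mu + remainder ν q ε hd n mu (b, u)).2) z =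
        1 / (2 * n) * (2 + ε * (mu + z - 1 - ε * q z))⁻¹ *
          (intOp ν (crossKernel ε n) b z - ε * intOp ν (selfKernel ε n) u z) := by
      simp only [rangeVec, remainder, smallPart, bandWeight]
      have h := intOp_sub_const ν (crossKernel ε n) (Real.exp (-(n * 2))) b z
      simp [h, max_eq_left (hA z)]
      ring
    rw [h1, map_smul]
    have hA' : 2 + ε * (mu + z - 1 - ε * q z) ≠ 0 := by linarith [hA z]
    simp only [ContinuousMap.smul_apply, smul_eq_mul]
    generalize 2 + ε * (mu + z - 1 - ε * q z) = A at hA'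
    generalize (intOp ν (selfKernel ε n)) u z = Y
    generalize (intOp ν (crossKernel ε n)) b z = X
    constructor
    · intro h
      have h2 : A * u z = 1 / (2 * n) * (X - ε * Y) :=
        mul_left_cancel₀ hε.ne' (by linear_combination h)
      rw [← inv_mul_cancel_left₀ hA' (u z), h2]; ring
    · intro h
      rw [h]; field_simp

end CouetteWave

namespace CouetteWave

/-! ### The dispersion function -/

theorem seg_symbol_pos {mu : ℝ} (hmu : 0 < mu) (z : Seg) : 0 < mu + 1 - (z : ℝ) := by
  linarith [z.2.2]

theorem continuous_dispersion_integrand {mu : ℝ} (hmu : 0 < mu) :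
    Continuous fun z : Seg => (mu + 1 - (z : ℝ))⁻¹ :=
  Continuous.inv₀ (by fun_prop) fun z => (seg_symbol_pos hmu z).ne'

variable (ν : Measure Seg) [IsProbabilityMeasure ν]

theorem le_dispersion_sub {mu mu' : ℝ} (hmu : 0 < mu) (h : mu ≤ mu') (h1 : mu' ≤ 1) :
    (mu' - mu) / 9 ≤ dispersion ν mu - dispersion ν mu' := by
  have hmu' := hmu.trans_le h
  unfold dispersion
  rw [← integral_sub (integrable_of_continuous ν (continuous_dispersion_integrand hmu))
    (integrable_of_continuous ν (continuous_dispersion_integrand hmu'))]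
  have h2 : (mu' - mu) / 9 = ∫ _ : Seg, (mu' - mu) / 9 ∂ν := by simp
  rw [h2]
  refine integral_mono (integrable_const _) (integrable_of_continuous ν
    ((continuous_dispersion_integrand hmu).sub (continuous_dispersion_integrand hmu'))) fun z => ?_
  have p1 := seg_symbol_pos hmu z
  have p2 := seg_symbol_pos hmu' z
  simp only
  rw [inv_sub_inv p1.ne' p2.ne']
  have h3 : (mu + 1 - (z : ℝ)) * (mu' + 1 - z) ≤ 9 := by
    have := z.2.1
    nlinarith
  have h4 : mu' + 1 - (z : ℝ) - (mu + 1 - z) = mu' - mu := by ring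
  rw [h4]
  exact div_le_div_of_nonneg_left (by linarith) (by positivity) h3

theorem dispersion_sub_le {mu mu' d : ℝ} (hd : 0 < d) (hmu : d ≤ mu) (h : mu ≤ mu') :
    dispersion ν mu - dispersion ν mu' ≤ (mu' - mu) / d ^ 2 := by
  have hmu0 := hd.trans_le hmu
  have hmu' := hmu0.trans_le h
  unfold dispersion
  rw [← integral_sub (integrable_of_continuous ν (continuous_dispersion_integrand hmu0))
    (integrable_of_continuous ν (continuous_dispersion_integrand hmu'))]
  have h2 : (mu' - mu) / d ^ 2 = ∫ _ : Seg, (mu' - mu) / d ^ 2 ∂ν := by simp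
  rw [h2]
  refine integral_mono (integrable_of_continuous ν
    ((continuous_dispersion_integrand hmu0).sub (continuous_dispersion_integrand hmu')))
    (integrable_const _) fun z => ?_
  have p1 := seg_symbol_pos hmu0 z
  have p2 := seg_symbol_pos hmu' z
  simp only
  rw [inv_sub_inv p1.ne' p2.ne']
  have h3 : d ^ 2 ≤ (mu + 1 - (z : ℝ)) * (mu' + 1 - z) := by
    have := z.2.2
    rw [sq]; gcongr <;> linarith
  have h4 : mu' + 1 - (z : ℝ) - (mu + 1 - z) = mu' - mu := by ring
  rw [h4]
  exact div_le_div_of_nonneg_left (by linarith) (by positivity) h3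

theorem dispersion_sub_le_abs {mu mu' d : ℝ} (hd : 0 < d) (hmu : d ≤ mu) (hmu' : d ≤ mu') :
    |dispersion ν mu - dispersion ν mu'| ≤ |mu - mu'| / d ^ 2 := by
  have key : ∀ s t : ℝ, d ≤ s → s ≤ t → |dispersion ν s - dispersion ν t| ≤ |s - t| / d ^ 2 := by
    intro s t hs hst
    have h1 := dispersion_sub_le ν hd hs hst
    have h2 : 0 ≤ dispersion ν s - dispersion ν t := by
      unfold dispersion
      have hs0 := hd.trans_le hs
      refine sub_nonneg.2 (integral_mono (integrable_of_continuous ν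
        (continuous_dispersion_integrand (hs0.trans_le hst))) (integrable_of_continuous ν
        (continuous_dispersion_integrand hs0)) fun z => ?_)
      have := seg_symbol_pos hs0 z
      simp only
      gcongr
    rw [abs_of_nonneg h2, abs_sub_comm, abs_of_nonneg (by linarith)]
    exact h1
  rcases le_total mu mu' with h | h
  · exact key _ _ hmu h
  · rw [abs_sub_comm, abs_sub_comm mu]; exact key _ _ hmu' h

theorem continuousOn_dispersion {d : ℝ} (hd : 0 < d) : ContinuousOn (dispersion ν) (Ici d) := by
  have : LipschitzOnWith (Real.toNNReal (1 / d ^ 2)) (dispersion ν) (Ici d) := by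
    refine LipschitzOnWith.of_dist_le_mul fun x hx y hy => ?_
    rw [Real.dist_eq, Real.dist_eq, Real.coe_toNNReal _ (by positivity)]
    refine (dispersion_sub_le_abs ν hd hx hy).trans (le_of_eq ?_)
    ring
  exact this.continuousOn

theorem dispersion_le {mu : ℝ} (hmu : 0 < mu) : dispersion ν mu ≤ mu⁻¹ := by
  have h2 : mu⁻¹ = ∫ _ : Seg, mu⁻¹ ∂ν := by simp
  rw [h2]
  refine integral_mono (integrable_of_continuous ν (continuous_dispersion_integrand hmu))
    (integrable_const _) fun z => ?_
  have := z.2.2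
  simp only
  gcongr
  linarith

/-- The dispersion relation `F(mu) = 2m` of the limit problem is solvable. -/
theorem exists_dispersion_eq {M c : ℝ} (hc : 0 < c) (hc1 : c ≤ 1 / 2)
    (hF : 2 * M ≤ dispersion ν c) {m : ℕ} (hm : 1 ≤ m) (hmM : (m : ℝ) < M) :
    ∃ mu, c ≤ mu ∧ mu ≤ 1 / 2 ∧ dispersion ν mu = 2 * m := by
  have hm' : (1 : ℝ) ≤ m := by exact_mod_cast hm
  have h1 : dispersion ν (1 / 2) ≤ 2 * m := by
    refine (dispersion_le ν (by norm_num)).trans ?_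
    norm_num; linarith
  have h := intermediate_value_Icc' hc1
    ((continuousOn_dispersion ν hc).mono (fun x hx => hx.1))
  obtain ⟨mu, hmu, h2⟩ := h ⟨h1, by linarith⟩
  exact ⟨mu, hmu.1, hmu.2, h2⟩

/-! ### Symbols on the two bands -/

variable {q : C(Seg, ℝ)}

theorem lower_symbol_ge (hq : ∀ z, |q z| ≤ 1) {ε mu c : ℝ} (hε : 0 ≤ ε) (hε1 : ε ≤ c / 4)
    (hmu : c / 2 ≤ mu) (z : Seg) : c / 4 ≤ mu + 1 - z + ε * q z := by
  have := z.2.2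
  have := (abs_le.1 (hq z)).1
  nlinarith

theorem upper_symbol_ge (hq : ∀ z, |q z| ≤ 1) {ε mu : ℝ} (hε : 0 ≤ ε) (hε1 : ε ≤ 1 / 4)
    (hmu : 0 ≤ mu) (z : Seg) : 1 ≤ 2 + ε * (mu + z - 1 - ε * q z) := by
  have := z.2.1
  have := (abs_le.1 (hq z)).2
  have h : -(9 / 4) ≤ mu + z - 1 - ε * q z := by nlinarith
  nlinarith

theorem continuous_lower_inv (hq : ∀ z, |q z| ≤ 1) {ε mu c : ℝ} (hc : 0 < c) (hε : 0 ≤ ε)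
    (hε1 : ε ≤ c / 4) (hmu : c / 2 ≤ mu) :
    Continuous fun z : Seg => (mu + 1 - z + ε * q z)⁻¹ := by
  refine Continuous.inv₀ (by fun_prop) fun z => ?_
  have := lower_symbol_ge hq hε hε1 hmu z
  intro h; linarith

theorem integral_lower_inv_sub_le (hq : ∀ z, |q z| ≤ 1) {ε mu c : ℝ} (hc : 0 < c) (hε : 0 ≤ ε)
    (hε1 : ε ≤ c / 4) (hmu : c / 2 ≤ mu) :
    |∫ z : Seg, (mu + 1 - z + ε * q z)⁻¹ ∂ν - dispersion ν mu| ≤ 8 / c ^ 2 * ε := by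
  have hmu0 : 0 < mu := by linarith
  unfold dispersion
  rw [← integral_sub (integrable_of_continuous ν (continuous_lower_inv hq hc hε hε1 hmu))
    (integrable_of_continuous ν (continuous_dispersion_integrand hmu0))]
  rw [← Real.norm_eq_abs]
  have : ∀ z : Seg, ‖(mu + 1 - (z : ℝ) + ε * q z)⁻¹ - (mu + 1 - z)⁻¹‖ ≤ 8 / c ^ 2 * ε := by
    intro z
    have p1 := lower_symbol_ge hq hε hε1 hmu z
    have p2 : c / 2 ≤ mu + 1 - z := by linarith [z.2.2]
    have p1' : 0 < mu + 1 - (z : ℝ) + ε * q z := by linarith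
    have p2' : 0 < mu + 1 - (z : ℝ) := by linarith
    rw [inv_sub_inv p1'.ne' p2'.ne', Real.norm_eq_abs, abs_div, abs_of_pos (mul_pos p1' p2')]
    have h1 : |mu + 1 - (z : ℝ) - (mu + 1 - z + ε * q z)| ≤ ε := by
      have : mu + 1 - (z : ℝ) - (mu + 1 - z + ε * q z) = -(ε * q z) := by ring
      rw [this, abs_neg, abs_mul, abs_of_nonneg hε]
      nlinarith [hq z]
    calc _ ≤ ε / ((c / 4) * (c / 2)) := by gcongr
      _ = _ := by field_simp; ring
  refine (norm_integral_le_of_norm_le_const (Filter.Eventually.of_forall this)).trans ?_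
  simp

end CouetteWave

namespace CouetteWave

/-! ### Solvability of the mode equations -/

variable (ν : Measure Seg) [IsProbabilityMeasure ν] {q : C(Seg, ℝ)}

theorem abs_intOp_le {k : C(Seg × Seg, ℝ)} (hk : ‖k‖ ≤ 1) (f : C(Seg, ℝ)) (z : Seg) :
    |intOp ν k f z| ≤ ∫ t, |f t| ∂ν := by
  rw [intOp_apply]
  refine abs_integral_le_integral_abs.trans (integral_mono (integrable_of_continuous ν (by fun_prop))
    (integrable_of_continuous ν (by fun_prop)) fun t => ?_)
  simp only [abs_mul]
  have : |k (z, t)| ≤ 1 := (k.norm_coe_le_norm _).trans hk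
  exact mul_le_of_le_one_left (abs_nonneg _) this

/-- Modes for which the interaction is a contraction are trivial. -/
theorem modeEq_trivial (hq : ∀ z, |q z| ≤ 1) {ε mu c S : ℝ} {n : ℕ} (hn : 1 ≤ n) (hc : 0 < c)
    (hε : 0 ≤ ε) (hε1 : ε ≤ c / 4) (hε2 : ε ≤ 1 / 4) (hmu : c / 2 ≤ mu)
    (hS : ∫ z : Seg, (mu + 1 - z + ε * q z)⁻¹ ∂ν ≤ S) (hSn : S * (1 + ε) < 2 * n)
    {b u : C(Seg, ℝ)} (h : ModeEq ν q ε mu n b u) : b = 0 ∧ u = 0 := by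
  have hn' : (1 : ℝ) ≤ n := by exact_mod_cast hn
  have hmu0 : 0 ≤ mu := by linarith
  have hk1 := norm_selfKernel_le hε n
  have hk2 := norm_crossKernel_le hε (by linarith) n
  have ib := integrable_of_continuous ν (f := fun t => |b t|) (by fun_prop)
  have iu := integrable_of_continuous ν (f := fun t => |u t|) (by fun_prop)
  set B := ∫ t, |b t| ∂ν with hB
  set U := ∫ t, |u t| ∂ν with hU
  have B0 : 0 ≤ B := integral_nonneg fun _ => abs_nonneg _
  have U0 : 0 ≤ U := integral_nonneg fun _ => abs_nonneg _
  have hb : ∀ z : Seg, |b z| ≤ (mu + 1 - z + ε * q z)⁻¹ * (1 / (2 * n) * (B + U)) := by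
    intro z
    have p1 := lower_symbol_ge hq hε hε1 hmu z
    have p1' : 0 < mu + 1 - (z : ℝ) + ε * q z := by linarith
    have e : b z = (mu + 1 - (z : ℝ) + ε * q z)⁻¹ * (1 / (2 * n) *
        (intOp ν (selfKernel ε n) b z - intOp ν (crossKernel ε n) u z)) := by
      rw [← h.1 z, inv_mul_cancel_left₀ p1'.ne']
    rw [e, abs_mul, abs_mul, abs_of_pos (inv_pos.2 p1'),
      abs_of_nonneg (a := 1 / (2 * (n : ℝ))) (by positivity)]
    gcongr
    exact (abs_sub _ _).trans (add_le_add (abs_intOp_le ν hk1 b z) (abs_intOp_le ν hk2 u z))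
  have hu : ∀ z : Seg, |u z| ≤ ε / 2 * (B + U) := by
    intro z
    have p1 := upper_symbol_ge hq hε hε2 hmu0 z
    have p1' : 0 < 2 + ε * (mu + (z : ℝ) - 1 - ε * q z) := by linarith
    have e : u z = (2 + ε * (mu + (z : ℝ) - 1 - ε * q z))⁻¹ * (ε / (2 * n) *
        (intOp ν (crossKernel ε n) b z - intOp ν (selfKernel ε n) u z)) := by
      rw [← h.2 z, inv_mul_cancel_left₀ p1'.ne']
    rw [e, abs_mul, abs_mul, abs_of_pos (inv_pos.2 p1'),
      abs_of_nonneg (a := ε / (2 * (n : ℝ))) (by positivity)]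
    calc _ ≤ 1 * (ε / (2 * 1) * (B + U)) := by
          gcongr
          · exact inv_le_one_of_one_le₀ p1
          · exact (abs_sub _ _).trans
              (add_le_add (abs_intOp_le ν hk2 b z) (abs_intOp_le ν hk1 u z))
      _ = _ := by ring
  have hBS : B ≤ S * (1 / (2 * n) * (B + U)) := by
    calc B ≤ ∫ z : Seg, (mu + 1 - z + ε * q z)⁻¹ * (1 / (2 * n) * (B + U)) ∂ν :=
          integral_mono ib ((integrable_of_continuous ν
            (continuous_lower_inv hq hc hε hε1 hmu)).mul_const _) hb
      _ = (∫ z : Seg, (mu + 1 - z + ε * q z)⁻¹ ∂ν) * (1 / (2 * n) * (B + U)) :=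
          integral_mul_const _ _
      _ ≤ _ := by gcongr
  have hUB : U ≤ ε / 2 * (B + U) := by
    calc U ≤ ∫ _ : Seg, ε / 2 * (B + U) ∂ν := integral_mono iu (integrable_const _) hu
      _ = _ := by simp
  have hUB' : U ≤ ε * B := by nlinarith
  have S0 : 0 ≤ S := by
    refine le_trans (integral_nonneg fun z => ?_) hS
    have p1 := lower_symbol_ge hq hε hε1 hmu z
    exact inv_nonneg.2 (by linarith)
  have hB0 : B = 0 := by
    have h1 : 2 * n * B ≤ S * (1 + ε) * B := by
      have h2 : 2 * n * (S * (1 / (2 * n) * (B + U))) = S * (B + U) := by field_simp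
      have h3 : S * (B + U) ≤ S * (B + ε * B) := by gcongr
      nlinarith
    nlinarith
  have hU0 : U = 0 := by rw [hB0] at hUB'; linarith
  rw [hB0, hU0] at hb hu
  constructor
  · ext z; have := hb z; simp at this; simpa using this
  · ext z; have := hu z; simp at this; simpa using this

/-- The function whose value `1` characterizes the nontrivial modes. -/
noncomputable def modeDet (q : C(Seg, ℝ)) (ε : ℝ) {d : ℝ} (hd : 0 < d) (n : ℕ) (mu : ℝ) : ℝ :=
  mean ν (resolventVec (remainder ν q ε hd n mu) (rangeVec q ε hd n mu)).1

theorem continuousOn_modeDet (q : C(Seg, ℝ)) {ε : ℝ} (hε : 0 ≤ ε) (hε1 : ε ≤ 1) {d : ℝ}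
    (hd : 0 < d) (hd1 : d ≤ 1) {n : ℕ} (hn : 1 ≤ n) (hsmall : d⁻¹ * ((2 * n + 1) * ε) ≤ 1 / 2) :
    Continuous (modeDet ν q ε hd n) := by
  refine (mean ν).continuous.comp (continuous_fst.comp ?_)
  rw [← continuousOn_univ]
  have hw := continuous_bandWeight q ε hd n
  refine continuousOn_resolventVec ?_ ?_ fun mu _ => ?_
  · exact (((ContinuousLinearMap.mul ℝ (C(Seg, ℝ) × C(Seg, ℝ))).continuous.comp hw).clm_comp
      continuous_const)
  · exact hw.mul continuous_const
  · exact ((norm_remainder_le ν q hε hε1 hd hd1 hn mu).trans hsmall).trans_lt (by norm_num)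

theorem modeDet_approx (hq : ∀ z, |q z| ≤ 1) {ε mu c : ℝ} {n : ℕ} (hn : 1 ≤ n) (hc : 0 < c)
    (hc1 : c ≤ 1) (hε : 0 ≤ ε) (hε1 : ε ≤ c / 4) (hmu : c / 2 ≤ mu) (hd : 0 < c / 4)
    (hsmall : (c / 4)⁻¹ * ((2 * n + 1) * ε) ≤ 1 / 2) :
    |2 * n * modeDet ν q ε hd n mu - dispersion ν mu| ≤
      (64 * n * (2 * n + 1) + 8) / c ^ 2 * ε := by
  have hn' : (1 : ℝ) ≤ n := by exact_mod_cast hn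
  have hR := norm_remainder_le ν q hε (by linarith) hd (by linarith) hn mu
  have hv := norm_rangeVec_le q ε hd (by linarith) hn mu
  have h1 := norm_resolventVec_sub_le (hR.trans hsmall) (rangeVec q ε hd n mu)
  have h2 : |modeDet ν q ε hd n mu - mean ν (rangeVec q ε hd n mu).1| ≤
      2 * ((c / 4)⁻¹ * ((2 * n + 1) * ε)) * (c / 4)⁻¹ := by
    unfold modeDet
    rw [← map_sub, ← Prod.fst_sub]
    calc _ ≤ ‖mean ν‖ * _ := (mean ν).le_opNorm _
      _ ≤ 1 * _ := by
        gcongr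
        · exact norm_mean_le ν
      _ ≤ _ := by
        rw [one_mul]
        refine (norm_fst_le _).trans (h1.trans ?_)
        gcongr
  have h3 : 2 * n * mean ν (rangeVec q ε hd n mu).1 = ∫ z : Seg, (mu + 1 - z + ε * q z)⁻¹ ∂ν := by
    rw [mean_apply, ← integral_const_mul]
    congr 1; ext z
    simp only [rangeVec, bandWeight, Prod.mk_mul_mk, mul_one, ContinuousMap.coe_mk]
    rw [max_eq_left (lower_symbol_ge hq hε hε1 hmu z)]
    field_simp
  have h4 := integral_lower_inv_sub_le ν hq hc hε hε1 hmu
  rw [← h3] at h4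
  calc _ = |2 * n * (modeDet ν q ε hd n mu - mean ν (rangeVec q ε hd n mu).1) +
        (2 * n * mean ν (rangeVec q ε hd n mu).1 - dispersion ν mu)| := by congr 1; ring
    _ ≤ 2 * n * |modeDet ν q ε hd n mu - mean ν (rangeVec q ε hd n mu).1| + 8 / c ^ 2 * ε := by
      refine (abs_add_le _ _).trans (add_le_add ?_ h4)
      rw [abs_mul, abs_of_nonneg (by positivity)]
    _ ≤ 2 * n * (2 * ((c / 4)⁻¹ * ((2 * n + 1) * ε)) * (c / 4)⁻¹) + 8 / c ^ 2 * ε := by gcongr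
    _ = _ := by field_simp; ring

/-- The solution space of the mode equation is at most one-dimensional. -/
theorem modeEq_eq_smul (hq : ∀ z, |q z| ≤ 1) {ε mu c : ℝ} {n : ℕ} (hn : 1 ≤ n)
    (hc1 : c ≤ 1) (hε : 0 < ε) (hε1 : ε ≤ c / 4) (hmu : c / 2 ≤ mu) (hd : 0 < c / 4)
    (hsmall : (c / 4)⁻¹ * ((2 * n + 1) * ε) ≤ 1 / 2) {b u : C(Seg, ℝ)}
    (h : ModeEq ν q ε mu n b u) :
    (b, ε⁻¹ • u) = mean ν b • resolventVec (remainder ν q ε hd n mu) (rangeVec q ε hd n mu) := by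
  have hR := (norm_remainder_le ν q hε.le (by linarith) hd (by linarith) hn mu).trans hsmall
  have e : u = ε • (ε⁻¹ • u) := by rw [smul_smul, mul_inv_cancel₀ hε.ne', one_smul]
  rw [e, modeEq_iff ν q hε hd (lower_symbol_ge hq hε.le hε1 hmu)
    (upper_symbol_ge hq hε.le (by linarith) (by linarith))] at h
  exact eq_smul_resolventVec hR h

theorem modeEq_trivial_of_modeDet_ne_one (hq : ∀ z, |q z| ≤ 1) {ε mu c : ℝ} {n : ℕ} (hn : 1 ≤ n)
    (hc1 : c ≤ 1) (hε : 0 < ε) (hε1 : ε ≤ c / 4) (hmu : c / 2 ≤ mu) (hd : 0 < c / 4)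
    (hsmall : (c / 4)⁻¹ * ((2 * n + 1) * ε) ≤ 1 / 2) (hne : modeDet ν q ε hd n mu ≠ 1)
    {b u : C(Seg, ℝ)} (h : ModeEq ν q ε mu n b u) : b = 0 ∧ u = 0 := by
  have h1 := modeEq_eq_smul ν hq hn hc1 hε hε1 hmu hd hsmall h
  have h2 : mean ν b = mean ν b * modeDet ν q ε hd n mu := by
    have := congrArg (fun w => mean ν w.1) h1
    simpa only [Prod.smul_fst, map_smul, smul_eq_mul, modeDet] using this
  have h3 : mean ν b = 0 := by
    by_contra h0
    exact hne (mul_left_cancel₀ h0 (by rw [mul_one]; exact h2.symm))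
  rw [h3, zero_smul, Prod.ext_iff] at h1
  refine ⟨h1.1, ?_⟩
  have h5 : ε⁻¹ • u = 0 := h1.2
  exact (smul_eq_zero.1 h5).resolve_left (inv_ne_zero hε.ne')

theorem exists_modeEq_of_modeDet_eq_one (hq : ∀ z, |q z| ≤ 1) {ε mu c : ℝ} {n : ℕ} (hn : 1 ≤ n)
    (hc1 : c ≤ 1) (hε : 0 < ε) (hε1 : ε ≤ c / 4) (hmu : c / 2 ≤ mu) (hd : 0 < c / 4)
    (hsmall : (c / 4)⁻¹ * ((2 * n + 1) * ε) ≤ 1 / 2) (h1 : modeDet ν q ε hd n mu = 1) :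
    ∃ b u : C(Seg, ℝ), ModeEq ν q ε mu n b u ∧ (b ≠ 0 ∨ u ≠ 0) ∧
      ∀ b' u' : C(Seg, ℝ), ModeEq ν q ε mu n b' u' → ∃ k : ℝ, b' = k • b ∧ u' = k • u := by
  have hR := (norm_remainder_le ν q hε.le (by linarith) hd (by linarith) hn mu).trans hsmall
  set s := resolventVec (remainder ν q ε hd n mu) (rangeVec q ε hd n mu) with hs
  have hmean : mean ν s.1 = 1 := h1
  refine ⟨s.1, ε • s.2, ?_, Or.inl ?_, ?_⟩
  · rw [modeEq_iff ν q hε hd (lower_symbol_ge hq hε.le hε1 hmu)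
      (upper_symbol_ge hq hε.le (by linarith) (by linarith)), hmean, one_smul, Prod.mk.eta]
    exact resolventVec_eq (by linarith) _
  · intro h0; rw [h0, map_zero] at hmean; norm_num at hmean
  · intro b' u' h
    have h2 := modeEq_eq_smul ν hq hn hc1 hε hε1 hmu hd hsmall h
    rw [← hs, Prod.ext_iff] at h2
    refine ⟨mean ν b', h2.1, ?_⟩
    have h3 : ε⁻¹ • u' = mean ν b' • s.2 := h2.2
    rw [smul_comm, ← h3, smul_smul, mul_inv_cancel₀ hε.ne', one_smul]

/-- Existence of a speed near `1 + mu₁ ε` for which the kernel is one-dimensional and carried by the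
mode `m`. -/
theorem exists_speed {M c : ℝ} (hM : 1 < M) (hc : 0 < c) (hc1 : c ≤ 1 / 2) :
    ∃ ε₀ C : ℝ, 0 < ε₀ ∧ ε₀ ≤ c / 4 ∧ 0 < C ∧
      ∀ (ν : Measure Seg) [IsProbabilityMeasure ν] (q : C(Seg, ℝ)), (∀ z, |q z| ≤ 1) →
      ∀ m : ℕ, 1 ≤ m → (m : ℝ) < M → ∀ mu₁, c ≤ mu₁ → mu₁ ≤ 1 / 2 → dispersion ν mu₁ = 2 * m →
      ∀ ε, 0 < ε → ε < ε₀ → ∃ mu : ℝ, |mu - mu₁| ≤ C * ε ∧ c / 2 ≤ mu ∧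
        ∃ b u : C(Seg, ℝ), ModeEq ν q ε mu m b u ∧ (b ≠ 0 ∨ u ≠ 0) ∧
        (∀ b' u' : C(Seg, ℝ), ModeEq ν q ε mu m b' u' → ∃ k : ℝ, b' = k • b ∧ u' = k • u) ∧
        ∀ n : ℕ, 1 ≤ n → n ≠ m → ∀ b' u' : C(Seg, ℝ), ModeEq ν q ε mu n b' u' →
          b' = 0 ∧ u' = 0 := by
  set C₁ : ℝ := (64 * M * (2 * M + 1) + 8) / c ^ 2 with hC₁
  have hC₁0 : 0 < C₁ := by positivity
  set L : ℝ := (c / 4)⁻¹ * (2 * M + 1) with hL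
  have hL0 : 0 < L := by positivity
  set N : ℝ := 72 / c ^ 2 * C₁ + C₁ + 1 with hN
  have hN0 : 0 < N := by positivity
  refine ⟨min (c / 4) (min (1 / 2 / L) (min (c / 4 / (18 * C₁)) (min (1 / 4 / N)
    (1 / 2 / (2 * M + 1))))), 18 * C₁, by positivity, min_le_left _ _, by positivity, ?_⟩
  intro ν _ q hq m hm hmM mu₁ hmu1 hmu2 hF ε hε hεlt
  simp only [lt_min_iff] at hεlt
  obtain ⟨e1, e2, e3, e4, e5⟩ := hεlt
  rw [lt_div_iff₀ (by positivity)] at e2 e3 e4 e5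
  have hd : 0 < c / 4 := by positivity
  have hm' : (1 : ℝ) ≤ m := by exact_mod_cast hm
  set δ := 18 * C₁ * ε with hδ
  have hδ1 : δ < c / 4 := by rw [hδ]; linarith
  have hδ0 : 0 < δ := by positivity
  have small : ∀ n : ℕ, n ≤ m → (c / 4)⁻¹ * ((2 * n + 1) * ε) ≤ 1 / 2 := by
    intro n hn
    have hn' : (n : ℝ) ≤ m := by exact_mod_cast hn
    calc _ ≤ (c / 4)⁻¹ * ((2 * M + 1) * ε) := by gcongr; linarith
      _ = ε * L := by rw [hL]; ring
      _ ≤ _ := e2.le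
  have approx : ∀ n : ℕ, 1 ≤ n → n ≤ m → ∀ mu, c / 2 ≤ mu →
      |2 * n * modeDet ν q ε hd n mu - dispersion ν mu| ≤ C₁ * ε := by
    intro n hn1 hn mu hmu
    have hn' : (n : ℝ) ≤ M := by
      have : (n : ℝ) ≤ m := by exact_mod_cast hn
      linarith
    refine (modeDet_approx ν hq hn1 hc (by linarith) hε.le e1.le hmu hd (small n hn)).trans ?_
    rw [hC₁]; gcongr
  have hlo : modeDet ν q ε hd m (mu₁ + δ) ≤ 1 := by
    have h1 := (abs_le.1 (approx m hm le_rfl (mu₁ + δ) (by linarith))).2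
    have h2 := le_dispersion_sub ν (mu := mu₁) (mu' := mu₁ + δ) (by linarith) (by linarith)
      (by linarith)
    rw [hF] at h2
    have h3 : (mu₁ + δ - mu₁) / 9 = 2 * (C₁ * ε) := by rw [hδ]; ring
    have h4 : 0 < C₁ * ε := by positivity
    by_contra h5
    push Not at h5
    have : 2 * (m : ℝ) < 2 * m * modeDet ν q ε hd m (mu₁ + δ) := by nlinarith
    linarith
  have hhi : 1 ≤ modeDet ν q ε hd m (mu₁ - δ) := by
    have h1 := (abs_le.1 (approx m hm le_rfl (mu₁ - δ) (by linarith))).1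
    have h2 := le_dispersion_sub ν (mu := mu₁ - δ) (mu' := mu₁) (by linarith) (by linarith)
      (by linarith)
    rw [hF] at h2
    have h3 : (mu₁ - (mu₁ - δ)) / 9 = 2 * (C₁ * ε) := by rw [hδ]; ring
    have h4 : 0 < C₁ * ε := by positivity
    by_contra h5
    push Not at h5
    have : 2 * m * modeDet ν q ε hd m (mu₁ - δ) < 2 * (m : ℝ) := by nlinarith
    linarith
  obtain ⟨mu, hmu, hdet⟩ := intermediate_value_Icc' (by linarith : mu₁ - δ ≤ mu₁ + δ)
    (continuousOn_modeDet ν q hε.le (by linarith) hd (by linarith) hm (small m le_rfl)).continuousOn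
    ⟨hlo, hhi⟩
  have hmuc : c / 2 ≤ mu := by linarith [hmu.1]
  have habs : |mu - mu₁| ≤ δ := abs_le.2 ⟨by linarith [hmu.1], by linarith [hmu.2]⟩
  have hFmu : |dispersion ν mu - 2 * m| ≤ 72 / c ^ 2 * C₁ * ε := by
    rw [← hF]
    refine (dispersion_sub_le_abs ν (d := c / 2) (by positivity) hmuc (by linarith)).trans ?_
    calc _ ≤ δ / (c / 2) ^ 2 := by gcongr
      _ = _ := by rw [hδ]; field_simp; ring
  have hNε : 72 / c ^ 2 * C₁ * ε + C₁ * ε < 1 / 4 := by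
    rw [hN] at e4; linarith
  have hC8 : 8 / c ^ 2 * ε ≤ C₁ * ε := by
    rw [hC₁]; gcongr; nlinarith
  refine ⟨mu, habs, hmuc, ?_⟩
  obtain ⟨b, u, h1, h2, h3⟩ := exists_modeEq_of_modeDet_eq_one ν hq hm (by linarith) hε e1.le
    hmuc hd (small m le_rfl) hdet
  refine ⟨b, u, h1, h2, h3, fun n hn hnm b' u' h => ?_⟩
  rcases lt_or_gt_of_ne hnm with hlt | hgt
  · refine modeEq_trivial_of_modeDet_ne_one ν hq hn (by linarith) hε e1.le hmuc hd
      (small n hlt.le) (fun h1 => ?_) h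
    have h5 := approx n hn hlt.le mu hmuc
    rw [h1] at h5
    have h6 := (abs_le.1 h5).1
    have h7 := (abs_le.1 hFmu).1
    have h8 : (n : ℝ) + 1 ≤ m := by exact_mod_cast hlt
    linarith
  · have h8 : (m : ℝ) + 1 ≤ n := by exact_mod_cast hgt
    refine modeEq_trivial ν hq hn hc hε.le e1.le (by linarith) hmuc (S := 2 * m + 1 / 4) ?_ ?_ h
    · have h4 := (abs_le.1 (integral_lower_inv_sub_le ν hq hc hε.le e1.le hmuc)).2
      have h7 := (abs_le.1 hFmu).2
      linarith
    · nlinarith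

end CouetteWave

namespace CouetteWave

/-! ### The vorticity density -/

section Density
variable {Θ : ℝ → ℝ}

/-- The primitive of the mollifier. -/
noncomputable def mollifierPrim (Θ : ℝ → ℝ) (t : ℝ) : ℝ := ∫ s in (-1 : ℝ)..t, Θ s

theorem IsMollifier.hasDerivAt_prim (hΘ : IsMollifier Θ) (t : ℝ) :
    HasDerivAt (mollifierPrim Θ) (Θ t) t :=
  intervalIntegral.integral_hasDerivAt_right (hΘ.smooth.continuous.intervalIntegrable _ _)
    (hΘ.smooth.continuous.stronglyMeasurableAtFilter _ _) hΘ.smooth.continuous.continuousAt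

theorem IsMollifier.contDiff_prim (hΘ : IsMollifier Θ) : ContDiff ℝ ∞ (mollifierPrim Θ) := by
  rw [contDiff_infty_iff_deriv]
  refine ⟨fun t => (hΘ.hasDerivAt_prim t).differentiableAt, ?_⟩
  have : deriv (mollifierPrim Θ) = Θ := funext fun t => (hΘ.hasDerivAt_prim t).deriv
  rw [this]; exact hΘ.smooth

theorem IsMollifier.eq_zero (hΘ : IsMollifier Θ) {t : ℝ} (ht : t ∉ Ioo (-1 : ℝ) 1) : Θ t = 0 := by
  by_contra h; exact ht (hΘ.support_subset h)

theorem IsMollifier.monotone_prim (hΘ : IsMollifier Θ) : Monotone (mollifierPrim Θ) :=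
  monotone_of_hasDerivAt_nonneg hΘ.hasDerivAt_prim hΘ.nonneg

theorem IsMollifier.prim_of_le (hΘ : IsMollifier Θ) {t : ℝ} (ht : t ≤ -1) :
    mollifierPrim Θ t = 0 := by
  unfold mollifierPrim
  rw [intervalIntegral.integral_symm, neg_eq_zero]
  refine intervalIntegral.integral_zero_ae (Filter.Eventually.of_forall fun s hs => hΘ.eq_zero ?_)
  rw [uIoc_of_le ht] at hs
  exact fun h => absurd hs.2 (not_le.2 h.1)

theorem IsMollifier.prim_of_ge (hΘ : IsMollifier Θ) {t : ℝ} (ht : 1 ≤ t) :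
    mollifierPrim Θ t = 1 := by
  unfold mollifierPrim
  rw [← intervalIntegral.integral_add_adjacent_intervals (b := 1)
    (hΘ.smooth.continuous.intervalIntegrable _ _) (hΘ.smooth.continuous.intervalIntegrable _ _),
    hΘ.integral_eq_one, add_eq_left]
  refine intervalIntegral.integral_zero_ae (Filter.Eventually.of_forall fun s hs => hΘ.eq_zero ?_)
  rw [uIoc_of_le ht] at hs
  exact fun h => absurd hs.1 (not_lt.2 h.2.le)

theorem IsMollifier.prim_mem (hΘ : IsMollifier Θ) (t : ℝ) : mollifierPrim Θ t ∈ Icc (0 : ℝ) 1 := by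
  constructor
  · rw [← hΘ.prim_of_le (min_le_right t (-1))]; exact hΘ.monotone_prim (min_le_left _ _)
  · rw [← hΘ.prim_of_ge (le_max_right t 1)]; exact hΘ.monotone_prim (le_max_left _ _)

theorem IsMollifier.psiDeriv_eq (hΘ : IsMollifier Θ) {κ : ℝ} (hκ : 0 < κ) (z : ℝ) :
    psiDeriv Θ κ z = mollifierPrim Θ ((z + 1 - κ) / κ) - mollifierPrim Θ ((z - 1 + κ) / κ) := by
  unfold psiDeriv mollifierScaled mollifierPrim
  have hi : ∀ a b, IntervalIntegrable Θ volume a b := fun a b =>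
    hΘ.smooth.continuous.intervalIntegrable _ _
  rw [intervalIntegral.integral_const_mul, intervalIntegral.integral_interval_sub_left (hi _ _)
    (hi _ _)]
  simp only [sub_div z _ κ]
  rw [intervalIntegral.integral_comp_sub_div _ hκ.ne', smul_eq_mul, ← mul_assoc,
    one_div_mul_cancel hκ.ne', one_mul]
  congr 1 <;> ring

theorem IsMollifier.contDiff_psiDeriv (hΘ : IsMollifier Θ) {κ : ℝ} (hκ : 0 < κ) :
    ContDiff ℝ ∞ (psiDeriv Θ κ) := by
  rw [funext (hΘ.psiDeriv_eq hκ)]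
  have h := hΘ.contDiff_prim
  fun_prop

theorem IsMollifier.psiDeriv_nonneg (hΘ : IsMollifier Θ) {κ : ℝ} (hκ : 0 < κ) (hκ1 : κ ≤ 1)
    (z : ℝ) : 0 ≤ psiDeriv Θ κ z := by
  rw [hΘ.psiDeriv_eq hκ, sub_nonneg]
  exact hΘ.monotone_prim (by gcongr ?_ / _; linarith)

theorem IsMollifier.psiDeriv_le_one (hΘ : IsMollifier Θ) {κ : ℝ} (hκ : 0 < κ) (z : ℝ) :
    psiDeriv Θ κ z ≤ 1 := by
  rw [hΘ.psiDeriv_eq hκ]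
  linarith [(hΘ.prim_mem ((z + 1 - κ) / κ)).2, (hΘ.prim_mem ((z - 1 + κ) / κ)).1]

theorem IsMollifier.psiDeriv_eq_one (hΘ : IsMollifier Θ) {κ : ℝ} (hκ : 0 < κ) {z : ℝ}
    (hz : z ∈ Icc (-1 + 2 * κ) (1 - 2 * κ)) : psiDeriv Θ κ z = 1 := by
  rw [hΘ.psiDeriv_eq hκ, hΘ.prim_of_ge, hΘ.prim_of_le, sub_zero]
  · rw [div_le_iff₀ hκ]; linarith [hz.2]
  · rw [le_div_iff₀ hκ]; linarith [hz.1]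

theorem IsMollifier.integral_psiDeriv_le (hΘ : IsMollifier Θ) {κ : ℝ} (hκ : 0 < κ) :
    ∫ z in (-1 : ℝ)..1, psiDeriv Θ κ z ≤ 2 := by
  calc _ ≤ ∫ _ in (-1 : ℝ)..1, (1 : ℝ) := intervalIntegral.integral_mono_on (by norm_num)
        ((hΘ.contDiff_psiDeriv hκ).continuous.intervalIntegrable _ _)
        intervalIntegrable_const fun z _ => hΘ.psiDeriv_le_one hκ z
    _ = 2 := by norm_num

theorem IsMollifier.integral_psiDeriv_pos (hΘ : IsMollifier Θ) {κ : ℝ} (hκ : 0 < κ)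
    (hκ1 : κ < 1 / 2) : 0 < ∫ z in (-1 : ℝ)..1, psiDeriv Θ κ z := by
  refine intervalIntegral.integral_pos (by norm_num)
    (hΘ.contDiff_psiDeriv hκ).continuous.continuousOn
    (fun z _ => hΘ.psiDeriv_nonneg hκ (by linarith) z) ⟨0, by simp, ?_⟩
  rw [hΘ.psiDeriv_eq_one hκ ⟨by linarith, by linarith⟩]; norm_num

/-- The density `-φ_κ'`. -/
noncomputable def density (Θ : ℝ → ℝ) (κ z : ℝ) : ℝ :=
  if κ = 0 then 1 / 2 else psiDeriv Θ κ z / ∫ s in (-1 : ℝ)..1, psiDeriv Θ κ s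

theorem IsMollifier.contDiff_density (hΘ : IsMollifier Θ) {κ : ℝ} (hκ : 0 ≤ κ) :
    ContDiff ℝ ∞ (density Θ κ) := by
  unfold density
  rcases hκ.eq_or_lt with h | h
  · simp only [← h, if_true]; exact contDiff_const
  · simp only [h.ne', if_false]; exact (hΘ.contDiff_psiDeriv h).div_const _

theorem IsMollifier.density_nonneg (hΘ : IsMollifier Θ) {κ : ℝ} (hκ : 0 ≤ κ) (hκ1 : κ < 1 / 2)
    (z : ℝ) : 0 ≤ density Θ κ z := by
  unfold density
  rcases hκ.eq_or_lt with h | h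
  · simp [← h]
  · simp only [h.ne', if_false]
    exact div_nonneg (hΘ.psiDeriv_nonneg h (by linarith) z) (hΘ.integral_psiDeriv_pos h hκ1).le

theorem IsMollifier.integral_density (hΘ : IsMollifier Θ) {κ : ℝ} (hκ : 0 ≤ κ) (hκ1 : κ < 1 / 2) :
    ∫ z in (-1 : ℝ)..1, density Θ κ z = 1 := by
  unfold density
  rcases hκ.eq_or_lt with h | h
  · simp only [← h, if_true]; norm_num
  · simp only [h.ne', if_false]
    rw [intervalIntegral.integral_div, div_self (hΘ.integral_psiDeriv_pos h hκ1).ne']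

theorem IsMollifier.half_le_density (hΘ : IsMollifier Θ) {κ : ℝ} (hκ : 0 ≤ κ) (hκ1 : κ < 1 / 2)
    {z : ℝ} (hz : z ∈ Icc (-1 + 2 * κ) (1 - 2 * κ)) : 1 / 2 ≤ density Θ κ z := by
  unfold density
  rcases hκ.eq_or_lt with h | h
  · simp [← h]
  · simp only [h.ne', if_false]
    rw [hΘ.psiDeriv_eq_one h hz]
    exact one_div_le_one_div_of_le (hΘ.integral_psiDeriv_pos h hκ1) (hΘ.integral_psiDeriv_le h)

theorem IsMollifier.hasDerivAt_phi (hΘ : IsMollifier Θ) {κ : ℝ} (hκ : 0 ≤ κ) (z : ℝ) :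
    HasDerivAt (phi Θ κ) (-density Θ κ z) z := by
  unfold density
  rcases hκ.eq_or_lt with h | h
  · have : phi Θ κ = fun z => (1 - z) / 2 := by ext z; simp [phi, ← h]
    rw [this]
    simp only [← h, if_true]
    have h1 := ((hasDerivAt_id z).const_sub 1).div_const 2
    rwa [neg_div] at h1
  · have : phi Θ κ = fun z => 1 - (∫ s in (-1 : ℝ)..z, psiDeriv Θ κ s) /
        ∫ s in (-1 : ℝ)..1, psiDeriv Θ κ s := by ext z; simp [phi, h.ne']
    rw [this]
    simp only [h.ne', if_false]
    have hc := (hΘ.contDiff_psiDeriv h).continuous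
    exact ((intervalIntegral.integral_hasDerivAt_right (hc.intervalIntegrable _ _)
      (hc.stronglyMeasurableAtFilter _ _) hc.continuousAt).div_const _).const_sub 1

/-- The derivative of the profile on the bands. -/
noncomputable def bandSlope (a : ℝ → ℝ) (ε y : ℝ) : ℝ :=
  if 0 < y then -a ((y - 1) / ε) else a ((-1 - y) / ε)

theorem IsMollifier.deriv_profile (hΘ : IsMollifier Θ) {ε κ y : ℝ} (hκ : 0 ≤ κ) (hε : 0 < ε)
    (hε1 : ε < 1) (hy : y ∈ Ioo (-1 - ε) (-1 + ε) ∪ Ioo (1 - ε) (1 + ε)) :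
    deriv (profile Θ ε κ) y = bandSlope (density Θ κ) ε y := by
  unfold bandSlope
  rcases hy with hy | hy
  · have h0 : ¬ 0 < y := by linarith [hy.2]
    rw [if_neg h0]
    have : profile Θ ε κ =ᶠ[nhds y] fun y => ε * phi Θ κ ((-1 - y) / ε) := by
      filter_upwards [isOpen_Ioo.mem_nhds hy] with t ht
      have h1 : |t| = -t := abs_of_neg (by linarith [ht.2])
      unfold profile
      rw [h1, if_neg (by linarith [ht.2]), if_pos (by linarith [ht.1])]
      ring_nf
    rw [this.deriv_eq]
    have h2 : HasDerivAt (fun y : ℝ => (-1 - y) / ε) (-1 / ε) y :=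
      ((hasDerivAt_id y).const_sub (-1)).div_const ε
    have h3 : HasDerivAt (fun y => ε * phi Θ κ ((-1 - y) / ε)) _ y :=
      ((hΘ.hasDerivAt_phi hκ _).comp y h2).const_mul ε
    rw [h3.deriv]
    field_simp
  · have h0 : 0 < y := by linarith [hy.1]
    rw [if_pos h0]
    have : profile Θ ε κ =ᶠ[nhds y] fun y => ε * phi Θ κ ((y - 1) / ε) := by
      filter_upwards [isOpen_Ioo.mem_nhds hy] with t ht
      have h1 : |t| = t := abs_of_pos (by linarith [ht.1])
      unfold profile
      rw [h1, if_neg (by linarith [ht.1]), if_pos (by linarith [ht.2])]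
    rw [this.deriv_eq]
    have h2 : HasDerivAt (fun y : ℝ => (y - 1) / ε) (1 / ε) y :=
      ((hasDerivAt_id y).sub_const 1).div_const ε
    have h3 : HasDerivAt (fun y => ε * phi Θ κ ((y - 1) / ε)) _ y :=
      ((hΘ.hasDerivAt_phi hκ _).comp y h2).const_mul ε
    rw [h3.deriv]
    field_simp

end Density

/-! ### The measure on the reference interval -/

/-- The measure with density `a` on the reference interval. -/
noncomputable def segMeasure (a : ℝ → ℝ) : Measure Seg :=
  (Measure.comap Subtype.val volume).withDensity fun z => ENNReal.ofReal (a z)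

theorem integral_segMeasure {a : ℝ → ℝ} (ha : Continuous a) (ha0 : ∀ z, 0 ≤ a z) (f : ℝ → ℝ) :
    ∫ z : Seg, f z ∂segMeasure a = ∫ z in (-1 : ℝ)..1, a z * f z := by
  unfold segMeasure
  rw [integral_withDensity_eq_integral_toReal_smul (by fun_prop)
    (Filter.Eventually.of_forall fun _ => ENNReal.ofReal_lt_top)]
  simp only [ENNReal.toReal_ofReal (ha0 _), smul_eq_mul]
  rw [integral_subtype_comap measurableSet_Icc (fun z => a z * f z), integral_Icc_eq_integral_Ioc,
    ← intervalIntegral.integral_of_le (by norm_num)]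

theorem isProbabilityMeasure_segMeasure {a : ℝ → ℝ} (ha : Continuous a) (ha0 : ∀ z, 0 ≤ a z)
    (ha1 : ∫ z in (-1 : ℝ)..1, a z = 1) : IsProbabilityMeasure (segMeasure a) := by
  constructor
  unfold segMeasure
  rw [withDensity_apply _ MeasurableSet.univ, Measure.restrict_univ,
    ← lintegral_subtype_comap measurableSet_Icc (fun z => ENNReal.ofReal (a z)) |>.symm,
    ← ofReal_integral_eq_lintegral_ofReal]
  · rw [integral_Icc_eq_integral_Ioc, ← intervalIntegral.integral_of_le (by norm_num), ha1]; simp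
  · exact ha.continuousOn.integrableOn_Icc
  · exact Filter.Eventually.of_forall ha0

theorem IsMollifier.le_dispersion {Θ : ℝ → ℝ} (hΘ : IsMollifier Θ) {κ M : ℝ} (hM : 1 < M)
    (hκ : 0 ≤ κ) (hκ1 : κ < Real.exp (-(4 * M)) / 2) :
    2 * M ≤ dispersion (segMeasure (density Θ κ)) (Real.exp (-(4 * M))) := by
  set c := Real.exp (-(4 * M)) with hc
  have hc0 : 0 < c := Real.exp_pos _
  have hc1 : c < 1 / 2 := by
    have h1 : c * Real.exp (4 * M) = 1 := by rw [hc, ← Real.exp_add]; simp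
    have h2 := Real.add_one_le_exp (4 * M)
    nlinarith
  have hκ2 : κ < 1 / 2 := by linarith
  have hac := (hΘ.contDiff_density hκ).continuous
  have ha0 := hΘ.density_nonneg hκ hκ2
  unfold dispersion
  rw [integral_segMeasure hac ha0 (fun z => (c + 1 - z)⁻¹)]
  have hcont : ContinuousOn (fun z => density Θ κ z * (c + 1 - z)⁻¹) (Icc (-1) 1) := by
    refine hac.continuousOn.mul (ContinuousOn.inv₀ (by fun_prop) fun z hz => ?_)
    intro h; linarith [hz.2]
  have hcont2 : ContinuousOn (fun z => (1 / 2 : ℝ) * (c + 1 - z)⁻¹) (Icc (-1) 1) := by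
    refine continuousOn_const.mul (ContinuousOn.inv₀ (by fun_prop) fun z hz => ?_)
    intro h; linarith [hz.2]
  have hle : -1 + 2 * κ ≤ 1 - 2 * κ := by linarith
  have hsub : Icc (-1 + 2 * κ) (1 - 2 * κ) ⊆ Icc (-1 : ℝ) 1 :=
    Icc_subset_Icc (by linarith) (by linarith)
  calc 2 * M ≤ 1 / 2 * Real.log ((c + 2 - 2 * κ) / (c + 2 * κ)) := by
        have h1 : Real.exp (4 * M) ≤ (c + 2 - 2 * κ) / (c + 2 * κ) := by
          rw [le_div_iff₀ (by linarith)]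
          have h1 : Real.exp (4 * M) * c = 1 := by rw [hc, ← Real.exp_add]; simp
          have := Real.exp_pos (4 * M)
          nlinarith
        have h2 := Real.log_le_log (Real.exp_pos _) h1
        rw [Real.log_exp] at h2
        linarith
    _ = ∫ z in (-1 + 2 * κ)..(1 - 2 * κ), 1 / 2 * (c + 1 - z)⁻¹ := by
        rw [intervalIntegral.integral_const_mul,
          intervalIntegral.integral_comp_sub_left (fun x => x⁻¹) (c + 1),
          integral_inv_of_pos (by linarith) (by linarith)]
        congr 3 <;> ring
    _ ≤ ∫ z in (-1 + 2 * κ)..(1 - 2 * κ), density Θ κ z * (c + 1 - z)⁻¹ := by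
        refine intervalIntegral.integral_mono_on hle
          ((hcont2.mono hsub).intervalIntegrable_of_Icc hle)
          ((hcont.mono hsub).intervalIntegrable_of_Icc hle) fun z hz => ?_
        have h1 := hΘ.half_le_density hκ hκ2 hz
        have h2 : 0 < c + 1 - z := by linarith [hz.2]
        gcongr
    _ ≤ ∫ z in (-1 : ℝ)..1, density Θ κ z * (c + 1 - z)⁻¹ := by
        refine intervalIntegral.integral_mono_interval (by linarith) hle (by linarith) ?_
          (hcont.intervalIntegrable_of_Icc (by norm_num))
        refine (ae_restrict_iff' measurableSet_Ioc).2 (Filter.Eventually.of_forall fun z hz => ?_)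
        have h2 : 0 < c + 1 - z := by linarith [hz.2]
        exact mul_nonneg (ha0 z) (inv_nonneg.2 h2.le)

end CouetteWave

namespace CouetteWave

/-! ### Smoothness of the solutions of the mode equations -/

/-- The function `z ↦ ∫ min(z,t) dν(t)`. -/
noncomputable def minMean (ν : Measure Seg) [IsProbabilityMeasure ν] : C(Seg, ℝ) :=
  ⟨fun z => ∫ t : Seg, min (z : ℝ) t ∂ν, by
    refine continuous_of_dominated (bound := fun _ => 1) ?_ ?_ (integrable_const _) ?_
    · intro z; exact (by fun_prop : Continuous fun t : Seg => min (z : ℝ) t).aestronglyMeasurable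
    · intro z; refine Filter.Eventually.of_forall fun t => ?_
      rw [Real.norm_eq_abs, abs_le]
      exact ⟨le_min z.2.1 t.2.1, (min_le_left _ _).trans z.2.2⟩
    · exact Filter.Eventually.of_forall fun t => by fun_prop⟩

theorem abs_minMean_le (ν : Measure Seg) [IsProbabilityMeasure ν] (z : Seg) :
    |minMean ν z| ≤ 1 := by
  calc |∫ t : Seg, min (z : ℝ) t ∂ν| ≤ 1 * ν.real univ := by
        have h : ∀ t : Seg, ‖min (z : ℝ) t‖ ≤ 1 := fun t => by
          rw [Real.norm_eq_abs, abs_le]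
          exact ⟨le_min z.2.1 t.2.1, (min_le_left _ _).trans z.2.2⟩
        exact norm_integral_le_of_norm_le_const (μ := ν) (Filter.Eventually.of_forall h)
    _ = 1 := by simp

/-- The extension of a function on the reference interval, constant to the left and to the
right. -/
noncomputable def segExtend (f : C(Seg, ℝ)) : ℝ → ℝ :=
  IccExtend (by norm_num : (-1 : ℝ) ≤ 1) f

theorem continuous_segExtend (f : C(Seg, ℝ)) : Continuous (segExtend f) :=
  f.continuous.Icc_extend'

theorem segExtend_of_mem (f : C(Seg, ℝ)) {z : ℝ} (hz : z ∈ Icc (-1 : ℝ) 1) :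
    segExtend f z = f ⟨z, hz⟩ := IccExtend_of_mem _ _ hz

theorem segExtend_coe (f : C(Seg, ℝ)) (z : Seg) : segExtend f z = f z := IccExtend_val _ _ _

theorem contDiffOn_primitive {f : ℝ → ℝ} (hf : Continuous f) {k : ℕ}
    (h : ContDiffOn ℝ k f (Icc (-1) 1)) :
    ContDiffOn ℝ (k + 1) (fun z => ∫ t in (-1 : ℝ)..z, f t) (Icc (-1) 1) := by
  have hd : ∀ z, HasDerivAt (fun z => ∫ t in (-1 : ℝ)..z, f t) (f z) z := fun z =>
    intervalIntegral.integral_hasDerivAt_right (hf.intervalIntegrable _ _)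
      (hf.stronglyMeasurableAtFilter _ _) hf.continuousAt
  have hu : UniqueDiffOn ℝ (Icc (-1 : ℝ) 1) := uniqueDiffOn_Icc (by norm_num)
  rw [contDiffOn_succ_iff_derivWithin hu]
  refine ⟨fun z _ => (hd z).differentiableAt.differentiableWithinAt, by simp, ?_⟩
  exact h.congr fun z hz => (hd z).hasDerivWithinAt.derivWithin (hu z hz)

theorem contDiffOn_primitive_right {f : ℝ → ℝ} (hf : Continuous f) {k : ℕ}
    (h : ContDiffOn ℝ k f (Icc (-1) 1)) :
    ContDiffOn ℝ (k + 1) (fun z => ∫ t in z..(1 : ℝ), f t) (Icc (-1) 1) := by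
  have : (fun z => ∫ t in z..(1 : ℝ), f t) =
      fun z => (∫ t in (-1 : ℝ)..1, f t) - ∫ t in (-1 : ℝ)..z, f t := by
    ext z
    rw [intervalIntegral.integral_interval_sub_left] <;> exact hf.intervalIntegrable _ _
  rw [this]
  exact contDiffOn_const.sub (contDiffOn_primitive hf h)

theorem integral_exp_abs_eq {f : ℝ → ℝ} (hf : Continuous f) (c : ℝ) {z : ℝ}
    (hz : z ∈ Icc (-1 : ℝ) 1) :
    ∫ t in (-1 : ℝ)..1, Real.exp (-(c * |z - t|)) * f t =
      Real.exp (-(c * z)) * (∫ t in (-1 : ℝ)..z, Real.exp (c * t) * f t) +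
      Real.exp (c * z) * ∫ t in z..(1 : ℝ), Real.exp (-(c * t)) * f t := by
  have hc : Continuous fun t => Real.exp (-(c * |z - t|)) * f t := by fun_prop
  rw [← intervalIntegral.integral_add_adjacent_intervals (hc.intervalIntegrable (-1) z)
    (hc.intervalIntegrable z 1), ← intervalIntegral.integral_const_mul,
    ← intervalIntegral.integral_const_mul]
  congr 1
  · refine intervalIntegral.integral_congr fun t ht => ?_
    rw [uIcc_of_le hz.1] at ht
    rw [abs_of_nonneg (by linarith [ht.2]), ← mul_assoc, ← Real.exp_add]
    ring_nf
  · refine intervalIntegral.integral_congr fun t ht => ?_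
    rw [uIcc_of_le hz.2] at ht
    rw [abs_of_nonpos (by linarith [ht.1]), ← mul_assoc, ← Real.exp_add]
    ring_nf

theorem contDiffOn_integral_exp_abs {f : ℝ → ℝ} (hf : Continuous f) (c : ℝ) {k : ℕ}
    (h : ContDiffOn ℝ k f (Icc (-1) 1)) :
    ContDiffOn ℝ (k + 1) (fun z => ∫ t in (-1 : ℝ)..1, Real.exp (-(c * |z - t|)) * f t)
      (Icc (-1) 1) := by
  refine ContDiffOn.congr (f := fun z =>
      Real.exp (-(c * z)) * (∫ t in (-1 : ℝ)..z, Real.exp (c * t) * f t) +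
      Real.exp (c * z) * ∫ t in z..(1 : ℝ), Real.exp (-(c * t)) * f t) ?_
    fun z hz => integral_exp_abs_eq hf c hz
  have e1 : ∀ {l : WithTop ℕ∞} (c : ℝ), ContDiffOn ℝ l (fun z => Real.exp (c * z)) (Icc (-1) 1) :=
    fun c => ContDiff.contDiffOn (by fun_prop)
  have e2 : ∀ {l : WithTop ℕ∞} (c : ℝ), ContDiffOn ℝ l (fun z => Real.exp (-(c * z)))
    (Icc (-1) 1) := fun c => ContDiff.contDiffOn (by fun_prop)
  exact ((e2 c).mul (contDiffOn_primitive (by fun_prop) ((e1 c).mul h))).add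
    ((e1 c).mul (contDiffOn_primitive_right (by fun_prop) ((e2 c).mul h)))

section
variable {a : ℝ → ℝ} (ha : ContDiff ℝ ∞ a) (ha0 : ∀ z, 0 ≤ a z)
  [IsProbabilityMeasure (segMeasure a)]
include ha ha0

theorem contDiffOn_segExtend_minMean (k : ℕ) :
    ContDiffOn ℝ k (segExtend (minMean (segMeasure a))) (Icc (-1) 1) := by
  have hac := ha.continuous
  have hak : ContDiff ℝ k a := ha.of_le (by exact_mod_cast le_top)
  refine ContDiffOn.congr (f := fun z => (∫ t in (-1 : ℝ)..z, t * a t) +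
    z * ∫ t in z..(1 : ℝ), a t) ?_ ?_
  · refine ContDiffOn.of_le (n := k + 1) ?_ (by exact_mod_cast Nat.le_succ k)
    exact (contDiffOn_primitive (by fun_prop) (contDiff_id.mul hak).contDiffOn).add
      (contDiff_id.contDiffOn.mul (contDiffOn_primitive_right hac hak.contDiffOn))
  · intro z hz
    rw [segExtend_of_mem _ hz]
    simp only [minMean, ContinuousMap.coe_mk]
    rw [integral_segMeasure hac ha0 (fun t => min z t)]
    have hc : Continuous fun t => a t * min z t := by fun_prop
    rw [← intervalIntegral.integral_add_adjacent_intervals (hc.intervalIntegrable (-1) z)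
      (hc.intervalIntegrable z 1), ← intervalIntegral.integral_const_mul]
    congr 1
    · refine intervalIntegral.integral_congr fun t ht => ?_
      rw [uIcc_of_le hz.1] at ht
      rw [min_eq_right ht.2, mul_comm]
    · refine intervalIntegral.integral_congr fun t ht => ?_
      rw [uIcc_of_le hz.2] at ht
      rw [min_eq_left ht.1, mul_comm]

theorem intOp_selfKernel_eq (ε : ℝ) (n : ℕ) (f : C(Seg, ℝ)) (z : Seg) :
    intOp (segMeasure a) (selfKernel ε n) f z =
      ∫ t in (-1 : ℝ)..1, Real.exp (-(n * ε * |(z : ℝ) - t|)) * (a t * segExtend f t) := by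
  have h := integral_segMeasure ha.continuous ha0
    (fun t => Real.exp (-(n * (ε * |(z : ℝ) - t|))) * segExtend f t)
  simp only [segExtend_coe] at h
  rw [intOp_apply]
  refine h.trans (intervalIntegral.integral_congr fun t _ => ?_)
  simp only [mul_assoc]; ring

theorem intOp_crossKernel_eq (ε : ℝ) (n : ℕ) (f : C(Seg, ℝ)) (z : Seg) :
    intOp (segMeasure a) (crossKernel ε n) f z =
      ∫ t in (-1 : ℝ)..1, Real.exp (-(n * (2 + ε * (z + t)))) * (a t * segExtend f t) := by
  have h := integral_segMeasure ha.continuous ha0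
    (fun t => Real.exp (-(n * (2 + ε * ((z : ℝ) + t)))) * segExtend f t)
  simp only [segExtend_coe] at h
  rw [intOp_apply]
  refine h.trans (intervalIntegral.integral_congr fun t _ => ?_)
  ring

theorem contDiffOn_intOp_selfKernel (ε : ℝ) (n : ℕ) (f : C(Seg, ℝ)) {k : ℕ}
    (h : ContDiffOn ℝ k (segExtend f) (Icc (-1) 1)) :
    ContDiffOn ℝ (k + 1) (segExtend (intOp (segMeasure a) (selfKernel ε n) f)) (Icc (-1) 1) := by
  have hac := ha.continuous
  have hf := continuous_segExtend f
  have hak : ContDiff ℝ k a := ha.of_le (by exact_mod_cast le_top)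
  refine (contDiffOn_integral_exp_abs (f := fun t => a t * segExtend f t) (by fun_prop) (n * ε)
    (hak.contDiffOn.mul h)).congr fun z hz => ?_
  rw [segExtend_of_mem _ hz, intOp_selfKernel_eq ha ha0]

theorem contDiffOn_intOp_crossKernel (ε : ℝ) (n : ℕ) (f : C(Seg, ℝ)) (k : WithTop ℕ∞) :
    ContDiffOn ℝ k (segExtend (intOp (segMeasure a) (crossKernel ε n) f)) (Icc (-1) 1) := by
  refine ContDiffOn.congr (f := fun z => Real.exp (-(n * (2 + ε * z))) *
    ∫ t in (-1 : ℝ)..1, Real.exp (-(n * (ε * t))) * (a t * segExtend f t))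
    (ContDiff.contDiffOn (by fun_prop)) fun z hz => ?_
  rw [segExtend_of_mem _ hz, intOp_crossKernel_eq ha ha0, ← intervalIntegral.integral_const_mul]
  refine intervalIntegral.integral_congr fun t _ => ?_
  rw [← mul_assoc (Real.exp _) (Real.exp _), ← Real.exp_add]
  ring_nf

/-- Solutions of the mode equations are smooth up to the boundary. -/
theorem ModeEq.contDiffOn {ε mu : ℝ} {n : ℕ} {b u : C(Seg, ℝ)}
    (h : ModeEq (segMeasure a) (minMean (segMeasure a)) ε mu n b u)
    (hD : ∀ z : Seg, mu + 1 - z + ε * minMean (segMeasure a) z ≠ 0)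
    (hA : ∀ z : Seg, 2 + ε * (mu + z - 1 - ε * minMean (segMeasure a) z) ≠ 0) :
    ContDiffOn ℝ ∞ (segExtend b) (Icc (-1) 1) ∧ ContDiffOn ℝ ∞ (segExtend u) (Icc (-1) 1) := by
  have key : ∀ k : ℕ, ContDiffOn ℝ k (segExtend b) (Icc (-1) 1) ∧
      ContDiffOn ℝ k (segExtend u) (Icc (-1) 1) := by
    intro k
    induction k with
    | zero => exact ⟨contDiffOn_zero.2 (continuous_segExtend b).continuousOn,
        contDiffOn_zero.2 (continuous_segExtend u).continuousOn⟩
    | succ k ih =>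
      have hq := contDiffOn_segExtend_minMean ha ha0 (k + 1)
      push_cast at hq ⊢
      constructor
      · refine ContDiffOn.congr (f := fun z =>
          (mu + 1 - z + ε * segExtend (minMean (segMeasure a)) z)⁻¹ * (1 / (2 * n) *
          (segExtend (intOp (segMeasure a) (selfKernel ε n) b) z -
            segExtend (intOp (segMeasure a) (crossKernel ε n) u) z))) ?_ fun z hz => ?_
        · refine ContDiffOn.mul (ContDiffOn.inv ?_ fun z hz => ?_) (contDiffOn_const.mul
            ((contDiffOn_intOp_selfKernel ha ha0 ε n b ih.1).sub
              (contDiffOn_intOp_crossKernel ha ha0 ε n u _)))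
          · exact (contDiffOn_const.sub contDiffOn_id).add (contDiffOn_const.mul hq)
          · rw [segExtend_of_mem _ hz]; exact hD ⟨z, hz⟩
        · simp only [segExtend_of_mem _ hz]
          rw [← h.1 ⟨z, hz⟩, inv_mul_cancel_left₀ (hD ⟨z, hz⟩)]
      · refine ContDiffOn.congr (f := fun z =>
          (2 + ε * (mu + z - 1 - ε * segExtend (minMean (segMeasure a)) z))⁻¹ * (ε / (2 * n) *
          (segExtend (intOp (segMeasure a) (crossKernel ε n) b) z -
            segExtend (intOp (segMeasure a) (selfKernel ε n) u) z))) ?_ fun z hz => ?_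
        · refine ContDiffOn.mul (ContDiffOn.inv ?_ fun z hz => ?_) (contDiffOn_const.mul
            ((contDiffOn_intOp_crossKernel ha ha0 ε n b _).sub
              (contDiffOn_intOp_selfKernel ha ha0 ε n u ih.2)))
          · exact contDiffOn_const.add (contDiffOn_const.mul
              (((contDiffOn_const.add contDiffOn_id).sub contDiffOn_const).sub
                (contDiffOn_const.mul hq)))
          · rw [segExtend_of_mem _ hz]; exact hA ⟨z, hz⟩
        · simp only [segExtend_of_mem _ hz]
          rw [← h.2 ⟨z, hz⟩, inv_mul_cancel_left₀ (hA ⟨z, hz⟩)]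
  exact ⟨contDiffOn_infty.2 fun k => (key k).1, contDiffOn_infty.2 fun k => (key k).2⟩

end

end CouetteWave

namespace CouetteWave

/-! ### The logarithmic kernel in Fourier modes -/

/-- The kernel of the Biot–Savart law on the cylinder. -/
noncomputable def logKer (X Y : ℝ) : ℝ := Real.log (Real.cosh Y - Real.cos X)

theorem logKer_neg (X Y : ℝ) : logKer (-X) Y = logKer X Y := by simp [logKer]

theorem measurable_logKer : Measurable fun p : ℝ × ℝ => logKer p.1 p.2 := by
  unfold logKer
  exact Real.measurable_log.comp (by fun_prop : Continuous fun p : ℝ × ℝ =>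
    Real.cosh p.2 - Real.cos p.1).measurable

theorem hasSum_logKer (X : ℝ) {Y : ℝ} (hY : Y ≠ 0) :
    HasSum (fun n : ℕ => -(2 / n * Real.exp (-(n * |Y|)) * Real.cos (n * X)))
      (logKer X Y - (|Y| - Real.log 2)) := by
  set r := Real.exp (-|Y|) with hr
  have hr0 : 0 < r := Real.exp_pos _
  have hr1 : r < 1 := Real.exp_lt_one_iff.2 (by linarith [abs_pos.2 hY])
  set w : ℂ := r * Complex.exp (X * Complex.I) with hw
  have hwn : ‖w‖ < 1 := by
    rw [hw, norm_mul, Complex.norm_exp_ofReal_mul_I, mul_one, Complex.norm_real,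
      Real.norm_of_nonneg hr0.le]
    exact hr1
  have h := (Complex.hasSum_re (Complex.hasSum_taylorSeries_neg_log hwn)).mul_left (-2)
  have e1 : ∀ n : ℕ, -(2 / n * Real.exp (-(n * |Y|)) * Real.cos (n * X)) =
      -2 * (w ^ n / (n : ℂ)).re := by
    intro n
    have h1 : w ^ n / (n : ℂ) = ((r ^ n / n : ℝ) : ℂ) * Complex.exp ((n * X : ℝ) * Complex.I) := by
      rw [hw, mul_pow, ← Complex.exp_nat_mul]
      push_cast
      rw [mul_div_right_comm]; ring_nf
    rw [h1, Complex.re_ofReal_mul, Complex.exp_ofReal_mul_I_re, hr, ← Real.exp_nat_mul]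
    ring_nf
  have e2 : logKer X Y - (|Y| - Real.log 2) = -2 * (-Complex.log (1 - w)).re := by
    rw [Complex.neg_re, Complex.log_re]
    have hcosh : Real.cosh Y = (r⁻¹ + r) / 2 := by
      rw [← Real.cosh_abs, Real.cosh_eq, hr, ← Real.exp_neg, neg_neg]
    have hsq : ‖1 - w‖ ^ 2 = 1 - 2 * r * Real.cos X + r ^ 2 := by
      rw [Complex.sq_norm, Complex.normSq_apply, hw]
      simp only [Complex.sub_re, Complex.one_re, Complex.re_ofReal_mul, Complex.sub_im,
        Complex.one_im, Complex.im_ofReal_mul, Complex.exp_ofReal_mul_I_re,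
        Complex.exp_ofReal_mul_I_im]
      nlinarith [Real.sin_sq_add_cos_sq X]
    have hpos : 0 < ‖1 - w‖ := by
      rw [norm_pos_iff, sub_ne_zero]
      intro h1; rw [← h1] at hwn; simp at hwn
    have hker : Real.cosh Y - Real.cos X = r⁻¹ / 2 * ‖1 - w‖ ^ 2 := by
      rw [hsq, hcosh]; field_simp; ring
    unfold logKer
    rw [hker, Real.log_mul (by positivity) (by positivity), Real.log_div (by positivity) (by simp),
      Real.log_inv, hr, Real.log_exp, Real.log_pow]
    push_cast; ring
  rw [funext e1, e2]
  exact h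

theorem integral_sin_int_mul_add {j : ℤ} (hj : j ≠ 0) (c : ℝ) :
    ∫ t in (-Real.pi)..Real.pi, Real.sin (j * t + c) = 0 := by
  have hj' : (j : ℝ) ≠ 0 := by exact_mod_cast hj
  rw [intervalIntegral.integral_comp_mul_add _ hj', integral_sin]
  have : (j : ℝ) * Real.pi + c = j * -Real.pi + c + j * (2 * Real.pi) := by ring
  rw [this, Real.cos_add_int_mul_two_pi]; simp

theorem integral_cos_int_mul_add {j : ℤ} (hj : j ≠ 0) (c : ℝ) :
    ∫ t in (-Real.pi)..Real.pi, Real.cos (j * t + c) = 0 := by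
  have hj' : (j : ℝ) ≠ 0 := by exact_mod_cast hj
  rw [intervalIntegral.integral_comp_mul_add _ hj', integral_cos]
  have : (j : ℝ) * Real.pi + c = j * -Real.pi + c + j * (2 * Real.pi) := by ring
  rw [this, Real.sin_add_int_mul_two_pi]; simp

theorem integral_cos_mul_sin {n k : ℕ} (hn : 1 ≤ n) (x : ℝ) :
    ∫ t in (-Real.pi)..Real.pi, Real.cos (n * (x - t)) * Real.sin (k * t) =
      if n = k then Real.pi * Real.sin (n * x) else 0 := by
  have e : ∀ t : ℝ, Real.cos (n * (x - t)) * Real.sin (k * t) =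
      1 / 2 * (Real.sin (((k - n : ℤ) : ℝ) * t + n * x) +
        Real.sin (((k + n : ℤ) : ℝ) * t + -(n * x))) := by
    intro t
    push_cast
    rw [show ((k : ℝ) - n) * t + n * x = k * t + n * (x - t) by ring,
      show ((k : ℝ) + n) * t + -(n * x) = k * t - n * (x - t) by ring, Real.sin_add, Real.sin_sub]
    ring
  simp only [e]
  rw [intervalIntegral.integral_const_mul, intervalIntegral.integral_add
    ((by fun_prop : Continuous _).intervalIntegrable _ _)
    ((by fun_prop : Continuous _).intervalIntegrable _ _),
    integral_sin_int_mul_add (by omega : ((k : ℤ) + n) ≠ 0)]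
  split_ifs with h
  · subst h; simp; ring
  · rw [integral_sin_int_mul_add (by omega)]; simp

theorem hasSum_integral_logKer (x : ℝ) {Y : ℝ} (hY : Y ≠ 0) {g : ℝ → ℝ} (hg : Continuous g)
    (hg1 : ∀ t, |g t| ≤ 1) :
    HasSum (fun n : ℕ => -(2 / n * Real.exp (-(n * |Y|))) *
        ∫ t in (-Real.pi)..Real.pi, Real.cos (n * (x - t)) * g t)
      (∫ t in (-Real.pi)..Real.pi, (logKer (x - t) Y - (|Y| - Real.log 2)) * g t) := by
  have hr1 : Real.exp (-|Y|) < 1 := Real.exp_lt_one_iff.2 (by linarith [abs_pos.2 hY])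
  have h := intervalIntegral.hasSum_integral_of_dominated_convergence (μ := volume)
    (a := -Real.pi) (b := Real.pi)
    (F := fun (n : ℕ) t => -(2 / n * Real.exp (-(n * |Y|)) * Real.cos (n * (x - t))) * g t)
    (f := fun t => (logKer (x - t) Y - (|Y| - Real.log 2)) * g t)
    (fun n _ => 2 * Real.exp (-|Y|) ^ n) ?_ ?_ ?_ ?_ ?_
  · have e : (fun n : ℕ => -(2 / n * Real.exp (-(n * |Y|))) *
        ∫ t in (-Real.pi)..Real.pi, Real.cos (n * (x - t)) * g t) = fun n : ℕ =>
        ∫ t in (-Real.pi)..Real.pi,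
          -(2 / n * Real.exp (-(n * |Y|)) * Real.cos (n * (x - t))) * g t := by
      funext n
      rw [← intervalIntegral.integral_const_mul]
      refine intervalIntegral.integral_congr fun t _ => ?_
      ring
    rw [e]; exact h
  · intro n; exact (by fun_prop : Continuous _).aestronglyMeasurable
  · intro n
    refine Filter.Eventually.of_forall fun t _ => ?_
    rw [← Real.exp_nat_mul, norm_mul, norm_neg, norm_mul, norm_mul, norm_div]
    simp only [Real.norm_eq_abs, Real.abs_exp, mul_neg]
    have h2 : |(2 : ℝ)| / |(n : ℝ)| ≤ 2 := by
      rcases Nat.eq_zero_or_pos n with h0 | h0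
      · simp [h0]
      · have : (1 : ℝ) ≤ n := by exact_mod_cast h0
        rw [abs_of_nonneg (by positivity), abs_of_nonneg (by positivity)]
        exact div_le_self (by norm_num) this
    calc _ ≤ 2 * Real.exp (-(n * |Y|)) * 1 * 1 := by
          gcongr
          · exact Real.abs_cos_le_one _
          · exact hg1 t
      _ = _ := by ring
  · refine Filter.Eventually.of_forall fun t _ => ?_
    exact (summable_geometric_of_lt_one (Real.exp_pos _).le hr1).mul_left 2
  · exact intervalIntegrable_const
  · refine Filter.Eventually.of_forall fun t _ => ?_
    exact (hasSum_logKer (x - t) hY).mul_right (g t)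

theorem continuous_logKer {Y : ℝ} (hY : Y ≠ 0) : Continuous fun X => logKer X Y := by
  unfold logKer
  refine Continuous.log (by fun_prop) fun X => ?_
  have := Real.one_lt_cosh.2 hY
  have := Real.cos_le_one X
  intro h; linarith

theorem integral_logKer (x : ℝ) {Y : ℝ} (hY : Y ≠ 0) :
    ∫ t in (-Real.pi)..Real.pi, logKer (x - t) Y = 2 * Real.pi * (|Y| - Real.log 2) := by
  have h := hasSum_integral_logKer x hY (g := fun _ => 1) continuous_const (by simp)
  have h0 : ∀ n : ℕ, -(2 / n * Real.exp (-(n * |Y|))) *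
      ∫ t in (-Real.pi)..Real.pi, Real.cos (n * (x - t)) * 1 = 0 := by
    intro n
    rcases Nat.eq_zero_or_pos n with h0 | h0
    · simp [h0]
    · have := integral_cos_int_mul_add (j := -n) (by omega) (n * x)
      push_cast at this
      have e : ∀ t : ℝ, Real.cos (n * (x - t)) * 1 = Real.cos (-n * t + n * x) := by
        intro t; rw [mul_one]; congr 1; ring
      simp only [e, this, mul_zero]
  simp only [h0] at h
  have h1 := h.unique hasSum_zero
  have hc := continuous_logKer hY
  simp only [mul_one] at h1
  rw [intervalIntegral.integral_sub ((by fun_prop : Continuous _).intervalIntegrable _ _)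
    intervalIntegrable_const, intervalIntegral.integral_const, sub_eq_zero] at h1
  rw [h1, smul_eq_mul]; ring

theorem integral_logKer_mul_sin (x : ℝ) {Y : ℝ} (hY : Y ≠ 0) {k : ℕ} (hk : 1 ≤ k) :
    ∫ t in (-Real.pi)..Real.pi, logKer (x - t) Y * Real.sin (k * t) =
      -(2 * Real.pi / k) * Real.exp (-(k * |Y|)) * Real.sin (k * x) := by
  have h := hasSum_integral_logKer x hY (g := fun t => Real.sin (k * t)) (by fun_prop)
    (fun t => Real.abs_sin_le_one _)
  have h0 : ∀ n : ℕ, n ≠ k → -(2 / n * Real.exp (-(n * |Y|))) *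
      ∫ t in (-Real.pi)..Real.pi, Real.cos (n * (x - t)) * Real.sin (k * t) = 0 := by
    intro n hn
    rcases Nat.eq_zero_or_pos n with h0 | h0
    · simp [h0]
    · rw [integral_cos_mul_sin h0, if_neg hn, mul_zero]
  have h1 := h.unique (hasSum_single k h0)
  rw [integral_cos_mul_sin hk, if_pos rfl] at h1
  have hc := continuous_logKer hY
  have h2 := integral_sin_int_mul_add (j := k) (by omega) 0
  simp only [add_zero, Int.cast_natCast] at h2
  simp only [sub_mul] at h1
  rw [intervalIntegral.integral_sub ((by fun_prop : Continuous _).intervalIntegrable _ _)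
    ((by fun_prop : Continuous _).intervalIntegrable _ _)] at h1
  simp only [← sub_mul] at h1
  rw [intervalIntegral.integral_const_mul, h2, mul_zero, sub_zero] at h1
  rw [h1]; ring

theorem integral_logKer_mul_sin' (x : ℝ) {Y : ℝ} (hY : Y ≠ 0) {k : ℕ} (hk : 1 ≤ k) :
    ∫ t in (-Real.pi)..Real.pi, logKer (t - x) Y * Real.sin (k * t) =
      -(2 * Real.pi / k) * Real.exp (-(k * |Y|)) * Real.sin (k * x) := by
  rw [← integral_logKer_mul_sin x hY hk]
  congr 1; ext t; rw [← logKer_neg, neg_sub]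

/-! ### Integrability of the logarithmic kernel -/

/-- A majorant of the logarithmic kernel for bounded `Y`. -/
noncomputable def logBound (X : ℝ) : ℝ := 10 + |Real.log (1 - Real.cos X)|

theorem abs_logKer_le {X Y : ℝ} (hX : Real.cos X ≠ 1) (hY : |Y| ≤ 4) :
    |logKer X Y| ≤ logBound X := by
  have h1 : 0 < 1 - Real.cos X := by
    have := lt_of_le_of_ne (Real.cos_le_one X) hX; linarith
  have h2 := Real.one_le_cosh Y
  have h3 : Real.log (1 - Real.cos X) ≤ logKer X Y := Real.log_le_log h1 (by linarith)
  have h4 : logKer X Y ≤ 10 := by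
    unfold logKer
    rw [Real.log_le_iff_le_exp (by linarith)]
    have h5 : Real.cosh Y ≤ Real.exp 4 := by
      rw [← Real.cosh_abs, Real.cosh_eq]
      have e1 : Real.exp |Y| ≤ Real.exp 4 := Real.exp_le_exp.2 hY
      have e2 : Real.exp (-|Y|) ≤ Real.exp 4 := Real.exp_le_exp.2 (by linarith [abs_nonneg Y])
      linarith
    have h6 := Real.neg_one_le_cos X
    have h7 : Real.exp 10 = Real.exp 4 * Real.exp 6 := by rw [← Real.exp_add]; norm_num
    have h8 := Real.add_one_le_exp (6 : ℝ)
    have h9 := Real.add_one_le_exp (4 : ℝ)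
    nlinarith
  unfold logBound
  rw [abs_le]
  constructor
  · linarith [neg_abs_le (Real.log (1 - Real.cos X))]
  · linarith [abs_nonneg (Real.log (1 - Real.cos X))]

theorem intervalIntegrable_logBound (a b : ℝ) : IntervalIntegrable logBound volume a b := by
  refine intervalIntegrable_const.add (IntervalIntegrable.abs ?_)
  refine MeromorphicOn.intervalIntegrable_log ?_
  intro x _
  exact AnalyticAt.meromorphicAt (by fun_prop)

theorem logBound_periodic : Function.Periodic logBound (2 * Real.pi) := by
  intro X; simp [logBound]

theorem integral_logBound_sub (s : ℝ) :
    ∫ x in (-Real.pi)..Real.pi, logBound (x - s) = ∫ x in (-Real.pi)..Real.pi, logBound x := by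
  rw [intervalIntegral.integral_comp_sub_right]
  have h := logBound_periodic.intervalIntegral_add_eq (-Real.pi - s) (-Real.pi)
  rw [show -Real.pi - s + 2 * Real.pi = Real.pi - s by ring,
    show -Real.pi + 2 * Real.pi = Real.pi by ring] at h
  exact h

theorem intervalIntegrable_logBound_sub (s : ℝ) :
    IntervalIntegrable (fun x => logBound (x - s)) volume (-Real.pi) Real.pi := by
  simpa using (intervalIntegrable_logBound (-Real.pi - s) (Real.pi - s)).comp_sub_right s

theorem ae_cos_sub_ne_one (s : ℝ) : ∀ᵐ x : ℝ, Real.cos (x - s) ≠ 1 := by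
  have : {x : ℝ | ¬ Real.cos (x - s) ≠ 1} ⊆ range fun k : ℤ => s + k * (2 * Real.pi) := by
    intro x hx
    simp only [mem_ofPred_eq, not_not] at hx
    obtain ⟨k, hk⟩ := (Real.cos_eq_one_iff _).1 hx
    exact ⟨k, by simp only [hk]; ring⟩
  exact measure_mono_null this ((countable_range _).measure_zero _)

end CouetteWave

namespace CouetteWave

/-! ### The nonlocal operator in Fourier modes -/

/-- Lebesgue measure on the fundamental domain of the torus. -/
noncomputable def torusMeasure : Measure ℝ := volume.restrict (Icc (-Real.pi) Real.pi)

/-- Lebesgue measure on the bands. -/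
noncomputable def bandMeasure (ε : ℝ) : Measure ℝ := volume.restrict (bands ε)

instance : IsFiniteMeasure torusMeasure := by
  unfold torusMeasure; infer_instance

theorem isCompact_bands (ε : ℝ) : IsCompact (bands ε) := isCompact_Icc.union isCompact_Icc

theorem measurableSet_bands (ε : ℝ) : MeasurableSet (bands ε) := (isCompact_bands ε).measurableSet

instance (ε : ℝ) : IsFiniteMeasure (bandMeasure ε) :=
  ⟨by rw [bandMeasure, Measure.restrict_apply_univ]; exact (isCompact_bands ε).measure_lt_top⟩

theorem domainMeasure_eq (ε : ℝ) : domainMeasure ε = torusMeasure.prod (bandMeasure ε) := by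
  rw [torusMeasure, bandMeasure, Measure.prod_restrict, domainMeasure, Measure.volume_eq_prod]

instance (ε : ℝ) : IsFiniteMeasure (domainMeasure ε) := by
  rw [domainMeasure_eq]; infer_instance

theorem integral_torusMeasure (f : ℝ → ℝ) :
    ∫ x, f x ∂torusMeasure = ∫ x in (-Real.pi)..Real.pi, f x := by
  rw [torusMeasure, integral_Icc_eq_integral_Ioc,
    ← intervalIntegral.integral_of_le (by linarith [Real.pi_pos])]

theorem integrable_torusMeasure_iff {f : ℝ → ℝ} :
    Integrable f torusMeasure ↔ IntervalIntegrable f volume (-Real.pi) Real.pi := by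
  rw [torusMeasure, intervalIntegrable_iff_integrableOn_Icc_of_le (by linarith [Real.pi_pos])]
  rfl

theorem ae_torusMeasure {P : ℝ → Prop} (h : ∀ᵐ x : ℝ, P x) : ∀ᵐ x ∂torusMeasure, P x :=
  ae_restrict_of_ae h

theorem ae_bandMeasure_mem (ε : ℝ) : ∀ᵐ y ∂bandMeasure ε, y ∈ bands ε :=
  ae_restrict_mem (measurableSet_bands ε)

theorem ae_bandMeasure_ne (ε y : ℝ) : ∀ᵐ y' ∂bandMeasure ε, y - y' ≠ 0 := by
  have : ∀ᵐ y' : ℝ, y' ≠ y := by simp [ae_iff]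
  filter_upwards [ae_restrict_of_ae this] with y' h h0
  exact h (by linarith)

theorem ae_domain_fst {ε : ℝ} {P : ℝ → Prop} (h : ∀ᵐ x ∂torusMeasure, P x) :
    ∀ᵐ p ∂domainMeasure ε, P p.1 := by
  rw [domainMeasure_eq]; exact Measure.quasiMeasurePreserving_fst.ae h

theorem ae_domain_snd {ε : ℝ} {P : ℝ → Prop} (h : ∀ᵐ y ∂bandMeasure ε, P y) :
    ∀ᵐ p ∂domainMeasure ε, P p.2 := by
  rw [domainMeasure_eq]; exact Measure.quasiMeasurePreserving_snd.ae h

theorem ae_ae_of_ae_domain {ε : ℝ} {P : ℝ × ℝ → Prop} (h : ∀ᵐ p ∂domainMeasure ε, P p) :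
    ∀ᵐ y ∂bandMeasure ε, ∀ᵐ x ∂torusMeasure, P (x, y) := by
  rw [domainMeasure_eq, ← Measure.prod_swap] at h
  exact Measure.ae_ae_of_ae_prod (ae_of_ae_map measurable_swap.aemeasurable h)

theorem abs_sub_le_four {ε : ℝ} (hε1 : ε < 1) {y y' : ℝ} (hy : y ∈ bands ε) (hy' : y' ∈ bands ε) :
    |y - y'| ≤ 4 := by
  rw [abs_le]
  rcases hy with hy | hy <;> rcases hy' with hy' | hy' <;>
    constructor <;> linarith [hy.1, hy.2, hy'.1, hy'.2]

theorem integrable_logBound_sub (s : ℝ) : Integrable (fun x => logBound (x - s)) torusMeasure :=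
  integrable_torusMeasure_iff.2 (intervalIntegrable_logBound_sub s)

theorem logBound_nonneg (x : ℝ) : 0 ≤ logBound x := by unfold logBound; positivity

theorem ae_abs_logKer_le {ε : ℝ} (hε1 : ε < 1) {y y' : ℝ} (hy : y ∈ bands ε) (hy' : y' ∈ bands ε)
    (s : ℝ) : ∀ᵐ x ∂torusMeasure, |logKer (x - s) (y - y')| ≤ logBound (x - s) := by
  filter_upwards [ae_torusMeasure (ae_cos_sub_ne_one s)] with x hx
  exact abs_logKer_le hx (abs_sub_le_four hε1 hy hy')

section
variable {ε : ℝ} (hε1 : ε < 1) {σ : ℝ → ℝ} (hσ : Measurable σ) {S : ℝ}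
  (hS : ∀ y ∈ bands ε, |σ y| ≤ S)
include hε1 hσ hS

theorem integrable_kernel_prod {w : ℝ × ℝ → ℝ} (hw : Integrable w (domainMeasure ε)) {y : ℝ}
    (hy : y ∈ bands ε) :
    Integrable (fun p : ℝ × ℝ × ℝ => σ p.2.2 * logKer (p.1 - p.2.1) (y - p.2.2) * w p.2)
      (torusMeasure.prod (domainMeasure ε)) := by
  have hm : Measurable fun p : ℝ × ℝ × ℝ => σ p.2.2 * logKer (p.1 - p.2.1) (y - p.2.2) :=
    (hσ.comp (measurable_snd.comp measurable_snd)).mul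
      (measurable_logKer.comp (f := fun p : ℝ × ℝ × ℝ => (p.1 - p.2.1, y - p.2.2)) (by fun_prop))
  have hm' : AEStronglyMeasurable
      (fun p : ℝ × ℝ × ℝ => σ p.2.2 * logKer (p.1 - p.2.1) (y - p.2.2) * w p.2)
      (torusMeasure.prod (domainMeasure ε)) :=
    hm.aestronglyMeasurable.mul
      (hw.aestronglyMeasurable.comp_quasiMeasurePreserving Measure.quasiMeasurePreserving_snd)
  have hb : ∀ q : ℝ × ℝ, q.2 ∈ bands ε → ∀ᵐ x ∂torusMeasure,
      ‖σ q.2 * logKer (x - q.1) (y - q.2) * w q‖ ≤ logBound (x - q.1) * (S * ‖w q‖) := by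
    intro q hq
    filter_upwards [ae_abs_logKer_le hε1 hy hq q.1] with x hx
    rw [norm_mul, norm_mul, Real.norm_eq_abs, Real.norm_eq_abs]
    calc _ ≤ S * logBound (x - q.1) * ‖w q‖ := by
          gcongr
          · exact (abs_nonneg _).trans (hS _ hq)
          · exact hS _ hq
      _ = _ := by ring
  have hmem : ∀ᵐ q ∂domainMeasure ε, q.2 ∈ bands ε := ae_domain_snd (ae_bandMeasure_mem ε)
  have hmeas : ∀ q : ℝ × ℝ, AEStronglyMeasurable
      (fun x => σ q.2 * logKer (x - q.1) (y - q.2) * w q) torusMeasure := by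
    intro q
    have : Measurable fun x => logKer (x - q.1) (y - q.2) :=
      measurable_logKer.comp (f := fun x => (x - q.1, y - q.2)) (by fun_prop)
    exact ((this.const_mul _).mul_const _).aestronglyMeasurable
  rw [integrable_prod_iff' hm']
  constructor
  · filter_upwards [hmem] with q hq
    exact ((integrable_logBound_sub q.1).mul_const _).mono' (hmeas q) (hb q hq)
  · refine ((hw.norm.const_mul S).const_mul
      (∫ x in (-Real.pi)..Real.pi, logBound x)).mono' hm'.norm.prod_swap.integral_prod_right' ?_
    filter_upwards [hmem] with q hq
    rw [Real.norm_of_nonneg (integral_nonneg fun _ => norm_nonneg _)]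
    refine (integral_mono_of_nonneg (Filter.Eventually.of_forall fun _ => norm_nonneg _)
      ((integrable_logBound_sub q.1).mul_const _) (hb q hq)).trans ?_
    rw [integral_mul_const, integral_torusMeasure, integral_logBound_sub]

theorem integrable_kernel_product {f H : ℝ → ℝ} (hf : Continuous f) (hf1 : ∀ x, |f x| ≤ 1)
    (hH : Integrable H (bandMeasure ε)) {y : ℝ} (hy : y ∈ bands ε) (x : ℝ) :
    Integrable (fun q : ℝ × ℝ => σ q.2 * logKer (x - q.1) (y - q.2) * (f q.1 * H q.2))
      (domainMeasure ε) := by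
  have hB : Integrable (fun q : ℝ × ℝ => logBound (q.1 - x) * (S * ‖H q.2‖)) (domainMeasure ε) := by
    rw [domainMeasure_eq]
    exact (integrable_logBound_sub x).mul_prod (hH.norm.const_mul S)
  refine hB.mono' ?_ ?_
  · have hm : Measurable fun q : ℝ × ℝ => σ q.2 * logKer (x - q.1) (y - q.2) :=
      (hσ.comp measurable_snd).mul
        (measurable_logKer.comp (f := fun q : ℝ × ℝ => (x - q.1, y - q.2)) (by fun_prop))
    refine hm.aestronglyMeasurable.mul (AEStronglyMeasurable.mul ?_ ?_)
    · exact (hf.comp continuous_fst).aestronglyMeasurable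
    · rw [domainMeasure_eq]
      exact hH.aestronglyMeasurable.comp_quasiMeasurePreserving Measure.quasiMeasurePreserving_snd
  · filter_upwards [ae_domain_snd (ae_bandMeasure_mem ε),
      ae_domain_fst (ae_torusMeasure (ae_cos_sub_ne_one x))] with q hq hc
    have h1 : |logKer (x - q.1) (y - q.2)| ≤ logBound (q.1 - x) := by
      rw [← logKer_neg, neg_sub]
      exact abs_logKer_le hc (abs_sub_le_four hε1 hy hq)
    simp only [norm_mul, Real.norm_eq_abs]
    have hS0 : 0 ≤ S := (abs_nonneg _).trans (hS _ hq)
    have hl := logBound_nonneg (q.1 - x)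
    calc _ ≤ S * logBound (q.1 - x) * (1 * |H q.2|) := by
          gcongr
          · exact hS _ hq
          · exact hf1 _
      _ = _ := by ring

theorem integral_kernel_const {y : ℝ} (hy : y ∈ bands ε) (x : ℝ) :
    ∫ q, σ q.2 * logKer (x - q.1) (y - q.2) ∂domainMeasure ε =
      2 * Real.pi * ∫ y', σ y' * (|y - y'| - Real.log 2) ∂bandMeasure ε := by
  have h := integrable_kernel_product hε1 hσ hS (f := fun _ => 1) (H := fun _ => 1)
    continuous_const (by simp) (integrable_const _) hy x
  simp only [mul_one] at h
  rw [domainMeasure_eq] at h ⊢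
  rw [integral_prod_symm _ h, ← integral_const_mul]
  refine integral_congr_ae ?_
  filter_upwards [ae_bandMeasure_ne ε y] with y' hy'
  rw [integral_const_mul, integral_torusMeasure, integral_logKer x hy']
  ring

theorem integral_kernel_sin {H : ℝ → ℝ} (hH : Integrable H (bandMeasure ε)) {y : ℝ}
    (hy : y ∈ bands ε) (x : ℝ) {n : ℕ} (hn : 1 ≤ n) :
    ∫ q, σ q.2 * logKer (x - q.1) (y - q.2) * (Real.sin (n * q.1) * H q.2) ∂domainMeasure ε =
      -(2 * Real.pi / n) * Real.sin (n * x) *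
        ∫ y', σ y' * Real.exp (-(n * |y - y'|)) * H y' ∂bandMeasure ε := by
  have h := integrable_kernel_product hε1 hσ hS (f := fun x => Real.sin (n * x))
    (by fun_prop) (fun _ => Real.abs_sin_le_one _) hH hy x
  rw [domainMeasure_eq] at h ⊢
  rw [integral_prod_symm _ h, ← integral_const_mul]
  refine integral_congr_ae ?_
  filter_upwards [ae_bandMeasure_ne ε y] with y' hy'
  have e : ∀ t : ℝ, σ y' * logKer (x - t) (y - y') * (Real.sin (n * t) * H y') =
      σ y' * H y' * (logKer (x - t) (y - y') * Real.sin (n * t)) := fun t => by ring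
  simp only [e]
  rw [integral_const_mul, integral_torusMeasure, integral_logKer_mul_sin x hy' hn]
  ring

omit hε1 in
theorem integrable_exp_kernel {w : ℝ × ℝ → ℝ} (hw : Integrable w (domainMeasure ε)) (y : ℝ)
    (n : ℕ) : Integrable (fun q : ℝ × ℝ => σ q.2 * Real.exp (-(n * |y - q.2|)) *
      (Real.sin (n * q.1) * w q)) (domainMeasure ε) := by
  have h : ∀ q : ℝ × ℝ, σ q.2 * Real.exp (-(n * |y - q.2|)) * (Real.sin (n * q.1) * w q) =
      (σ q.2 * Real.exp (-(n * |y - q.2|)) * Real.sin (n * q.1)) * w q := fun q => by ring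
  simp only [h]
  refine hw.bdd_mul (c := S) ?_ ?_
  · have h1 : Measurable fun q : ℝ × ℝ => σ q.2 := hσ.comp measurable_snd
    exact ((h1.mul (by fun_prop)).mul (by fun_prop)).aestronglyMeasurable
  · filter_upwards [ae_domain_snd (ae_bandMeasure_mem ε)] with q hq
    have h0 : 0 ≤ S := (abs_nonneg _).trans (hS _ hq)
    have h2 : 0 ≤ (n : ℝ) * |y - q.2| := by positivity
    rw [norm_mul, norm_mul, Real.norm_eq_abs, Real.norm_eq_abs, Real.norm_eq_abs, Real.abs_exp]
    calc _ ≤ S * 1 * 1 := by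
          gcongr
          · exact hS _ hq
          · exact Real.exp_le_one_iff.2 (by linarith)
          · exact Real.abs_sin_le_one _
      _ = S := by ring

theorem integral_sin_mul_kernel {w : ℝ × ℝ → ℝ} (hw : Integrable w (domainMeasure ε)) {y : ℝ}
    (hy : y ∈ bands ε) {n : ℕ} (hn : 1 ≤ n) :
    ∫ x, Real.sin (n * x) *
        ∫ q, σ q.2 * logKer (x - q.1) (y - q.2) * w q ∂domainMeasure ε ∂torusMeasure =
      -(2 * Real.pi / n) * ∫ y', σ y' * Real.exp (-(n * |y - y'|)) *
        (∫ x, Real.sin (n * x) * w (x, y') ∂torusMeasure) ∂bandMeasure ε := by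
  have h := integrable_kernel_prod hε1 hσ hS hw hy
  have h2 : Integrable (fun p : ℝ × ℝ × ℝ => Real.sin (n * p.1) *
      (σ p.2.2 * logKer (p.1 - p.2.1) (y - p.2.2) * w p.2))
      (torusMeasure.prod (domainMeasure ε)) := by
    refine h.bdd_mul (c := 1) (by fun_prop) (Filter.Eventually.of_forall fun p => ?_)
    exact Real.abs_sin_le_one _
  calc _ = ∫ x, ∫ q, Real.sin (n * x) * (σ q.2 * logKer (x - q.1) (y - q.2) * w q)
        ∂domainMeasure ε ∂torusMeasure := by simp only [integral_const_mul]
    _ = ∫ q, ∫ x, Real.sin (n * x) * (σ q.2 * logKer (x - q.1) (y - q.2) * w q)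
        ∂torusMeasure ∂domainMeasure ε := integral_integral_swap h2
    _ = ∫ q, -(2 * Real.pi / n) * (σ q.2 * Real.exp (-(n * |y - q.2|)) *
        (Real.sin (n * q.1) * w q)) ∂domainMeasure ε := by
        refine integral_congr_ae ?_
        filter_upwards [ae_domain_snd (ae_bandMeasure_ne ε y)] with q hq
        have e : ∀ x : ℝ, Real.sin (n * x) * (σ q.2 * logKer (x - q.1) (y - q.2) * w q) =
          σ q.2 * w q * (logKer (x - q.1) (y - q.2) * Real.sin (n * x)) := fun x => by ring
        simp only [e]
        rw [integral_const_mul, integral_torusMeasure, integral_logKer_mul_sin' q.1 hq hn]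
        ring
    _ = _ := by
        have h3 := integrable_exp_kernel hσ hS hw y n
        rw [integral_const_mul]
        rw [domainMeasure_eq] at h3 ⊢
        rw [integral_prod_symm _ h3]
        simp only [integral_const_mul]

end

/-- The coefficient of the local part of the operator. -/
noncomputable def localCoeff (σ : ℝ → ℝ) (ε lam y : ℝ) : ℝ :=
  lam + y - 1 / 2 * ∫ y', σ y' * (|y - y'| - Real.log 2) ∂bandMeasure ε

/-- The band operator in Fourier mode `n`. -/
noncomputable def modeOp (σ : ℝ → ℝ) (ε lam : ℝ) (n : ℕ) (H : ℝ → ℝ) (y : ℝ) : ℝ :=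
  localCoeff σ ε lam y * H y -
    1 / (2 * n) * ∫ y', σ y' * Real.exp (-(n * |y - y'|)) * H y' ∂bandMeasure ε

section
variable {Θ : ℝ → ℝ} {ε κ : ℝ} (hε1 : ε < 1) {σ : ℝ → ℝ} (hσ : Measurable σ) {S : ℝ}
  (hS : ∀ y ∈ bands ε, |σ y| ≤ S) (hσe : deriv (profile Θ ε κ) =ᵐ[bandMeasure ε] σ)
include hε1 hσ hS hσe

theorem linOp_eq (lam : ℝ) {g : ℝ × ℝ → ℝ} {p : ℝ × ℝ} (hp : p.2 ∈ bands ε)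
    (hint : Integrable (fun q : ℝ × ℝ => σ q.2 * logKer (p.1 - q.1) (p.2 - q.2) * weakDx ε g q)
      (domainMeasure ε)) :
    linOp Θ ε κ lam g p = localCoeff σ ε lam p.2 * weakDx ε g p + 1 / (4 * Real.pi) *
      ∫ q, σ q.2 * logKer (p.1 - q.1) (p.2 - q.2) * weakDx ε g q ∂domainMeasure ε := by
  have h1 := integrable_kernel_product hε1 hσ hS (f := fun _ => 1) (H := fun _ => 1)
    continuous_const (by simp) (integrable_const _) hp p.1
  simp only [mul_one] at h1
  have e : ∫ q, deriv (profile Θ ε κ) q.2 *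
          Real.log (Real.cosh (p.2 - q.2) - Real.cos (p.1 - q.1)) *
          (weakDx ε g p - weakDx ε g q) ∂domainMeasure ε =
      ∫ q, (σ q.2 * logKer (p.1 - q.1) (p.2 - q.2) * weakDx ε g p -
        σ q.2 * logKer (p.1 - q.1) (p.2 - q.2) * weakDx ε g q) ∂domainMeasure ε := by
    refine integral_congr_ae ?_
    filter_upwards [ae_domain_snd hσe] with q hq
    rw [hq, ← mul_sub]; rfl
  unfold linOp
  rw [e, integral_sub (h1.mul_const _) hint, integral_mul_const,
    integral_kernel_const hε1 hσ hS hp, localCoeff]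
  have := Real.pi_ne_zero
  field_simp
  ring

theorem modeOp_eq_zero_of_linOp {lam : ℝ} {g : ℝ × ℝ → ℝ}
    (hw : Integrable (weakDx ε g) (domainMeasure ε))
    (h : linOp Θ ε κ lam g =ᵐ[domainMeasure ε] 0) {n : ℕ} (hn : 1 ≤ n) :
    ∀ᵐ y ∂bandMeasure ε, modeOp σ ε lam n
      (fun y => ∫ x, Real.sin (n * x) * weakDx ε g (x, y) ∂torusMeasure) y = 0 := by
  have hw' := hw
  rw [domainMeasure_eq] at hw'
  filter_upwards [ae_ae_of_ae_domain h, ae_bandMeasure_mem ε, hw'.prod_left_ae] with y h0 hy hwy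
  have hk := integrable_kernel_prod hε1 hσ hS hw hy
  have e : ∀ᵐ x ∂torusMeasure, Real.sin (n * x) * (localCoeff σ ε lam y * weakDx ε g (x, y)) +
      Real.sin (n * x) * (1 / (4 * Real.pi) *
        ∫ q, σ q.2 * logKer (x - q.1) (y - q.2) * weakDx ε g q ∂domainMeasure ε) = 0 := by
    filter_upwards [h0, hk.prod_right_ae] with x hx hkx
    rw [linOp_eq hε1 hσ hS hσe lam (p := (x, y)) hy hkx] at hx
    rw [← mul_add, hx]; simp
  have e1 := integral_congr_ae e
  have bs : ∀ f : ℝ → ℝ, Integrable f torusMeasure →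
      Integrable (fun x => Real.sin (n * x) * f x) torusMeasure := fun f hf =>
    hf.bdd_mul (c := 1) (by fun_prop) (Filter.Eventually.of_forall fun p => Real.abs_sin_le_one _)
  rw [integral_add (bs _ (hwy.const_mul _)) (bs _ (hk.integral_prod_left.const_mul _)),
    integral_zero] at e1
  have e2 : ∀ x : ℝ, Real.sin (n * x) * (localCoeff σ ε lam y * weakDx ε g (x, y)) =
      localCoeff σ ε lam y * (Real.sin (n * x) * weakDx ε g (x, y)) := fun x => by ring
  have e3 : ∀ x : ℝ, Real.sin (n * x) * (1 / (4 * Real.pi) *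
        ∫ q, σ q.2 * logKer (x - q.1) (y - q.2) * weakDx ε g q ∂domainMeasure ε) =
      1 / (4 * Real.pi) * (Real.sin (n * x) *
        ∫ q, σ q.2 * logKer (x - q.1) (y - q.2) * weakDx ε g q ∂domainMeasure ε) :=
    fun x => by ring
  simp only [e2, e3] at e1
  rw [integral_const_mul, integral_const_mul, integral_sin_mul_kernel hε1 hσ hS hw hy hn] at e1
  unfold modeOp
  rw [← e1]
  have := Real.pi_ne_zero
  have : (n : ℝ) ≠ 0 := by positivity
  field_simp
  ring

theorem linOp_eq_zero_of_modeOp {lam : ℝ} {g : ℝ × ℝ → ℝ} {n : ℕ} (hn : 1 ≤ n) {H : ℝ → ℝ}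
    (hH : Integrable H (bandMeasure ε))
    (hw : weakDx ε g =ᵐ[domainMeasure ε] fun p => Real.sin (n * p.1) * H p.2)
    (h : ∀ᵐ y ∂bandMeasure ε, modeOp σ ε lam n H y = 0) :
    linOp Θ ε κ lam g =ᵐ[domainMeasure ε] 0 := by
  filter_upwards [hw, ae_domain_snd h, ae_domain_snd (ae_bandMeasure_mem ε)] with p hwp h0 hp
  have hk := integrable_kernel_product hε1 hσ hS (f := fun x => Real.sin (n * x))
    (by fun_prop) (fun _ => Real.abs_sin_le_one _) hH hp p.1
  have ek : (fun q : ℝ × ℝ => σ q.2 * logKer (p.1 - q.1) (p.2 - q.2) * weakDx ε g q)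
      =ᵐ[domainMeasure ε] fun q => σ q.2 * logKer (p.1 - q.1) (p.2 - q.2) *
        (Real.sin (n * q.1) * H q.2) := by
    filter_upwards [hw] with q hq
    rw [hq]
  rw [linOp_eq hε1 hσ hS hσe lam hp (hk.congr ek.symm), integral_congr_ae ek,
    integral_kernel_sin hε1 hσ hS hH hp _ hn, hwp]
  unfold modeOp at h0
  have e : Real.sin (n * p.1) * (localCoeff σ ε lam p.2 * H p.2 - 1 / (2 * n) *
      ∫ y', σ y' * Real.exp (-(n * |p.2 - y'|)) * H y' ∂bandMeasure ε) = 0 := by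
    rw [h0, mul_zero]
  rw [Pi.zero_apply, ← e]
  have := Real.pi_ne_zero
  have : (n : ℝ) ≠ 0 := by positivity
  field_simp
  ring

end

end CouetteWave

namespace CouetteWave

/-! ### Rescaling of the bands -/

/-- Lebesgue measure on `[-1,1]`. -/
noncomputable def unitMeasure : Measure ℝ := volume.restrict (Icc (-1) 1)

theorem integral_unitMeasure (f : ℝ → ℝ) : ∫ z, f z ∂unitMeasure = ∫ z in (-1 : ℝ)..1, f z := by
  rw [unitMeasure, integral_Icc_eq_integral_Ioc, ← intervalIntegral.integral_of_le (by norm_num)]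

theorem quasiMeasurePreserving_affine (c : ℝ) {s : ℝ} (hs : s ≠ 0) :
    Measure.QuasiMeasurePreserving (fun z : ℝ => c + s * z) := by
  refine ⟨by fun_prop, ?_⟩
  have h : (fun z : ℝ => c + s * z) = (fun z => c + z) ∘ fun z => s * z := rfl
  rw [h, ← Measure.map_map (by fun_prop) (by fun_prop), Real.map_volume_mul_left hs,
    Measure.map_smul, map_add_left_eq_self]
  exact Measure.smul_absolutelyContinuous

section
variable {ε : ℝ} (hε : 0 < ε)
include hε

theorem lower_mem_bands {z : ℝ} (hz : z ∈ Icc (-1 : ℝ) 1) : -1 - ε * z ∈ bands ε :=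
  Or.inl ⟨by nlinarith [hz.2], by nlinarith [hz.1]⟩

theorem upper_mem_bands {z : ℝ} (hz : z ∈ Icc (-1 : ℝ) 1) : 1 + ε * z ∈ bands ε :=
  Or.inr ⟨by nlinarith [hz.1], by nlinarith [hz.2]⟩

theorem ae_bandMeasure_iff {P : ℝ → Prop} :
    (∀ᵐ y ∂bandMeasure ε, P y) ↔
      (∀ᵐ z ∂unitMeasure, P (-1 - ε * z)) ∧ ∀ᵐ z ∂unitMeasure, P (1 + ε * z) := by
  unfold bandMeasure unitMeasure
  rw [ae_restrict_iff' (measurableSet_bands ε), ae_restrict_iff' measurableSet_Icc,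
    ae_restrict_iff' measurableSet_Icc]
  constructor
  · intro h
    constructor
    · filter_upwards [(quasiMeasurePreserving_affine (-1) (neg_ne_zero.2 hε.ne')).ae h] with z hz hm
      rw [neg_mul, ← sub_eq_add_neg] at hz
      exact hz (lower_mem_bands hε hm)
    · filter_upwards [(quasiMeasurePreserving_affine 1 hε.ne').ae h] with z hz hm
      exact hz (upper_mem_bands hε hm)
  · rintro ⟨h1, h2⟩
    have e0 : (-ε⁻¹) ≠ 0 := neg_ne_zero.2 (inv_ne_zero hε.ne')
    filter_upwards [(quasiMeasurePreserving_affine (-ε⁻¹) e0).ae h1,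
      (quasiMeasurePreserving_affine (-ε⁻¹) (inv_ne_zero hε.ne')).ae h2] with y g1 g2 hy
    have e1 : -1 - ε * (-ε⁻¹ + -ε⁻¹ * y) = y := by field_simp; ring
    have e2 : 1 + ε * (-ε⁻¹ + ε⁻¹ * y) = y := by field_simp; ring
    rw [e1] at g1
    rw [e2] at g2
    rcases hy with hy | hy
    · refine g1 ⟨?_, ?_⟩
      · have := mul_le_mul_of_nonneg_left hy.2 (inv_pos.2 hε).le
        rw [mul_add, inv_mul_cancel₀ hε.ne'] at this; linarith
      · have := mul_le_mul_of_nonneg_left hy.1 (inv_pos.2 hε).le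
        rw [mul_sub, inv_mul_cancel₀ hε.ne'] at this; linarith
    · refine g2 ⟨?_, ?_⟩
      · have := mul_le_mul_of_nonneg_left hy.1 (inv_pos.2 hε).le
        rw [mul_sub, inv_mul_cancel₀ hε.ne'] at this; linarith
      · have := mul_le_mul_of_nonneg_left hy.2 (inv_pos.2 hε).le
        rw [mul_add, inv_mul_cancel₀ hε.ne'] at this; linarith

theorem intervalIntegrable_lower {f : ℝ → ℝ} (hf : Integrable f (bandMeasure ε)) :
    IntervalIntegrable (fun z => f (-1 - ε * z)) volume (-1) 1 := by
  have h : IntegrableOn f (Icc (-1 - ε) (-1 + ε)) :=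
    IntegrableOn.mono_set (t := bands ε) hf subset_union_left
  have h1 := (intervalIntegrable_iff_integrableOn_Icc_of_le (by linarith)).2 h
  have h2 := ((h1.comp_sub_left (-1)).comp_mul_left (c := ε)).symm
  have e1 : (-1 - (-1 - ε)) / ε = 1 := by field_simp; ring
  have e2 : (-1 - (-1 + ε)) / ε = -1 := by field_simp; ring
  rwa [e1, e2] at h2

theorem intervalIntegrable_upper {f : ℝ → ℝ} (hf : Integrable f (bandMeasure ε)) :
    IntervalIntegrable (fun z => f (1 + ε * z)) volume (-1) 1 := by
  have h : IntegrableOn f (Icc (1 - ε) (1 + ε)) :=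
    IntegrableOn.mono_set (t := bands ε) hf subset_union_right
  have h1 := (intervalIntegrable_iff_integrableOn_Icc_of_le (by linarith)).2 h
  have h2 := ((h1.comp_add_left 1).comp_mul_left (c := ε))
  have e1 : (1 - ε - 1) / ε = -1 := by field_simp; ring
  have e2 : (1 + ε - 1) / ε = 1 := by field_simp; ring
  rwa [e1, e2] at h2

theorem integral_bandMeasure (hε1 : ε < 1) {f : ℝ → ℝ} (hf : Integrable f (bandMeasure ε)) :
    ∫ y, f y ∂bandMeasure ε = ε * ((∫ z in (-1 : ℝ)..1, f (-1 - ε * z)) +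
      ∫ z in (-1 : ℝ)..1, f (1 + ε * z)) := by
  have hd : Disjoint (Icc (-1 - ε) (-1 + ε)) (Icc (1 - ε) (1 + ε)) := by
    rw [Set.disjoint_left]; intro y h1 h2; linarith [h1.2, h2.1]
  have ha : IntegrableOn f (Icc (-1 - ε) (-1 + ε)) :=
    IntegrableOn.mono_set (t := bands ε) hf subset_union_left
  have hb : IntegrableOn f (Icc (1 - ε) (1 + ε)) :=
    IntegrableOn.mono_set (t := bands ε) hf subset_union_right
  unfold bandMeasure bands
  rw [setIntegral_union hd measurableSet_Icc ha hb, integral_Icc_eq_integral_Ioc,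
    integral_Icc_eq_integral_Ioc, ← intervalIntegral.integral_of_le (by linarith),
    ← intervalIntegral.integral_of_le (by linarith),
    intervalIntegral.integral_comp_sub_mul _ hε.ne', intervalIntegral.integral_comp_add_mul _ hε.ne']
  simp only [smul_eq_mul, mul_one, mul_neg, sub_neg_eq_add]
  rw [← sub_eq_add_neg, mul_add, mul_inv_cancel_left₀ hε.ne', mul_inv_cancel_left₀ hε.ne']

theorem bandSlope_lower (a : ℝ → ℝ) (hε1 : ε < 1) {z : ℝ} (hz : z ∈ Icc (-1 : ℝ) 1) :
    bandSlope a ε (-1 - ε * z) = a z := by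
  unfold bandSlope
  rw [if_neg (by nlinarith [hz.1])]
  congr 1; field_simp; ring

theorem bandSlope_upper (a : ℝ → ℝ) (hε1 : ε < 1) {z : ℝ} (hz : z ∈ Icc (-1 : ℝ) 1) :
    bandSlope a ε (1 + ε * z) = -a z := by
  unfold bandSlope
  rw [if_pos (by nlinarith [hz.1])]
  congr 2; field_simp; ring

end

theorem measurable_bandSlope {a : ℝ → ℝ} (ha : Continuous a) (ε : ℝ) :
    Measurable (bandSlope a ε) := by
  unfold bandSlope
  exact Measurable.ite measurableSet_Ioi (by fun_prop) (by fun_prop)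

theorem exists_bandSlope_bound {a : ℝ → ℝ} (ha : Continuous a) {ε : ℝ} :
    ∃ S, ∀ y ∈ bands ε, |bandSlope a ε y| ≤ S := by
  obtain ⟨S1, h1⟩ := (isCompact_bands ε).exists_bound_of_continuousOn
    (f := fun y => a ((y - 1) / ε)) (by fun_prop)
  obtain ⟨S2, h2⟩ := (isCompact_bands ε).exists_bound_of_continuousOn
    (f := fun y => a ((-1 - y) / ε)) (by fun_prop)
  refine ⟨max S1 S2, fun y hy => ?_⟩
  unfold bandSlope
  split_ifs
  · rw [abs_neg]; exact (h1 y hy).trans (le_max_left _ _)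
  · exact (h2 y hy).trans (le_max_right _ _)

/-- Self-interaction integral of a band. -/
noncomputable def selfInt (a : ℝ → ℝ) (ε : ℝ) (n : ℕ) (f : ℝ → ℝ) (z : ℝ) : ℝ :=
  ∫ t in (-1 : ℝ)..1, Real.exp (-(n * ε * |z - t|)) * (a t * f t)

/-- Cross-interaction integral of the bands. -/
noncomputable def crossInt (a : ℝ → ℝ) (ε : ℝ) (n : ℕ) (f : ℝ → ℝ) (z : ℝ) : ℝ :=
  ∫ t in (-1 : ℝ)..1, Real.exp (-(n * (2 + ε * (z + t)))) * (a t * f t)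

section
variable {ε : ℝ} (hε : 0 < ε) (hε1 : ε < 1) {a : ℝ → ℝ} (ha : Continuous a)
include hε hε1 ha

theorem integral_bandSlope_mul {F : ℝ → ℝ} (hF : Integrable F (bandMeasure ε)) :
    ∫ y, bandSlope a ε y * F y ∂bandMeasure ε =
      ε * ((∫ t in (-1 : ℝ)..1, a t * F (-1 - ε * t)) - ∫ t in (-1 : ℝ)..1, a t * F (1 + ε * t)) := by
  obtain ⟨S, hS⟩ := exists_bandSlope_bound ha (ε := ε)
  have hi : Integrable (fun y => bandSlope a ε y * F y) (bandMeasure ε) := by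
    refine hF.bdd_mul (c := S) (measurable_bandSlope ha ε).aestronglyMeasurable ?_
    filter_upwards [ae_bandMeasure_mem ε] with y hy using hS y hy
  rw [integral_bandMeasure hε hε1 hi, sub_eq_add_neg, ← intervalIntegral.integral_neg]
  congr 2
  · refine intervalIntegral.integral_congr fun t ht => ?_
    rw [uIcc_of_le (by norm_num)] at ht
    simp only [bandSlope_lower hε a hε1 ht]
  · refine intervalIntegral.integral_congr fun t ht => ?_
    rw [uIcc_of_le (by norm_num)] at ht
    simp only [bandSlope_upper hε a hε1 ht, neg_mul]

omit hε hε1 ha in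
theorem integrable_exp_mul {H : ℝ → ℝ} (hH : Integrable H (bandMeasure ε)) (n : ℕ) (y : ℝ) :
    Integrable (fun y' => Real.exp (-(n * |y - y'|)) * H y') (bandMeasure ε) := by
  refine hH.bdd_mul (c := 1) (by fun_prop) (Filter.Eventually.of_forall fun y' => ?_)
  rw [Real.norm_eq_abs, Real.abs_exp, Real.exp_le_one_iff]
  have : 0 ≤ (n : ℝ) * |y - y'| := by positivity
  linarith

theorem integral_exp_lower {H : ℝ → ℝ} (hH : Integrable H (bandMeasure ε)) (n : ℕ) {z : ℝ}
    (hz : z ∈ Icc (-1 : ℝ) 1) :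
    ∫ y', bandSlope a ε y' * Real.exp (-(n * |-1 - ε * z - y'|)) * H y' ∂bandMeasure ε =
      ε * (selfInt a ε n (fun t => H (-1 - ε * t)) z -
        crossInt a ε n (fun t => H (1 + ε * t)) z) := by
  simp only [mul_assoc (bandSlope a ε _)]
  rw [integral_bandSlope_mul hε hε1 ha (integrable_exp_mul hH n _)]
  unfold selfInt crossInt
  congr 2
  · refine intervalIntegral.integral_congr fun t ht => ?_
    have e : |-1 - ε * z - (-1 - ε * t)| = ε * |z - t| := by
      rw [show -1 - ε * z - (-1 - ε * t) = -(ε * (z - t)) by ring, abs_neg, abs_mul, abs_of_pos hε]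
    simp only [e]
    ring_nf
  · refine intervalIntegral.integral_congr fun t ht => ?_
    rw [uIcc_of_le (by norm_num)] at ht
    have e : |-1 - ε * z - (1 + ε * t)| = 2 + ε * (z + t) := by
      rw [abs_of_nonpos (by nlinarith [hz.1, ht.1])]; ring
    simp only [e]
    ring

theorem integral_exp_upper {H : ℝ → ℝ} (hH : Integrable H (bandMeasure ε)) (n : ℕ) {z : ℝ}
    (hz : z ∈ Icc (-1 : ℝ) 1) :
    ∫ y', bandSlope a ε y' * Real.exp (-(n * |1 + ε * z - y'|)) * H y' ∂bandMeasure ε =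
      ε * (crossInt a ε n (fun t => H (-1 - ε * t)) z -
        selfInt a ε n (fun t => H (1 + ε * t)) z) := by
  simp only [mul_assoc (bandSlope a ε _)]
  rw [integral_bandSlope_mul hε hε1 ha (integrable_exp_mul hH n _)]
  unfold selfInt crossInt
  congr 2
  · refine intervalIntegral.integral_congr fun t ht => ?_
    rw [uIcc_of_le (by norm_num)] at ht
    have e : |1 + ε * z - (-1 - ε * t)| = 2 + ε * (z + t) := by
      rw [abs_of_nonneg (by nlinarith [hz.1, ht.1])]; ring
    simp only [e]
    ring
  · refine intervalIntegral.integral_congr fun t ht => ?_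
    have e : |1 + ε * z - (1 + ε * t)| = ε * |z - t| := by
      rw [show 1 + ε * z - (1 + ε * t) = ε * (z - t) by ring, abs_mul, abs_of_pos hε]
    simp only [e]
    ring_nf

variable (ha0 : ∀ z, 0 ≤ a z) (ha1 : ∫ z in (-1 : ℝ)..1, a z = 1)
  [IsProbabilityMeasure (segMeasure a)]
include ha0 ha1

omit hε hε1 in
theorem integral_abs_sub_eq (z : Seg) (c : ℝ) :
    (∫ t in (-1 : ℝ)..1, a t * (ε * |(z : ℝ) - t| - c)) -
      ∫ t in (-1 : ℝ)..1, a t * (2 + ε * (z + t) - c) =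
      -2 - 2 * ε * minMean (segMeasure a) z := by
  have h : minMean (segMeasure a) z = ∫ t in (-1 : ℝ)..1, a t * min (z : ℝ) t :=
    integral_segMeasure ha ha0 (fun t => min (z : ℝ) t)
  rw [h, ← intervalIntegral.integral_sub ((by fun_prop : Continuous _).intervalIntegrable _ _)
    ((by fun_prop : Continuous _).intervalIntegrable _ _)]
  have e : ∀ t : ℝ, a t * (ε * |(z : ℝ) - t| - c) - a t * (2 + ε * (z + t) - c) =
      -2 * a t - 2 * ε * (a t * min (z : ℝ) t) := by
    intro t
    have : |(z : ℝ) - t| = z + t - 2 * min (z : ℝ) t := by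
      rcases le_total (z : ℝ) t with h | h
      · rw [min_eq_left h, abs_of_nonpos (by linarith)]; ring
      · rw [min_eq_right h, abs_of_nonneg (by linarith)]; ring
    rw [this]; ring
  simp only [e]
  rw [intervalIntegral.integral_sub ((by fun_prop : Continuous _).intervalIntegrable _ _)
    ((by fun_prop : Continuous _).intervalIntegrable _ _), intervalIntegral.integral_const_mul,
    intervalIntegral.integral_const_mul, ha1]
  ring

theorem localCoeff_lower (mu : ℝ) (z : Seg) :
    localCoeff (bandSlope a ε) ε (1 + ε * mu) (-1 - ε * z) =
      ε * (mu + 1 - z + ε * minMean (segMeasure a) z) := by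
  have hF : Integrable (fun y' => |-1 - ε * z - y'| - Real.log 2) (bandMeasure ε) :=
    (ContinuousOn.integrableOn_compact (isCompact_bands ε) (by fun_prop))
  unfold localCoeff
  rw [integral_bandSlope_mul hε hε1 ha hF]
  have e1 : ∫ t in (-1 : ℝ)..1, a t * (|-1 - ε * z - (-1 - ε * t)| - Real.log 2) =
      ∫ t in (-1 : ℝ)..1, a t * (ε * |(z : ℝ) - t| - Real.log 2) := by
    refine intervalIntegral.integral_congr fun t ht => ?_
    have e : |-1 - ε * (z : ℝ) - (-1 - ε * t)| = ε * |z - t| := by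
      rw [show -1 - ε * (z : ℝ) - (-1 - ε * t) = -(ε * (z - t)) by ring, abs_neg, abs_mul,
        abs_of_pos hε]
    simp only [e]
  have e2 : ∫ t in (-1 : ℝ)..1, a t * (|-1 - ε * z - (1 + ε * t)| - Real.log 2) =
      ∫ t in (-1 : ℝ)..1, a t * (2 + ε * (z + t) - Real.log 2) := by
    refine intervalIntegral.integral_congr fun t ht => ?_
    rw [uIcc_of_le (by norm_num)] at ht
    have e : |-1 - ε * (z : ℝ) - (1 + ε * t)| = 2 + ε * (z + t) := by
      rw [abs_of_nonpos (by nlinarith [z.2.1, ht.1])]; ring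
    simp only [e]
  rw [e1, e2, integral_abs_sub_eq ha ha0 ha1 z]
  ring

theorem localCoeff_upper (mu : ℝ) (z : Seg) :
    localCoeff (bandSlope a ε) ε (1 + ε * mu) (1 + ε * z) =
      2 + ε * (mu + z - 1 - ε * minMean (segMeasure a) z) := by
  have hF : Integrable (fun y' => |1 + ε * z - y'| - Real.log 2) (bandMeasure ε) :=
    (ContinuousOn.integrableOn_compact (isCompact_bands ε) (by fun_prop))
  unfold localCoeff
  rw [integral_bandSlope_mul hε hε1 ha hF]
  have e1 : ∫ t in (-1 : ℝ)..1, a t * (|1 + ε * z - (1 + ε * t)| - Real.log 2) =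
      ∫ t in (-1 : ℝ)..1, a t * (ε * |(z : ℝ) - t| - Real.log 2) := by
    refine intervalIntegral.integral_congr fun t ht => ?_
    have e : |1 + ε * (z : ℝ) - (1 + ε * t)| = ε * |z - t| := by
      rw [show 1 + ε * (z : ℝ) - (1 + ε * t) = ε * (z - t) by ring, abs_mul, abs_of_pos hε]
    simp only [e]
  have e2 : ∫ t in (-1 : ℝ)..1, a t * (|1 + ε * z - (-1 - ε * t)| - Real.log 2) =
      ∫ t in (-1 : ℝ)..1, a t * (2 + ε * (z + t) - Real.log 2) := by
    refine intervalIntegral.integral_congr fun t ht => ?_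
    rw [uIcc_of_le (by norm_num)] at ht
    have e : |1 + ε * (z : ℝ) - (-1 - ε * t)| = 2 + ε * (z + t) := by
      rw [abs_of_nonneg (by nlinarith [z.2.1, ht.1])]; ring
    simp only [e]
  have h := integral_abs_sub_eq ha ha0 ha1 (ε := ε) z (Real.log 2)
  rw [e1, e2]
  linear_combination (ε / 2) * h

theorem modeOp_lower (mu : ℝ) {n : ℕ} {H : ℝ → ℝ} (hH : Integrable H (bandMeasure ε)) (z : Seg) :
    modeOp (bandSlope a ε) ε (1 + ε * mu) n H (-1 - ε * z) =
      ε * ((mu + 1 - z + ε * minMean (segMeasure a) z) * H (-1 - ε * z) - 1 / (2 * n) *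
        (selfInt a ε n (fun t => H (-1 - ε * t)) z - crossInt a ε n (fun t => H (1 + ε * t)) z)) := by
  unfold modeOp
  rw [localCoeff_lower hε hε1 ha ha0 ha1, integral_exp_lower hε hε1 ha hH n z.2]
  ring

theorem modeOp_upper (mu : ℝ) {n : ℕ} {H : ℝ → ℝ} (hH : Integrable H (bandMeasure ε)) (z : Seg) :
    modeOp (bandSlope a ε) ε (1 + ε * mu) n H (1 + ε * z) =
      (2 + ε * (mu + z - 1 - ε * minMean (segMeasure a) z)) * H (1 + ε * z) - ε / (2 * n) *
        (crossInt a ε n (fun t => H (-1 - ε * t)) z - selfInt a ε n (fun t => H (1 + ε * t)) z) := by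
  unfold modeOp
  rw [localCoeff_upper hε hε1 ha ha0 ha1, integral_exp_upper hε hε1 ha hH n z.2]
  ring

end

end CouetteWave

namespace CouetteWave

/-! ### From the band equation to the mode equation and back -/

section
variable {ε : ℝ} {a : ℝ → ℝ}

theorem crossInt_eq (n : ℕ) (f : ℝ → ℝ) (z : ℝ) :
    crossInt a ε n f z = Real.exp (-(n * (2 + ε * z))) *
      ∫ t in (-1 : ℝ)..1, Real.exp (-(n * (ε * t))) * (a t * f t) := by
  unfold crossInt
  rw [← intervalIntegral.integral_const_mul]
  refine intervalIntegral.integral_congr fun t _ => ?_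
  rw [← mul_assoc (Real.exp _) (Real.exp _), ← Real.exp_add]
  ring_nf

theorem continuous_crossInt (n : ℕ) (f : ℝ → ℝ) : Continuous (crossInt a ε n f) := by
  rw [funext (crossInt_eq n f)]
  fun_prop

theorem continuous_selfInt (hε : 0 < ε) (ha : Continuous a) (n : ℕ) {f : ℝ → ℝ}
    (hf : IntervalIntegrable f volume (-1) 1) : Continuous (selfInt a ε n f) := by
  have haf : IntervalIntegrable (fun t => a t * f t) volume (-1) 1 :=
    hf.continuousOn_mul ha.continuousOn
  refine intervalIntegral.continuous_of_dominated_interval (bound := fun t => |a t * f t|)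
    (fun z => ?_) (fun z => ?_) haf.abs ?_
  · exact (by fun_prop : Continuous fun t => Real.exp (-(n * ε * |z - t|))).aestronglyMeasurable.mul
      haf.def'.aestronglyMeasurable
  · refine Filter.Eventually.of_forall fun t _ => ?_
    rw [norm_mul, Real.norm_eq_abs, Real.norm_eq_abs, Real.abs_exp]
    refine mul_le_of_le_one_left (abs_nonneg _) (Real.exp_le_one_iff.2 ?_)
    have : 0 ≤ (n : ℝ) * ε * |z - t| := by positivity
    linarith
  · exact Filter.Eventually.of_forall fun t _ => by fun_prop

theorem selfInt_congr (n : ℕ) {f g : ℝ → ℝ} (h : ∀ᵐ t ∂unitMeasure, f t = g t) (z : ℝ) :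
    selfInt a ε n f z = selfInt a ε n g z := by
  unfold selfInt
  rw [← integral_unitMeasure, ← integral_unitMeasure]
  refine integral_congr_ae ?_
  filter_upwards [h] with t ht
  rw [ht]

theorem crossInt_congr (n : ℕ) {f g : ℝ → ℝ} (h : ∀ᵐ t ∂unitMeasure, f t = g t) (z : ℝ) :
    crossInt a ε n f z = crossInt a ε n g z := by
  unfold crossInt
  rw [← integral_unitMeasure, ← integral_unitMeasure]
  refine integral_congr_ae ?_
  filter_upwards [h] with t ht
  rw [ht]

theorem ae_unitMeasure_mem : ∀ᵐ z ∂unitMeasure, z ∈ Icc (-1 : ℝ) 1 := ae_restrict_mem measurableSet_Icc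

variable (hε : 0 < ε) (hε1 : ε < 1) (ha : ContDiff ℝ ∞ a)
  (ha0 : ∀ z, 0 ≤ a z) (ha1 : ∫ z in (-1 : ℝ)..1, a z = 1)
  [IsProbabilityMeasure (segMeasure a)]
include hε hε1 ha ha0 ha1

theorem exists_modeEq_of_modeOp {mu : ℝ} {n : ℕ}
    (hD : ∀ z : Seg, mu + 1 - z + ε * minMean (segMeasure a) z ≠ 0)
    (hA : ∀ z : Seg, 2 + ε * (mu + z - 1 - ε * minMean (segMeasure a) z) ≠ 0)
    {H : ℝ → ℝ} (hH : Integrable H (bandMeasure ε))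
    (h : ∀ᵐ y ∂bandMeasure ε, modeOp (bandSlope a ε) ε (1 + ε * mu) n H y = 0) :
    ∃ b u : C(Seg, ℝ), ModeEq (segMeasure a) (minMean (segMeasure a)) ε mu n b u ∧
      (∀ᵐ z ∂unitMeasure, H (-1 - ε * z) = segExtend b z) ∧
      ∀ᵐ z ∂unitMeasure, H (1 + ε * z) = segExtend u z := by
  have hac := ha.continuous
  set fb : ℝ → ℝ := fun t => H (-1 - ε * t) with hfb
  set fu : ℝ → ℝ := fun t => H (1 + ε * t) with hfu
  have ib := intervalIntegrable_lower hε hH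
  have iu := intervalIntegrable_upper hε hH
  have c1 := continuous_selfInt hε hac n ib
  have c2 := continuous_selfInt hε hac n iu
  have c3 := continuous_crossInt (a := a) (ε := ε) n fb
  have c4 := continuous_crossInt (a := a) (ε := ε) n fu
  let b : C(Seg, ℝ) := ⟨fun z => (mu + 1 - z + ε * minMean (segMeasure a) z)⁻¹ *
    (1 / (2 * n) * (selfInt a ε n fb z - crossInt a ε n fu z)),
    (Continuous.inv₀ (by fun_prop) hD).mul (by fun_prop)⟩
  let u : C(Seg, ℝ) := ⟨fun z => (2 + ε * (mu + z - 1 - ε * minMean (segMeasure a) z))⁻¹ *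
    (ε / (2 * n) * (crossInt a ε n fb z - selfInt a ε n fu z)),
    (Continuous.inv₀ (by fun_prop) hA).mul (by fun_prop)⟩
  rw [ae_bandMeasure_iff hε] at h
  have hb : ∀ᵐ z ∂unitMeasure, fb z = segExtend b z := by
    filter_upwards [h.1, ae_unitMeasure_mem] with z hz hm
    rw [modeOp_lower hε hε1 hac ha0 ha1 mu hH ⟨z, hm⟩] at hz
    have hz' := (mul_eq_zero.1 hz).resolve_left hε.ne'
    rw [segExtend_of_mem _ hm]
    change _ = (mu + 1 - z + ε * minMean (segMeasure a) ⟨z, hm⟩)⁻¹ *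
      (1 / (2 * n) * (selfInt a ε n fb z - crossInt a ε n fu z))
    rw [← sub_eq_zero.1 hz', inv_mul_cancel_left₀ (hD ⟨z, hm⟩)]
  have hu : ∀ᵐ z ∂unitMeasure, fu z = segExtend u z := by
    filter_upwards [h.2, ae_unitMeasure_mem] with z hz hm
    rw [modeOp_upper hε hε1 hac ha0 ha1 mu hH ⟨z, hm⟩] at hz
    rw [segExtend_of_mem _ hm]
    change _ = (2 + ε * (mu + z - 1 - ε * minMean (segMeasure a) ⟨z, hm⟩))⁻¹ *
      (ε / (2 * n) * (crossInt a ε n fb z - selfInt a ε n fu z))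
    rw [← sub_eq_zero.1 hz, inv_mul_cancel_left₀ (hA ⟨z, hm⟩)]
  refine ⟨b, u, ⟨fun z => ?_, fun z => ?_⟩, hb, hu⟩
  · rw [intOp_selfKernel_eq ha ha0, intOp_crossKernel_eq ha ha0]
    have e1 := selfInt_congr (a := a) (ε := ε) n hb z
    have e2 := crossInt_congr (a := a) (ε := ε) n hu z
    change (mu + 1 - (z : ℝ) + ε * minMean (segMeasure a) z) *
      ((mu + 1 - (z : ℝ) + ε * minMean (segMeasure a) z)⁻¹ *
      (1 / (2 * n) * (selfInt a ε n fb z - crossInt a ε n fu z))) = _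
    rw [mul_inv_cancel_left₀ (hD z), e1, e2]; rfl
  · rw [intOp_selfKernel_eq ha ha0, intOp_crossKernel_eq ha ha0]
    have e1 := selfInt_congr (a := a) (ε := ε) n hu z
    have e2 := crossInt_congr (a := a) (ε := ε) n hb z
    change (2 + ε * (mu + (z : ℝ) - 1 - ε * minMean (segMeasure a) z)) *
      ((2 + ε * (mu + (z : ℝ) - 1 - ε * minMean (segMeasure a) z))⁻¹ *
      (ε / (2 * n) * (crossInt a ε n fb z - selfInt a ε n fu z))) = _
    rw [mul_inv_cancel_left₀ (hA z), e1, e2]; rfl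

theorem modeOp_eq_zero_of_modeEq {mu : ℝ} {n : ℕ} {b u : C(Seg, ℝ)}
    (h : ModeEq (segMeasure a) (minMean (segMeasure a)) ε mu n b u)
    {H : ℝ → ℝ} (hH : Integrable H (bandMeasure ε))
    (hb : ∀ z ∈ Icc (-1 : ℝ) 1, H (-1 - ε * z) = segExtend b z)
    (hu : ∀ z ∈ Icc (-1 : ℝ) 1, H (1 + ε * z) = segExtend u z) :
    ∀ᵐ y ∂bandMeasure ε, modeOp (bandSlope a ε) ε (1 + ε * mu) n H y = 0 := by
  have hac := ha.continuous
  have hb' : ∀ᵐ z ∂unitMeasure, H (-1 - ε * z) = segExtend b z := by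
    filter_upwards [ae_unitMeasure_mem] with z hz using hb z hz
  have hu' : ∀ᵐ z ∂unitMeasure, H (1 + ε * z) = segExtend u z := by
    filter_upwards [ae_unitMeasure_mem] with z hz using hu z hz
  rw [ae_bandMeasure_iff hε]
  constructor
  · filter_upwards [ae_unitMeasure_mem] with z hm
    have h1 := h.1 ⟨z, hm⟩
    rw [intOp_selfKernel_eq ha ha0, intOp_crossKernel_eq ha ha0] at h1
    rw [modeOp_lower hε hε1 hac ha0 ha1 mu hH ⟨z, hm⟩, hb z hm, segExtend_of_mem _ hm, h1,
      selfInt_congr n hb', crossInt_congr n hu']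
    exact mul_eq_zero_of_right _ (sub_self _)
  · filter_upwards [ae_unitMeasure_mem] with z hm
    have h1 := h.2 ⟨z, hm⟩
    rw [intOp_selfKernel_eq ha ha0, intOp_crossKernel_eq ha ha0] at h1
    rw [modeOp_upper hε hε1 hac ha0 ha1 mu hH ⟨z, hm⟩, hu z hm, segExtend_of_mem _ hm, h1,
      selfInt_congr n hu', crossInt_congr n hb']
    exact sub_self _

end

/-- The function on the bands with rescaled profiles `b` (lower band) and `u` (upper band). -/
noncomputable def bandProfile (b u : C(Seg, ℝ)) (ε y : ℝ) : ℝ :=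
  if 0 < y then segExtend u ((y - 1) / ε) else segExtend b ((-1 - y) / ε)

section
variable {ε : ℝ} (hε : 0 < ε) (hε1 : ε < 1) (b u : C(Seg, ℝ))
include hε hε1

theorem bandProfile_lower {z : ℝ} (hz : z ∈ Icc (-1 : ℝ) 1) :
    bandProfile b u ε (-1 - ε * z) = segExtend b z := by
  unfold bandProfile
  rw [if_neg (by nlinarith [hz.1])]
  congr 1; field_simp; ring

theorem bandProfile_upper {z : ℝ} (hz : z ∈ Icc (-1 : ℝ) 1) :
    bandProfile b u ε (1 + ε * z) = segExtend u z := by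
  unfold bandProfile
  rw [if_pos (by nlinarith [hz.1])]
  congr 1; field_simp; ring

theorem contDiffOn_bandProfile {k : WithTop ℕ∞} (hb : ContDiffOn ℝ k (segExtend b) (Icc (-1) 1))
    (hu : ContDiffOn ℝ k (segExtend u) (Icc (-1) 1)) :
    ContDiffOn ℝ k (bandProfile b u ε) (bands ε) := by
  have hlow : ContDiffOn ℝ k (bandProfile b u ε) (Icc (-1 - ε) (-1 + ε)) := by
    have h1 : ContDiffOn ℝ k (fun y => segExtend b ((-1 - y) / ε)) (Icc (-1 - ε) (-1 + ε)) := by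
      refine hb.comp (ContDiff.contDiffOn (by fun_prop)) fun y hy => ⟨?_, ?_⟩
      · rw [le_div_iff₀ hε]; linarith [hy.2]
      · rw [div_le_iff₀ hε]; linarith [hy.1]
    refine h1.congr fun y hy => ?_
    unfold bandProfile; rw [if_neg (by linarith [hy.2])]
  have hupp : ContDiffOn ℝ k (bandProfile b u ε) (Icc (1 - ε) (1 + ε)) := by
    have h1 : ContDiffOn ℝ k (fun y => segExtend u ((y - 1) / ε)) (Icc (1 - ε) (1 + ε)) := by
      refine hu.comp (ContDiff.contDiffOn (by fun_prop)) fun y hy => ⟨?_, ?_⟩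
      · rw [le_div_iff₀ hε]; linarith [hy.1]
      · rw [div_le_iff₀ hε]; linarith [hy.2]
    refine h1.congr fun y hy => ?_
    unfold bandProfile; rw [if_pos (by linarith [hy.1])]
  intro y hy
  rcases hy with hy | hy
  · refine ((contDiffWithinAt_congr_set ?_).2 (hlow y hy))
    filter_upwards [isOpen_Iio.mem_nhds (show y ∈ Iio (0 : ℝ) by simp; linarith [hy.2])] with t ht
    simp only [mem_Iio] at ht
    refine propext ⟨fun h => ?_, fun h => Or.inl h⟩
    rcases h with h | h
    · exact h
    · linarith [h.1]
  · refine ((contDiffWithinAt_congr_set ?_).2 (hupp y hy))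
    filter_upwards [isOpen_Ioi.mem_nhds (show y ∈ Ioi (0 : ℝ) by simp; linarith [hy.1])] with t ht
    simp only [mem_Ioi] at ht
    refine propext ⟨fun h => ?_, fun h => Or.inr h⟩
    rcases h with h | h
    · linarith [h.2]
    · exact h

theorem continuousOn_bandProfile : ContinuousOn (bandProfile b u ε) (bands ε) :=
  (contDiffOn_bandProfile hε hε1 b u (k := 0)
    (contDiffOn_zero.2 (continuous_segExtend b).continuousOn)
    (contDiffOn_zero.2 (continuous_segExtend u).continuousOn)).continuousOn

theorem integrable_bandProfile : Integrable (bandProfile b u ε) (bandMeasure ε) :=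
  (continuousOn_bandProfile hε hε1 b u).integrableOn_compact (isCompact_bands ε)

theorem ae_eq_bandProfile {H : ℝ → ℝ} (h1 : ∀ᵐ z ∂unitMeasure, H (-1 - ε * z) = segExtend b z)
    (h2 : ∀ᵐ z ∂unitMeasure, H (1 + ε * z) = segExtend u z) :
    ∀ᵐ y ∂bandMeasure ε, H y = bandProfile b u ε y := by
  rw [ae_bandMeasure_iff hε]
  constructor
  · filter_upwards [h1, ae_unitMeasure_mem] with z hz hm
    rw [hz, bandProfile_lower hε hε1 b u hm]
  · filter_upwards [h2, ae_unitMeasure_mem] with z hz hm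
    rw [hz, bandProfile_upper hε hε1 b u hm]

end

end CouetteWave

namespace CouetteWave

/-! ### Completeness of the Fourier system and weak derivatives -/

theorem ae_eq_zero_of_fourier {f : ℝ → ℝ} (hf : MemLp f 2 torusMeasure)
    (hc : ∀ n : ℕ, ∫ x, Real.cos (n * x) * f x ∂torusMeasure = 0)
    (hs : ∀ n : ℕ, ∫ x, Real.sin (n * x) * f x ∂torusMeasure = 0) :
    ∀ᵐ x ∂torusMeasure, f x = 0 := by
  have hpi : -Real.pi < Real.pi := by linarith [Real.pi_pos]
  have hr : torusMeasure = volume.restrict (Ioc (-Real.pi) Real.pi) := by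
    unfold torusMeasure; exact (Measure.restrict_congr_set Ioc_ae_eq_Icc).symm
  have hF : MemLp (fun x => (f x : ℂ)) 2 (volume.restrict (Ioc (-Real.pi) Real.pi)) := by
    rw [← hr]; exact hf.ofReal
  have hc' : ∀ k : ℤ, ∫ x, Real.cos (k * x) * f x ∂torusMeasure = 0 := by
    intro k
    obtain ⟨n, rfl | rfl⟩ := k.eq_nat_or_neg
    · exact_mod_cast hc n
    · simpa using hc n
  have hs' : ∀ k : ℤ, ∫ x, Real.sin (k * x) * f x ∂torusMeasure = 0 := by
    intro k
    obtain ⟨n, rfl | rfl⟩ := k.eq_nat_or_neg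
    · exact_mod_cast hs n
    · simpa [integral_neg] using hs n
  have hfi : Integrable f torusMeasure := hf.integrable one_le_two
  have hcoef : ∀ k : ℤ, fourierCoeffOn hpi (fun x => (f x : ℂ)) k = 0 := by
    intro k
    rw [fourierCoeffOn_eq_integral, intervalIntegral.integral_of_le hpi.le, ← hr]
    have e : ∀ x : ℝ, fourier (-k) (x : AddCircle (Real.pi - -Real.pi)) • (f x : ℂ) =
        ((Real.cos (k * x) * f x : ℝ) : ℂ) - ((Real.sin (k * x) * f x : ℝ) : ℂ) * Complex.I := by
      intro x
      rw [fourier_coe_apply]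
      have : 2 * (Real.pi : ℂ) * Complex.I * ((-k : ℤ) : ℂ) * x / ((Real.pi - -Real.pi : ℝ) : ℂ) =
          ((-(k * x) : ℝ) : ℂ) * Complex.I := by
        have : (Real.pi : ℂ) ≠ 0 := by exact_mod_cast Real.pi_ne_zero
        push_cast
        rw [sub_neg_eq_add, ← two_mul]
        field_simp
      rw [this, Complex.exp_mul_I, ← Complex.ofReal_cos, ← Complex.ofReal_sin, Real.cos_neg,
        Real.sin_neg, smul_eq_mul]
      push_cast; ring
    simp only [e]
    have i1 : Integrable (fun x => Real.cos (k * x) * f x) torusMeasure :=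
      hfi.bdd_mul (c := 1) (by fun_prop) (Filter.Eventually.of_forall fun p => Real.abs_cos_le_one _)
    have i2 : Integrable (fun x => Real.sin (k * x) * f x) torusMeasure :=
      hfi.bdd_mul (c := 1) (by fun_prop) (Filter.Eventually.of_forall fun p => Real.abs_sin_le_one _)
    rw [integral_sub i1.ofReal (i2.ofReal.mul_const _), integral_mul_const, integral_complex_ofReal,
      integral_complex_ofReal, hc' k, hs' k]
    simp
  have h := tsum_sq_fourierCoeffOn hpi hF
  simp only [hcoef, norm_zero, ne_eq, OfNat.ofNat_ne_zero, not_false_eq_true, zero_pow, tsum_zero,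
    Complex.norm_real, Real.norm_eq_abs, sq_abs] at h
  rw [intervalIntegral.integral_of_le hpi.le, ← hr, smul_eq_mul, eq_comm, mul_eq_zero] at h
  have h2 := h.resolve_left (inv_ne_zero (by linarith))
  rw [integral_eq_zero_iff_of_nonneg (fun x => sq_nonneg _) hf.integrable_sq] at h2
  filter_upwards [h2] with x hx
  exact pow_eq_zero_iff (two_ne_zero) |>.1 hx

theorem ae_eq_zero_of_fourier_domain {ε : ℝ} {v : ℝ × ℝ → ℝ} (hv : MemLp v 2 (domainMeasure ε))
    (hc : ∀ n : ℕ, ∀ᵐ y ∂bandMeasure ε, ∫ x, Real.cos (n * x) * v (x, y) ∂torusMeasure = 0)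
    (hs : ∀ n : ℕ, ∀ᵐ y ∂bandMeasure ε, ∫ x, Real.sin (n * x) * v (x, y) ∂torusMeasure = 0) :
    v =ᵐ[domainMeasure ε] 0 := by
  have hsq := hv.integrable_sq
  have hm := hv.aestronglyMeasurable
  rw [domainMeasure_eq] at hsq hm
  have h : ∀ᵐ y ∂bandMeasure ε, ∀ᵐ x ∂torusMeasure, v (x, y) = 0 := by
    filter_upwards [ae_all_iff.2 hc, ae_all_iff.2 hs, hsq.prod_left_ae,
      hm.prod_swap.prodMk_left] with y h1 h2 h3 h4
    refine ae_eq_zero_of_fourier ?_ h1 h2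
    exact (memLp_two_iff_integrable_sq h4).2 h3
  have h0 : ∫ p, v p ^ 2 ∂domainMeasure ε = 0 := by
    rw [domainMeasure_eq, integral_prod_symm _ hsq, ← integral_zero ℝ ℝ (μ := bandMeasure ε)]
    refine integral_congr_ae ?_
    filter_upwards [h] with y hy
    rw [← integral_zero ℝ ℝ (μ := torusMeasure)]
    refine integral_congr_ae ?_
    filter_upwards [hy] with x hx
    rw [hx]; simp
  rw [integral_eq_zero_iff_of_nonneg (fun x => sq_nonneg _) hv.integrable_sq] at h0
  filter_upwards [h0] with x hx
  exact pow_eq_zero_iff (two_ne_zero) |>.1 hx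

/-- Smooth functions of `y` with compact support inside the bands. -/
structure IsBandTest (ε : ℝ) (χ : ℝ → ℝ) : Prop where
  smooth : ContDiff ℝ ∞ χ
  support_subset : ∃ K : Set ℝ, IsCompact K ∧ K ⊆ interior (bands ε) ∧ ∀ y, y ∉ K → χ y = 0

theorem ae_bandMeasure_mem_interior (ε : ℝ) : ∀ᵐ y ∂bandMeasure ε, y ∈ Ioo (-1 - ε) (-1 + ε) ∪
    Ioo (1 - ε) (1 + ε) := by
  have hfin : ({-1 - ε, -1 + ε, 1 - ε, 1 + ε} : Set ℝ).Finite := by simp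
  have h := ae_restrict_of_ae (s := bands ε)
    (measure_eq_zero_iff_ae_notMem.1 (hfin.measure_zero volume))
  filter_upwards [ae_bandMeasure_mem ε, h] with y hy hn
  simp only [mem_insert_iff, mem_singleton_iff, not_or] at hn
  obtain ⟨n1, n2, n3, n4⟩ := hn
  rcases hy with hy | hy
  · exact Or.inl ⟨lt_of_le_of_ne hy.1 (Ne.symm n1), lt_of_le_of_ne hy.2 n2⟩
  · exact Or.inr ⟨lt_of_le_of_ne hy.1 (Ne.symm n3), lt_of_le_of_ne hy.2 n4⟩

theorem Ioo_union_subset_interior (ε : ℝ) :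
    Ioo (-1 - ε) (-1 + ε) ∪ Ioo (1 - ε) (1 + ε) ⊆ interior (bands ε) :=
  interior_maximal (union_subset_union Ioo_subset_Icc_self Ioo_subset_Icc_self)
    (isOpen_Ioo.union isOpen_Ioo)

theorem ae_eq_zero_of_bandTest {ε : ℝ} {f : ℝ → ℝ} (hf : Integrable f (bandMeasure ε))
    (h : ∀ χ, IsBandTest ε χ → ∫ y, χ y * f y ∂bandMeasure ε = 0) :
    ∀ᵐ y ∂bandMeasure ε, f y = 0 := by
  have hl : LocallyIntegrableOn f (interior (bands ε)) volume :=
    (IntegrableOn.mono_set (t := bands ε) hf interior_subset).locallyIntegrableOn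
  have h1 := isOpen_interior.ae_eq_zero_of_integral_contDiff_smul_eq_zero hl fun g hg hgc hgs => by
    rw [← h g ⟨hg, tsupport g, hgc, hgs, fun y hy => image_eq_zero_of_notMem_tsupport hy⟩]
    unfold bandMeasure
    refine (setIntegral_eq_integral_of_forall_compl_eq_zero fun y hy => ?_).symm
    rw [image_eq_zero_of_notMem_tsupport fun h0 => hy (interior_subset (hgs h0)), zero_smul]
  filter_upwards [ae_restrict_of_ae (s := bands ε) h1, ae_bandMeasure_mem_interior ε] with y h2 h3
  exact h2 (Ioo_union_subset_interior ε h3)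

theorem IsBandTest.isTest {ε : ℝ} {χ : ℝ → ℝ} (hχ : IsBandTest ε χ) {f : ℝ → ℝ}
    (hf : ContDiff ℝ ∞ f) (hper : ∀ x, f (x + 2 * Real.pi) = f x) :
    IsTest ε fun p => f p.1 * χ p.2 := by
  refine ⟨(hf.comp contDiff_fst).mul (hχ.smooth.comp contDiff_snd), fun x y => by rw [hper], ?_⟩
  obtain ⟨K, h1, h2, h3⟩ := hχ.support_subset
  exact ⟨K, h1, h2, fun x y hy => by rw [h3 y hy, mul_zero]⟩

theorem cos_nat_periodic (n : ℕ) (x : ℝ) :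
    Real.cos (n * (x + 2 * Real.pi)) = Real.cos (n * x) := by
  rw [mul_add]; exact Real.cos_add_nat_mul_two_pi _ n

theorem sin_nat_periodic (n : ℕ) (x : ℝ) :
    Real.sin (n * (x + 2 * Real.pi)) = Real.sin (n * x) := by
  rw [mul_add]; exact Real.sin_add_nat_mul_two_pi _ n

section Slices
variable {ε : ℝ} {v : ℝ × ℝ → ℝ} (hv : Integrable v (domainMeasure ε)) {f : ℝ → ℝ}
  (hf : Continuous f) (hf1 : ∀ x, |f x| ≤ 1)
include hv hf hf1

theorem integrable_slice_mul : Integrable (fun p : ℝ × ℝ => f p.1 * v p) (domainMeasure ε) :=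
  hv.bdd_mul (c := 1) (by fun_prop) (Filter.Eventually.of_forall fun p => hf1 _)

theorem integrable_integral_slice :
    Integrable (fun y => ∫ x, f x * v (x, y) ∂torusMeasure) (bandMeasure ε) := by
  have h := integrable_slice_mul hv hf hf1
  rw [domainMeasure_eq] at h
  exact h.integral_prod_right

theorem integral_mul_test {χ : ℝ → ℝ} (hχ : IsBandTest ε χ) :
    ∫ p, v p * (f p.1 * χ p.2) ∂domainMeasure ε =
      ∫ y, χ y * ∫ x, f x * v (x, y) ∂torusMeasure ∂bandMeasure ε := by
  have hc := hχ.smooth.continuous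
  obtain ⟨K, h1, h2, h3⟩ := hχ.support_subset
  obtain ⟨C, hC⟩ := (isCompact_bands ε).exists_bound_of_continuousOn hc.continuousOn
  have h : Integrable (fun p : ℝ × ℝ => χ p.2 * (f p.1 * v p)) (domainMeasure ε) := by
    refine (integrable_slice_mul hv hf hf1).bdd_mul (c := C) (by fun_prop) ?_
    filter_upwards [ae_domain_snd (ae_bandMeasure_mem ε)] with p hp using hC _ hp
  have e : ∀ p : ℝ × ℝ, v p * (f p.1 * χ p.2) = χ p.2 * (f p.1 * v p) := fun p => by ring
  simp only [e]
  rw [domainMeasure_eq] at h ⊢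
  rw [integral_prod_symm _ h]
  simp only [integral_const_mul]

end Slices

theorem ae_integral_slice_eq_zero {ε : ℝ} {v : ℝ × ℝ → ℝ} (hv : Integrable v (domainMeasure ε))
    {f : ℝ → ℝ} (hf : ContDiff ℝ ∞ f) (hf1 : ∀ x, |f x| ≤ 1)
    (hper : ∀ x, f (x + 2 * Real.pi) = f x)
    (h : ∀ η, IsTest ε η → ∫ p, v p * η p ∂domainMeasure ε = 0) :
    ∀ᵐ y ∂bandMeasure ε, ∫ x, f x * v (x, y) ∂torusMeasure = 0 := by
  refine ae_eq_zero_of_bandTest (integrable_integral_slice hv hf.continuous hf1) fun χ hχ => ?_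
  rw [← integral_mul_test hv hf.continuous hf1 hχ]
  exact h _ (hχ.isTest hf hper)

theorem integrable_mul_test {ε : ℝ} {v : ℝ × ℝ → ℝ} (hv : Integrable v (domainMeasure ε))
    {η : ℝ × ℝ → ℝ} (hη : Continuous η) :
    Integrable (fun p => v p * η p) (domainMeasure ε) := by
  obtain ⟨C, hC⟩ := (isCompact_Icc.prod (isCompact_bands ε)).exists_bound_of_continuousOn
    (f := η) (s := Icc (-Real.pi) Real.pi ×ˢ bands ε) hη.continuousOn
  have hm : MeasurableSet (Icc (-Real.pi) Real.pi ×ˢ bands ε) :=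
    measurableSet_Icc.prod (measurableSet_bands ε)
  refine hv.mul_bdd (c := C) hη.aestronglyMeasurable ?_
  filter_upwards [ae_restrict_mem hm] with p hp using hC _ hp

theorem IsWeakPartial.ae_unique {ε : ℝ} {i j : ℕ} {g v v' : ℝ × ℝ → ℝ}
    (h : IsWeakPartial ε i j g v) (h' : IsWeakPartial ε i j g v') :
    v =ᵐ[domainMeasure ε] v' := by
  have hd := h.1.sub h'.1
  have hdi : Integrable (v - v') (domainMeasure ε) := hd.integrable one_le_two
  have h0 : ∀ η, IsTest ε η → ∫ p, (v - v') p * η p ∂domainMeasure ε = 0 := by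
    intro η hη
    have e := (h.2 η hη).symm.trans (h'.2 η hη)
    have e1 := mul_left_cancel₀ (pow_ne_zero _ (by norm_num)) e
    simp only [Pi.sub_apply, sub_mul]
    rw [integral_sub (integrable_mul_test (h.1.integrable one_le_two) hη.smooth.continuous)
      (integrable_mul_test (h'.1.integrable one_le_two) hη.smooth.continuous), e1, sub_self]
  have h1 := ae_eq_zero_of_fourier_domain hd
    (fun n => ae_integral_slice_eq_zero hdi (f := fun x => Real.cos (n * x)) (by fun_prop)
      (fun _ => Real.abs_cos_le_one _) (cos_nat_periodic n) h0)
    (fun n => ae_integral_slice_eq_zero hdi (f := fun x => Real.sin (n * x)) (by fun_prop)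
      (fun _ => Real.abs_sin_le_one _) (sin_nat_periodic n) h0)
  filter_upwards [h1] with p hp
  exact sub_eq_zero.1 hp

theorem MemX.isWeakPartial_weakDx {ε : ℝ} {g : ℝ × ℝ → ℝ} (hg : MemX ε g) :
    IsWeakPartial ε 1 0 g (weakDx ε g) := by
  have h := hg.sobolev.weakPartial 1 0 (by norm_num) (by norm_num)
  unfold weakDx
  rw [dif_pos h]
  exact h.choose_spec

/-- The Fourier coefficients of the weak derivative. -/
theorem MemX.fourier_weakDx {ε : ℝ} {g : ℝ × ℝ → ℝ} (hg : MemX ε g) (n : ℕ) :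
    ∀ᵐ y ∂bandMeasure ε, n * ∫ x, Real.cos (n * x) * g (x, y) ∂torusMeasure +
      ∫ x, Real.sin (n * x) * weakDx ε g (x, y) ∂torusMeasure = 0 := by
  have hw := hg.isWeakPartial_weakDx
  have hgi : Integrable g (domainMeasure ε) := hg.sobolev.memLp.integrable one_le_two
  have hwi : Integrable (weakDx ε g) (domainMeasure ε) := hw.1.integrable one_le_two
  have i1 := integrable_integral_slice hgi (f := fun x => Real.cos (n * x)) (by fun_prop)
    (fun _ => Real.abs_cos_le_one _)
  have i2 := integrable_integral_slice hwi (f := fun x => Real.sin (n * x)) (by fun_prop)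
    (fun _ => Real.abs_sin_le_one _)
  refine ae_eq_zero_of_bandTest ((i1.const_mul _).add i2) fun χ hχ => ?_
  have h := hw.2 _ (hχ.isTest (f := fun x => Real.sin (n * x)) (by fun_prop) (sin_nat_periodic n))
  have e1 : ∀ p : ℝ × ℝ, classicalPartial 1 0 (fun p => Real.sin (n * p.1) * χ p.2) p =
      n * (Real.cos (n * p.1) * χ p.2) := by
    intro p
    simp only [classicalPartial, iteratedDeriv_zero, iteratedDeriv_one]
    have hd : HasDerivAt (fun x : ℝ => Real.sin (n * x) * χ p.2)
        (Real.cos (n * p.1) * (n * 1) * χ p.2) p.1 :=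
      (((hasDerivAt_id p.1).const_mul (n : ℝ)).sin).mul_const _
    rw [hd.deriv]; ring
  have e2 : ∀ p : ℝ × ℝ, g p * (n * (Real.cos (n * p.1) * χ p.2)) =
    n * (g p * (Real.cos (n * p.1) * χ p.2)) := fun p => by ring
  simp only [e1, e2] at h
  rw [integral_const_mul, integral_mul_test hgi (by fun_prop) (fun _ => Real.abs_cos_le_one _) hχ,
    integral_mul_test hwi (f := fun x => Real.sin (n * x)) (by fun_prop)
      (fun _ => Real.abs_sin_le_one _) hχ] at h
  have hc := hχ.smooth.continuous
  obtain ⟨C, hC⟩ := (isCompact_bands ε).exists_bound_of_continuousOn hc.continuousOn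
  have bd : ∀ F : ℝ → ℝ, Integrable F (bandMeasure ε) →
      Integrable (fun y => χ y * F y) (bandMeasure ε) := fun F hF =>
    hF.bdd_mul (c := C) (by fun_prop) (by
      filter_upwards [ae_bandMeasure_mem ε] with y hy using hC y hy)
  simp only [mul_add]
  rw [integral_add (bd _ (i1.const_mul _)) (bd _ i2)]
  have e3 : ∀ y, χ y * (n * ∫ x, Real.cos (n * x) * g (x, y) ∂torusMeasure) =
    n * (χ y * ∫ x, Real.cos (n * x) * g (x, y) ∂torusMeasure) := fun y => by ring
  simp only [e3]
  rw [integral_const_mul, h]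
  simp

theorem MemX.integral_sin_eq_zero {ε : ℝ} {g : ℝ × ℝ → ℝ} (hg : MemX ε g) (n : ℕ) :
    ∀ᵐ y ∂bandMeasure ε, ∫ x, Real.sin (n * x) * g (x, y) ∂torusMeasure = 0 := by
  filter_upwards [ae_ae_of_ae_domain hg.even] with y hy
  have h1 : ∫ x, Real.sin (n * x) * g (x, y) ∂torusMeasure =
      ∫ x, -(Real.sin (n * -x) * g (-x, y)) ∂torusMeasure := by
    refine integral_congr_ae ?_
    filter_upwards [hy] with x hx
    rw [hx, mul_neg, Real.sin_neg]; ring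
  have h2 : ∫ x, -(Real.sin (n * -x) * g (-x, y)) ∂torusMeasure =
      -∫ x, Real.sin (n * x) * g (x, y) ∂torusMeasure := by
    rw [integral_neg, integral_torusMeasure, integral_torusMeasure,
      intervalIntegral.integral_comp_neg (fun x => Real.sin (n * x) * g (x, y)), neg_neg]
  linarith

theorem MemX.integral_eq_zero {ε : ℝ} {g : ℝ × ℝ → ℝ} (hg : MemX ε g) :
    ∀ᵐ y ∂bandMeasure ε, ∫ x, g (x, y) ∂torusMeasure = 0 := by
  simp only [integral_torusMeasure]
  exact hg.mean_zero

end CouetteWave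

namespace CouetteWave

/-! ### Separated functions belong to the Sobolev space -/

theorem integral_mul_iteratedDeriv_periodic {f θ : ℝ → ℝ} (hf : ContDiff ℝ ∞ f)
    (hθ : ContDiff ℝ ∞ θ) (hfp : Function.Periodic f (2 * Real.pi))
    (hθp : Function.Periodic θ (2 * Real.pi)) (i : ℕ) :
    ∫ x in (-Real.pi)..Real.pi, f x * iteratedDeriv i θ x =
      (-1) ^ i * ∫ x in (-Real.pi)..Real.pi, iteratedDeriv i f x * θ x := by
  induction i generalizing f with
  | zero => simp
  | succ i ih =>
    have hf' : ContDiff ℝ ∞ (deriv f) := (contDiff_infty_iff_deriv.1 hf).2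
    have hfp' : Function.Periodic (deriv f) (2 * Real.pi) := fun x => by
      rw [← deriv_comp_add_const]
      congr 1; ext y; exact hfp y
    have hθi : ContDiff ℝ ∞ (iteratedDeriv i θ) := by
      rw [iteratedDeriv_eq_iterate]
      exact hθ.iterate_deriv i
    have hθi' : ContDiff ℝ ∞ (deriv (iteratedDeriv i θ)) := (contDiff_infty_iff_deriv.1 hθi).2
    have hper : iteratedDeriv i θ Real.pi = iteratedDeriv i θ (-Real.pi) := by
      have h := congrFun (iteratedDeriv_comp_add_const i θ (2 * Real.pi)) (-Real.pi)
      have e : (fun z => θ (z + 2 * Real.pi)) = θ := funext hθp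
      rw [e] at h
      rw [h]; congr 1; ring
    have hfe : f Real.pi = f (-Real.pi) := by
      rw [← hfp (-Real.pi)]; congr 1; ring
    rw [iteratedDeriv_succ, iteratedDeriv_succ', intervalIntegral.integral_mul_deriv_eq_deriv_mul
      (u' := deriv f) (fun x _ => (hf.differentiable (by simp) x).hasDerivAt)
      (fun x _ => (hθi.differentiable (by simp) x).hasDerivAt)
      (hf'.continuous.intervalIntegrable _ _) (hθi'.continuous.intervalIntegrable _ _),
      ih hf' hfp', hper, hfe, pow_succ]
    ring

theorem uniqueDiffOn_bands {ε : ℝ} (hε : 0 < ε) : UniqueDiffOn ℝ (bands ε) := by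
  rintro y (hy | hy)
  · exact (uniqueDiffOn_Icc (by linarith) y hy).mono subset_union_left
  · exact (uniqueDiffOn_Icc (by linarith) y hy).mono subset_union_right

theorem IsBandTest.deriv {ε : ℝ} {χ : ℝ → ℝ} (hχ : IsBandTest ε χ) :
    IsBandTest ε (deriv χ) := by
  obtain ⟨K, h1, h2, h3⟩ := hχ.support_subset
  refine ⟨(contDiff_infty_iff_deriv.1 hχ.smooth).2, K, h1, h2, fun y hy => ?_⟩
  have : χ =ᶠ[nhds y] fun _ => 0 := by
    filter_upwards [h1.isClosed.isOpen_compl.mem_nhds hy] with t ht using h3 t ht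
  rw [this.deriv_eq]; simp

theorem IsBandTest.iteratedDeriv {ε : ℝ} {χ : ℝ → ℝ} (hχ : IsBandTest ε χ) (j : ℕ) :
    IsBandTest ε (iteratedDeriv j χ) := by
  induction j with
  | zero => simpa using hχ
  | succ j ih => rw [iteratedDeriv_succ]; exact ih.deriv

theorem integral_mul_deriv_bandTest {ε : ℝ} (hε : 0 < ε) {F χ : ℝ → ℝ}
    (hF : ContDiffOn ℝ ∞ F (bands ε)) (hχ : IsBandTest ε χ) :
    ∫ y, F y * deriv χ y ∂bandMeasure ε = -∫ y, derivWithin F (bands ε) y * χ y ∂bandMeasure ε := by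
  have hu := uniqueDiffOn_bands hε
  have hF' : ContinuousOn (derivWithin F (bands ε)) (bands ε) :=
    hF.continuousOn_derivWithin hu (by simp)
  obtain ⟨K, h1, h2, h3⟩ := hχ.support_subset
  obtain ⟨K', h1', h2', h3'⟩ := hχ.deriv.support_subset
  have hKb : K ⊆ bands ε := h2.trans interior_subset
  have hc := hχ.smooth.continuous
  have hc' := hχ.deriv.smooth.continuous
  have z1 : ∀ y, y ∉ bands ε → χ y = 0 := fun y hy => h3 y fun h => hy (hKb h)
  have z2 : ∀ y, y ∉ bands ε → _root_.deriv χ y = 0 := fun y hy =>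
    h3' y fun h => hy (interior_subset (h2' h))
  have i0 : IntegrableOn (fun y => F y * χ y) (bands ε) :=
    (hF.continuousOn.mul hc.continuousOn).integrableOn_compact (isCompact_bands ε)
  have i1 : IntegrableOn (fun y => derivWithin F (bands ε) y * χ y) (bands ε) :=
    (hF'.mul hc.continuousOn).integrableOn_compact (isCompact_bands ε)
  have i2 : IntegrableOn (fun y => F y * _root_.deriv χ y) (bands ε) :=
    (hF.continuousOn.mul hc'.continuousOn).integrableOn_compact (isCompact_bands ε)
  have supp : ∀ G : ℝ → ℝ, (∀ y, y ∉ bands ε → G y = 0) → IntegrableOn G (bands ε) →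
      Integrable G := fun G hG hi =>
    (integrableOn_iff_integrable_of_support_subset fun y hy => by
      by_contra h; exact hy (hG y h)).1 hi
  have hd : ∀ y, HasDerivAt (fun y => F y * χ y)
      (derivWithin F (bands ε) y * χ y + F y * _root_.deriv χ y) y := by
    intro y
    by_cases hy : y ∈ K
    · have hn : bands ε ∈ nhds y := mem_interior_iff_mem_nhds.1 (h2 hy)
      have hdF : HasDerivAt F (derivWithin F (bands ε) y) y :=
        ((hF.differentiableOn (by simp) y (hKb hy)).hasDerivWithinAt).hasDerivAt hn
      exact hdF.mul (hχ.smooth.differentiable (by simp) y).hasDerivAt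
    · have hz : (fun y => F y * χ y) =ᶠ[nhds y] fun _ => 0 := by
        filter_upwards [h1.isClosed.isOpen_compl.mem_nhds hy] with t ht
        rw [h3 t ht, mul_zero]
      have hz' : χ =ᶠ[nhds y] fun _ => 0 := by
        filter_upwards [h1.isClosed.isOpen_compl.mem_nhds hy] with t ht using h3 t ht
      rw [h3 y hy, hz'.deriv_eq]
      simpa using (hasDerivAt_const y (0 : ℝ)).congr_of_eventuallyEq hz
  have h := integral_eq_zero_of_hasDerivAt_of_integrable hd
    (supp _ (fun y hy => by rw [z1 y hy, z2 y hy]; simp) (i1.add i2))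
    (supp _ (fun y hy => by rw [z1 y hy]; simp) i0)
  rw [← setIntegral_eq_integral_of_forall_compl_eq_zero (s := bands ε)
    (fun y hy => by rw [z1 y hy, z2 y hy]; simp), integral_add i1 i2] at h
  unfold bandMeasure
  linarith

theorem contDiffOn_derivWithin_bands {ε : ℝ} (hε : 0 < ε) {F : ℝ → ℝ}
    (hF : ContDiffOn ℝ ∞ F (bands ε)) : ContDiffOn ℝ ∞ (derivWithin F (bands ε)) (bands ε) :=
  hF.derivWithin (uniqueDiffOn_bands hε) (by simp)

theorem contDiffOn_iteratedDerivWithin_bands {ε : ℝ} (hε : 0 < ε) {F : ℝ → ℝ}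
    (hF : ContDiffOn ℝ ∞ F (bands ε)) (j : ℕ) :
    ContinuousOn (iteratedDerivWithin j F (bands ε)) (bands ε) :=
  hF.continuousOn_iteratedDerivWithin (by exact_mod_cast le_top) (uniqueDiffOn_bands hε)

theorem integral_mul_iteratedDeriv_bandTest {ε : ℝ} (hε : 0 < ε) {F χ : ℝ → ℝ}
    (hF : ContDiffOn ℝ ∞ F (bands ε)) (hχ : IsBandTest ε χ) (j : ℕ) :
    ∫ y, F y * iteratedDeriv j χ y ∂bandMeasure ε =
      (-1) ^ j * ∫ y, iteratedDerivWithin j F (bands ε) y * χ y ∂bandMeasure ε := by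
  induction j generalizing F with
  | zero => simp
  | succ j ih =>
    rw [iteratedDeriv_succ, integral_mul_deriv_bandTest hε hF (hχ.iteratedDeriv j),
      ih (contDiffOn_derivWithin_bands hε hF), iteratedDerivWithin_succ', pow_succ]
    ring

/-- The partial derivatives in the second variable of a smooth function are jointly smooth. -/
theorem contDiff_iteratedDeriv_snd {η : ℝ × ℝ → ℝ} (hη : ContDiff ℝ ∞ η) (j : ℕ) :
    ContDiff ℝ ∞ fun p : ℝ × ℝ => iteratedDeriv j (fun y => η (p.1, y)) p.2 := by
  induction j with
  | zero => simpa using hη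
  | succ j ih =>
    have e : (fun p : ℝ × ℝ => iteratedDeriv (j + 1) (fun y => η (p.1, y)) p.2) = fun p : ℝ × ℝ =>
        fderiv ℝ (fun p : ℝ × ℝ => iteratedDeriv j (fun y => η (p.1, y)) p.2) p (0, 1) := by
      ext p
      rw [iteratedDeriv_succ]
      have h1 : HasDerivAt (fun y : ℝ => (p.1, y)) ((0 : ℝ), (1 : ℝ)) p.2 :=
        (hasDerivAt_const p.2 p.1).prodMk (hasDerivAt_id p.2)
      have h2 := (ih.differentiable (by simp) p).hasFDerivAt
      exact (h2.comp_hasDerivAt (f := fun y : ℝ => (p.1, y)) p.2 h1).deriv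
    rw [e]
    exact (ih.fderiv_right (by simp)).clm_apply contDiff_const

theorem contDiff_iteratedDeriv_fst {η : ℝ × ℝ → ℝ} (hη : ContDiff ℝ ∞ η) (i : ℕ) :
    ContDiff ℝ ∞ fun p : ℝ × ℝ => iteratedDeriv i (fun x => η (x, p.2)) p.1 :=
  (contDiff_iteratedDeriv_snd (η := fun p : ℝ × ℝ => η (p.2, p.1))
    (hη.comp (contDiff_snd.prodMk contDiff_fst)) i).comp (contDiff_snd.prodMk contDiff_fst)

section
variable {ε : ℝ}

theorem integrable_separated {f H : ℝ → ℝ} (hf : Continuous f) (hH : ContinuousOn H (bands ε))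
    {G : ℝ × ℝ → ℝ} (hG : Continuous G) :
    Integrable (fun p : ℝ × ℝ => f p.1 * H p.2 * G p) (torusMeasure.prod (bandMeasure ε)) := by
  rw [← domainMeasure_eq]
  refine ContinuousOn.integrableOn_compact (isCompact_Icc.prod (isCompact_bands ε)) ?_
  exact ((by fun_prop : Continuous fun p : ℝ × ℝ => f p.1).continuousOn.mul
    (hH.comp continuousOn_snd fun p hp => hp.2)).mul hG.continuousOn

theorem memLp_separated {f H : ℝ → ℝ} (hf : Continuous f) (hH : ContinuousOn H (bands ε)) :
    MemLp (fun p : ℝ × ℝ => f p.1 * H p.2) 2 (domainMeasure ε) := by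
  have hm : MeasurableSet (Icc (-Real.pi) Real.pi ×ˢ bands ε) :=
    measurableSet_Icc.prod (measurableSet_bands ε)
  have hc : ContinuousOn (fun p : ℝ × ℝ => f p.1 * H p.2) (Icc (-Real.pi) Real.pi ×ˢ bands ε) :=
    (by fun_prop : Continuous fun p : ℝ × ℝ => f p.1).continuousOn.mul
      (hH.comp continuousOn_snd fun p hp => hp.2)
  obtain ⟨C, hC⟩ := (isCompact_Icc.prod (isCompact_bands ε)).exists_bound_of_continuousOn hc
  refine MemLp.of_bound (hc.aestronglyMeasurable hm) C ?_
  filter_upwards [ae_restrict_mem hm] with p hp using hC _ hp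

theorem isWeakPartial_separated (hε : 0 < ε) {f H : ℝ → ℝ} (hf : ContDiff ℝ ∞ f)
    (hfp : Function.Periodic f (2 * Real.pi)) (hH : ContDiffOn ℝ ∞ H (bands ε)) (i j : ℕ) :
    IsWeakPartial ε i j (fun p => f p.1 * H p.2)
      (fun p => iteratedDeriv i f p.1 * iteratedDerivWithin j H (bands ε) p.2) := by
  have hfi : Continuous (iteratedDeriv i f) := hf.continuous_iteratedDeriv i (by exact_mod_cast le_top)
  have hHj := contDiffOn_iteratedDerivWithin_bands hε hH j
  refine ⟨memLp_separated hfi hHj, fun η hη => ?_⟩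
  have hsm := contDiff_iteratedDeriv_snd hη.smooth j
  have hper : ∀ y, Function.Periodic (fun x => iteratedDeriv j (fun y => η (x, y)) y)
      (2 * Real.pi) := by
    intro y x
    simp only [hη.periodic]
  have htest : ∀ x, IsBandTest ε fun y => η (x, y) := by
    intro x
    obtain ⟨K, h1, h2, h3⟩ := hη.support_subset
    exact ⟨hη.smooth.comp (contDiff_const.prodMk contDiff_id), K, h1, h2, fun y hy => h3 x y hy⟩
  have step1 : ∀ y, ∫ x, f x * H y * classicalPartial i j η (x, y) ∂torusMeasure =
      (-1) ^ i * ∫ x, iteratedDeriv i f x * H y * iteratedDeriv j (fun y => η (x, y)) y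
        ∂torusMeasure := by
    intro y
    have h := integral_mul_iteratedDeriv_periodic (θ := fun x => iteratedDeriv j (fun y => η (x, y)) y)
      hf (hsm.comp (contDiff_id.prodMk contDiff_const) : ContDiff ℝ ∞
        fun x => iteratedDeriv j (fun y => η (x, y)) y) hfp (hper y) i
    have e1 : ∀ x, f x * H y * classicalPartial i j η (x, y) =
        H y * (f x * iteratedDeriv i (fun x => iteratedDeriv j (fun y => η (x, y)) y) x) :=
      fun x => by unfold classicalPartial; ring
    have e2 : ∀ x, iteratedDeriv i f x * H y * iteratedDeriv j (fun y => η (x, y)) y =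
        H y * (iteratedDeriv i f x * iteratedDeriv j (fun y => η (x, y)) y) := fun x => by ring
    simp only [e1, e2]
    rw [integral_const_mul, integral_const_mul, integral_torusMeasure, integral_torusMeasure, h]
    ring
  have step2 : ∀ x, ∫ y, iteratedDeriv i f x * H y * iteratedDeriv j (fun y => η (x, y)) y
      ∂bandMeasure ε = (-1) ^ j * ∫ y, iteratedDeriv i f x * iteratedDerivWithin j H (bands ε) y *
        η (x, y) ∂bandMeasure ε := by
    intro x
    simp only [mul_assoc (iteratedDeriv i f x)]
    rw [integral_const_mul, integral_const_mul,
      integral_mul_iteratedDeriv_bandTest hε hH (htest x) j]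
    ring
  have c1 : Continuous (classicalPartial i j η) := (contDiff_iteratedDeriv_fst hsm i).continuous
  rw [domainMeasure_eq, integral_prod_symm _
    (integrable_separated hf.continuous hH.continuousOn c1)]
  simp only [step1]
  rw [integral_const_mul, ← integral_prod_symm _
    (integrable_separated hfi hH.continuousOn hsm.continuous),
    integral_prod _ (integrable_separated hfi hH.continuousOn hsm.continuous)]
  simp only [step2]
  rw [integral_const_mul, ← integral_prod _
    (integrable_separated hfi hHj hη.smooth.continuous), pow_add, mul_assoc]

theorem memX_separated (hε : 0 < ε) {H : ℝ → ℝ} (hH : ContDiffOn ℝ ∞ H (bands ε)) {m : ℕ}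
    (hm : 1 ≤ m) : MemX ε fun p => Real.cos (m * p.1) * H p.2 := by
  have hf : ContDiff ℝ ∞ fun x : ℝ => Real.cos (m * x) := by fun_prop
  refine ⟨⟨fun x y _ => ?_, memLp_separated hf.continuous hH.continuousOn,
    fun i j _ _ => ⟨_, isWeakPartial_separated hε hf (cos_nat_periodic m) hH i j⟩⟩, ?_, ?_⟩
  · simp only [cos_nat_periodic]
  · exact Filter.Eventually.of_forall fun p => by simp
  · refine Filter.Eventually.of_forall fun y => ?_
    have h := integral_cos_int_mul_add (j := m) (by omega) 0
    simp only [add_zero, Int.cast_natCast] at h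
    simp only [intervalIntegral.integral_mul_const, h, zero_mul]

theorem weakDx_separated (hε : 0 < ε) {g : ℝ × ℝ → ℝ} (hg : MemX ε g) {H : ℝ → ℝ}
    (hH : ContDiffOn ℝ ∞ H (bands ε)) {m : ℕ} {c : ℝ}
    (hgh : g =ᵐ[domainMeasure ε] fun p => c * (Real.cos (m * p.1) * H p.2)) :
    weakDx ε g =ᵐ[domainMeasure ε] fun p => Real.sin (m * p.1) * (-(c * m) * H p.2) := by
  have hf : ContDiff ℝ ∞ fun x : ℝ => Real.cos (m * x) := by fun_prop
  have h := isWeakPartial_separated hε hf (cos_nat_periodic m) hH 1 0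
  have h2 : IsWeakPartial ε 1 0 g fun p => Real.sin (m * p.1) * (-(c * m) * H p.2) := by
    have e : ∀ x : ℝ, deriv (fun x : ℝ => Real.cos (m * x)) x = -(m * Real.sin (m * x)) := by
      intro x
      have hd : HasDerivAt (fun x : ℝ => Real.cos (m * x)) (-Real.sin (m * x) * (m * 1)) x :=
        ((hasDerivAt_id x).const_mul (m : ℝ)).cos
      rw [hd.deriv]; ring
    simp only [iteratedDeriv_one, iteratedDerivWithin_zero, e] at h
    have e2 : (fun p : ℝ × ℝ => Real.sin (m * p.1) * (-(c * m) * H p.2)) =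
        fun p : ℝ × ℝ => c * (-(m * Real.sin (m * p.1)) * H p.2) := by ext p; ring
    rw [e2]
    refine ⟨h.1.const_mul c, fun η hη => ?_⟩
    have e3 : ∫ p, g p * classicalPartial 1 0 η p ∂domainMeasure ε =
        c * ∫ p, Real.cos (m * p.1) * H p.2 * classicalPartial 1 0 η p ∂domainMeasure ε := by
      rw [← integral_const_mul]
      refine integral_congr_ae ?_
      filter_upwards [hgh] with p hp
      rw [hp]; ring
    rw [e3, h.2 η hη]
    simp only [mul_assoc c]
    rw [integral_const_mul]
    ring
  exact hg.isWeakPartial_weakDx.ae_unique h2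

end

end CouetteWave

namespace CouetteWave

/-! ### The kernel of the linearized operator -/

theorem integral_cos_mul_cos (n : ℕ) {m : ℕ} (hm : 1 ≤ m) :
    ∫ x, Real.cos (n * x) * Real.cos (m * x) ∂torusMeasure = if n = m then Real.pi else 0 := by
  have e : ∀ x : ℝ, Real.cos (n * x) * Real.cos (m * x) =
      1 / 2 * (Real.cos (((n - m : ℤ) : ℝ) * x + 0) + Real.cos (((n + m : ℤ) : ℝ) * x + 0)) := by
    intro x
    push_cast
    rw [add_zero, add_zero, sub_mul, add_mul, Real.cos_sub, Real.cos_add]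
    ring
  rw [integral_torusMeasure]
  simp only [e]
  rw [intervalIntegral.integral_const_mul, intervalIntegral.integral_add
    ((by fun_prop : Continuous _).intervalIntegrable _ _)
    ((by fun_prop : Continuous _).intervalIntegrable _ _),
    integral_cos_int_mul_add (by omega : ((n : ℤ) + m) ≠ 0)]
  split_ifs with h
  · subst h; simp; ring
  · rw [integral_cos_int_mul_add (by omega)]; simp

theorem integral_sin_mul_cos (n m : ℕ) :
    ∫ x, Real.sin (n * x) * Real.cos (m * x) ∂torusMeasure = 0 := by
  rw [integral_torusMeasure]
  have h := intervalIntegral.integral_comp_neg (a := -Real.pi) (b := Real.pi)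
    (fun x => Real.sin (n * x) * Real.cos (m * x))
  simp only [mul_neg, Real.sin_neg, Real.cos_neg, neg_mul, intervalIntegral.integral_neg,
    neg_neg] at h
  linarith

theorem modeOp_const_mul (σ : ℝ → ℝ) (ε lam : ℝ) (n : ℕ) (k : ℝ) (H : ℝ → ℝ) (y : ℝ) :
    modeOp σ ε lam n (fun y => k * H y) y = k * modeOp σ ε lam n H y := by
  unfold modeOp
  have e : ∀ y', σ y' * Real.exp (-(n * |y - y'|)) * (k * H y') =
    k * (σ y' * Real.exp (-(n * |y - y'|)) * H y') := fun y' => by ring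
  simp only [e]
  rw [integral_const_mul]; ring

theorem bandProfile_smul (k : ℝ) (b u : C(Seg, ℝ)) (ε y : ℝ) :
    bandProfile (k • b) (k • u) ε y = k * bandProfile b u ε y := by
  unfold bandProfile
  split_ifs <;> simp [segExtend, IccExtend]

theorem bandProfile_zero (ε y : ℝ) : bandProfile 0 0 ε y = 0 := by
  unfold bandProfile
  split_ifs <;> simp [segExtend, IccExtend]

theorem eq_zero_of_bandProfile_ae {ε : ℝ} (hε : 0 < ε) (hε1 : ε < 1) {b u : C(Seg, ℝ)}
    (h : ∀ᵐ y ∂bandMeasure ε, bandProfile b u ε y = 0) : b = 0 ∧ u = 0 := by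
  rw [ae_bandMeasure_iff hε] at h
  have key : ∀ f : C(Seg, ℝ), (∀ᵐ z ∂unitMeasure, segExtend f z = 0) → f = 0 := by
    intro f hf
    have h1 := Measure.eqOn_Icc_of_ae_eq volume (by norm_num : (-1 : ℝ) ≠ 1)
      (f := segExtend f) (g := fun _ => 0) hf (continuous_segExtend f).continuousOn
      continuousOn_const
    ext z
    rw [← segExtend_coe f z]
    exact h1 z.2
  constructor
  · refine key b ?_
    filter_upwards [h.1, ae_unitMeasure_mem] with z hz hm
    rwa [bandProfile_lower hε hε1 b u hm] at hz
  · refine key u ?_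
    filter_upwards [h.2, ae_unitMeasure_mem] with z hz hm
    rwa [bandProfile_upper hε hε1 b u hm] at hz

theorem ae_eq_zero_of_separated {ε : ℝ} {m : ℕ} (hm : 1 ≤ m) {H : ℝ → ℝ}
    (h : (fun p : ℝ × ℝ => Real.cos (m * p.1) * H p.2) =ᵐ[domainMeasure ε] 0) :
    ∀ᵐ y ∂bandMeasure ε, H y = 0 := by
  filter_upwards [ae_ae_of_ae_domain h] with y hy
  have h1 : ∫ x, Real.cos (m * x) * Real.cos (m * x) * H y ∂torusMeasure = 0 := by
    rw [← integral_zero ℝ ℝ (μ := torusMeasure)]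
    refine integral_congr_ae ?_
    filter_upwards [hy] with x hx
    rw [mul_assoc, hx]; simp
  rw [integral_mul_const, integral_cos_mul_cos m hm, if_pos rfl] at h1
  exact (mul_eq_zero.1 h1).resolve_left Real.pi_ne_zero

/-- A function of `X` all of whose Fourier modes but one vanish is determined by the remaining
mode. -/
theorem MemX.ae_eq_of_modes {ε : ℝ} {g : ℝ × ℝ → ℝ} (hg : MemX ε g) {m : ℕ} (hm : 1 ≤ m)
    {H : ℝ → ℝ} (hH : ContinuousOn H (bands ε)) {k : ℝ}
    (hgm : ∀ᵐ y ∂bandMeasure ε,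
      ∫ x, Real.sin (m * x) * weakDx ε g (x, y) ∂torusMeasure = k * H y)
    (hgn : ∀ n : ℕ, 1 ≤ n → n ≠ m → ∀ᵐ y ∂bandMeasure ε,
      ∫ x, Real.sin (n * x) * weakDx ε g (x, y) ∂torusMeasure = 0) :
    g =ᵐ[domainMeasure ε] fun p => -k / (m * Real.pi) * (Real.cos (m * p.1) * H p.2) := by
  set c := -k / (m * Real.pi) with hc
  have hm0 : (m : ℝ) ≠ 0 := by positivity
  have hpi := Real.pi_ne_zero
  have hgL := hg.sobolev.memLp
  have hgi := hgL.integrable one_le_two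
  rw [domainMeasure_eq] at hgi
  have hh : MemLp (fun p : ℝ × ℝ => c * (Real.cos (m * p.1) * H p.2)) 2 (domainMeasure ε) :=
    (memLp_separated (f := fun x => Real.cos (m * x)) (by fun_prop) hH).const_mul c
  have split : ∀ f : ℝ → ℝ, Continuous f → (∀ x, |f x| ≤ 1) → ∀ᵐ y ∂bandMeasure ε,
      ∫ x, f x * (g (x, y) - c * (Real.cos (m * x) * H y)) ∂torusMeasure =
      (∫ x, f x * g (x, y) ∂torusMeasure) -
        (∫ x, f x * Real.cos (m * x) ∂torusMeasure) * (c * H y) := by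
    intro f hf hf1
    filter_upwards [hgi.prod_left_ae] with y hy
    have i1 : Integrable (fun x => f x * g (x, y)) torusMeasure :=
      hy.bdd_mul (c := 1) hf.aestronglyMeasurable (Filter.Eventually.of_forall hf1)
    have i2 : Integrable (fun x => f x * Real.cos (m * x)) torusMeasure :=
      ((by fun_prop : Continuous fun x => f x * Real.cos (m * x)).continuousOn).integrableOn_compact
        isCompact_Icc
    rw [← integral_mul_const, ← integral_sub i1 (i2.mul_const _)]
    congr 1; ext x; ring
  have hd := ae_eq_zero_of_fourier_domain (hgL.sub hh) (fun n => ?_) (fun n => ?_)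
  · filter_upwards [hd] with p hp
    exact sub_eq_zero.1 hp
  · have hcoef := hg.fourier_weakDx n
    rcases Nat.eq_zero_or_pos n with h0 | h0
    · subst h0
      filter_upwards [split (fun x => Real.cos ((0 : ℕ) * x)) (by fun_prop)
        (fun _ => Real.abs_cos_le_one _), hg.integral_eq_zero] with y h1 h2
      simp only [Pi.sub_apply]
      rw [h1, integral_cos_mul_cos 0 hm, if_neg (by omega)]
      simpa using h2
    · have hn0 : (n : ℝ) ≠ 0 := by positivity
      by_cases hnm : n = m
      · subst hnm
        filter_upwards [split (fun x => Real.cos (n * x)) (by fun_prop)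
          (fun _ => Real.abs_cos_le_one _), hcoef, hgm] with y h1 h2 h3
        simp only [Pi.sub_apply]
        rw [h3] at h2
        rw [h1, integral_cos_mul_cos n hm, if_pos rfl, hc]
        apply mul_left_cancel₀ hn0
        field_simp
        linarith
      · filter_upwards [split (fun x => Real.cos (n * x)) (by fun_prop)
          (fun _ => Real.abs_cos_le_one _), hcoef, hgn n h0 hnm] with y h1 h2 h3
        simp only [Pi.sub_apply]
        rw [h3, add_zero] at h2
        rw [h1, integral_cos_mul_cos n hm, if_neg hnm, (mul_eq_zero.1 h2).resolve_left hn0]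
        ring
  · filter_upwards [split (fun x => Real.sin (n * x)) (by fun_prop)
        (fun _ => Real.abs_sin_le_one _), hg.integral_sin_eq_zero n] with y h1 h2
    simp only [Pi.sub_apply]
    rw [h1, h2, integral_sin_mul_cos]; ring

end CouetteWave

theorem theorem4p1 (M : ℝ) (hM : 1 < M) :
    ∃ κ₀ ε₀ C : ℝ, 0 < κ₀ ∧ 0 < ε₀ ∧ 0 < C ∧
      ∀ Θ : ℝ → ℝ, CouetteWave.IsMollifier Θ →
      ∀ κ : ℝ, 0 ≤ κ → κ < κ₀ →
      ∀ m : ℕ, 1 ≤ m → (m : ℝ) < M →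
      ∃ lam₁ : ℝ, |lam₁| ≤ C ∧
        ∀ ε : ℝ, 0 < ε → ε < ε₀ →
        ∃ (lam : ℝ) (h : ℝ × ℝ → ℝ),
          |lam - (1 + lam₁ * ε)| ≤ C * ε ^ 2 ∧
          CouetteWave.MemX ε h ∧
          ContDiffOn ℝ ∞ h (Set.univ ×ˢ CouetteWave.bands ε) ∧
          (∀ x, ∀ y ∈ CouetteWave.bands ε, h (x + 2 * Real.pi / m, y) = h (x, y)) ∧
          (¬ h =ᵐ[CouetteWave.domainMeasure ε] 0) ∧
          (∃ y ∈ CouetteWave.bands ε, ∃ x x' : ℝ, h (x, y) ≠ h (x', y)) ∧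
          CouetteWave.linOp Θ ε κ lam h =ᵐ[CouetteWave.domainMeasure ε] 0 ∧
          ∀ g : ℝ × ℝ → ℝ, CouetteWave.MemX ε g →
            (CouetteWave.linOp Θ ε κ lam g =ᵐ[CouetteWave.domainMeasure ε] 0 ↔
              ∃ c : ℝ, g =ᵐ[CouetteWave.domainMeasure ε] fun p => c * h p) := by
  open CouetteWave in
  set c := Real.exp (-(4 * M)) with hc
  have hc0 : 0 < c := Real.exp_pos _
  have hc1 : c ≤ 1 / 2 := by
    have h1 : c * Real.exp (4 * M) = 1 := by rw [hc, ← Real.exp_add]; simp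
    have h2 := Real.add_one_le_exp (4 * M)
    nlinarith
  obtain ⟨ε₀, C, hε₀, hε₀c, hC, hspeed⟩ := exists_speed hM hc0 hc1
  refine ⟨c / 2, ε₀, C + 1, by positivity, hε₀, by positivity, ?_⟩
  intro Θ hΘ κ hκ hκ0 m hm hmM
  have hκ1 : κ < 1 / 2 := by linarith
  set a := density Θ κ with ha_def
  have ha : ContDiff ℝ ∞ a := hΘ.contDiff_density hκ
  have hac := ha.continuous
  have ha0 : ∀ z, 0 ≤ a z := hΘ.density_nonneg hκ hκ1
  have ha1 : ∫ z in (-1 : ℝ)..1, a z = 1 := hΘ.integral_density hκ hκ1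
  have : IsProbabilityMeasure (segMeasure a) := isProbabilityMeasure_segMeasure hac ha0 ha1
  obtain ⟨mu₁, hmu1, hmu2, hF⟩ := exists_dispersion_eq (segMeasure a) hc0 hc1
    (hΘ.le_dispersion hM hκ hκ0) hm hmM
  refine ⟨mu₁, by rw [abs_of_nonneg (by linarith)]; linarith, ?_⟩
  intro ε hε hεlt
  have hε1 : ε < 1 := by linarith
  have hq := abs_minMean_le (segMeasure a)
  obtain ⟨mu, hmu, hmuc, b, u, hbu, hne, huniq, htriv⟩ := hspeed (segMeasure a)
    (minMean (segMeasure a)) hq m hm hmM mu₁ hmu1 hmu2 hF ε hε hεlt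
  have hD : ∀ z : Seg, mu + 1 - z + ε * minMean (segMeasure a) z ≠ 0 := fun z h0 => by
    have := lower_symbol_ge hq hε.le (by linarith : ε ≤ c / 4) hmuc z
    linarith
  have hA : ∀ z : Seg, 2 + ε * (mu + z - 1 - ε * minMean (segMeasure a) z) ≠ 0 := fun z h0 => by
    have := upper_symbol_ge hq hε.le (by linarith : ε ≤ 1 / 4) (by linarith : 0 ≤ mu) z
    linarith
  obtain ⟨hbs, hus⟩ := hbu.contDiffOn ha ha0 hD hA
  set H := bandProfile b u ε with hH_def
  have hH : ContDiffOn ℝ ∞ H (bands ε) := contDiffOn_bandProfile hε hε1 b u hbs hus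
  have hHi : Integrable H (bandMeasure ε) := integrable_bandProfile hε hε1 b u
  have hm0 : (m : ℝ) ≠ 0 := by positivity
  have hX := memX_separated hε hH hm
  have hHne : ¬ ∀ᵐ y ∂bandMeasure ε, H y = 0 := fun h0 => by
    obtain ⟨h1, h2⟩ := eq_zero_of_bandProfile_ae hε hε1 h0
    rcases hne with h | h
    · exact h h1
    · exact h h2
  have hσ := measurable_bandSlope hac ε
  obtain ⟨S, hS⟩ := exists_bandSlope_bound hac (ε := ε)
  have hσe : deriv (profile Θ ε κ) =ᵐ[bandMeasure ε] bandSlope a ε := by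
    filter_upwards [ae_bandMeasure_mem_interior ε] with y hy
    exact hΘ.deriv_profile hκ hε hε1 hy
  have hmode := modeOp_eq_zero_of_modeEq hε hε1 ha ha0 ha1 hbu hHi
    (fun z hz => bandProfile_lower hε hε1 b u hz) (fun z hz => bandProfile_upper hε hε1 b u hz)
  have hker : ∀ g, MemX ε g → ∀ k : ℝ,
      g =ᵐ[domainMeasure ε] (fun p => k * (Real.cos (m * p.1) * H p.2)) →
      linOp Θ ε κ (1 + ε * mu) g =ᵐ[domainMeasure ε] 0 := by
    intro g hg k hgk
    refine linOp_eq_zero_of_modeOp hε1 hσ hS hσe hm (hHi.const_mul (-(k * m)))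
      (weakDx_separated hε hg hH hgk) ?_
    filter_upwards [hmode] with y hy
    rw [modeOp_const_mul, hy, mul_zero]
  refine ⟨1 + ε * mu, fun p => Real.cos (m * p.1) * H p.2, ?_, hX, ?_, ?_, ?_, ?_, ?_, ?_⟩
  · have e : 1 + ε * mu - (1 + mu₁ * ε) = ε * (mu - mu₁) := by ring
    rw [e, abs_mul, abs_of_pos hε]
    nlinarith [sq_nonneg ε]
  · exact ContDiffOn.mul (ContDiff.contDiffOn (by fun_prop))
      (hH.comp contDiffOn_snd fun p hp => hp.2)
  · intro x y _
    have e : (m : ℝ) * (x + 2 * Real.pi / m) = m * x + 2 * Real.pi := by field_simp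
    simp only [e, Real.cos_add_two_pi]
  · exact fun h0 => hHne (ae_eq_zero_of_separated hm h0)
  · by_contra hcon
    push Not at hcon
    refine hHne ?_
    filter_upwards [ae_bandMeasure_mem ε] with y hy
    have h1 := hcon y hy 0 (Real.pi / m)
    have e : (m : ℝ) * (Real.pi / m) = Real.pi := by field_simp
    simp only [mul_zero, Real.cos_zero, e, Real.cos_pi] at h1
    linarith
  · exact hker _ hX 1 (Filter.Eventually.of_forall fun p => by simp)
  · intro g hg
    refine ⟨fun hlin => ?_, fun ⟨k, hk⟩ => hker g hg k hk⟩
    have hwi : Integrable (weakDx ε g) (domainMeasure ε) :=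
      hg.isWeakPartial_weakDx.1.integrable one_le_two
    have hmodes : ∀ n : ℕ, 1 ≤ n → ∃ b' u' : C(Seg, ℝ),
        ModeEq (segMeasure a) (minMean (segMeasure a)) ε mu n b' u' ∧
        ∀ᵐ y ∂bandMeasure ε, ∫ x, Real.sin (n * x) * weakDx ε g (x, y) ∂torusMeasure =
          bandProfile b' u' ε y := by
      intro n hn
      obtain ⟨b', u', h1, h2, h3⟩ := exists_modeEq_of_modeOp hε hε1 ha ha0 ha1 hD hA
        (integrable_integral_slice hwi (f := fun x => Real.sin (n * x)) (by fun_prop)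
          (fun _ => Real.abs_sin_le_one _))
        (modeOp_eq_zero_of_linOp hε1 hσ hS hσe hwi hlin hn)
      exact ⟨b', u', h1, ae_eq_bandProfile hε hε1 b' u' h2 h3⟩
    obtain ⟨b', u', h1, h2⟩ := hmodes m hm
    obtain ⟨k, rfl, rfl⟩ := huniq b' u' h1
    refine ⟨_, hg.ae_eq_of_modes hm hH.continuousOn (k := k) ?_ fun n hn hnm => ?_⟩
    · filter_upwards [h2] with y hy
      rw [hy, bandProfile_smul]
    · obtain ⟨b', u', h1, h2⟩ := hmodes n hn
      obtain ⟨rfl, rfl⟩ := htriv n hn hnm b' u' h1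
      filter_upwards [h2] with y hy
      rw [hy, bandProfile_zero]
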